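/- **Fell absorption for exotic crossed products.** Let $G$ be a locally compact Hausdorff group with a fixed Haar measure $ds$. For a $G$-C*-algebra $(A,\alpha)$ let $A\rtimes_{\max}G$ and $A\rtimes_r G$ be the maximal and reduced crossed products (completions of $C_c(G,A)$), and let $\iota_A\colon A\to\mathcal M(A\rtimes_{\max}G)$, $\iota_G\colon G\to\mathcal{UM}(A\rtimes_{\max}G)$ be the universal covariant representation, given by $(\iota_A(a)f)(t)=af(t)$ and $(\iota_G(s)f)(t)=\alpha_s(f(s^{-1}t))$ for $f\in C_c(G,A)$. A *crossed product functor* $-\rtimes_\mu G$ is a functor from $G$-C*-algebras with equivariant *-homomorphisms to C*-algebras, with natural transformations $q\colon -\rtimes_{\max}G\to-\rtimes_\mu G$ and $s\colon-\rtimes_\mu G\to-\rtimes_r G$ consisting of surjective *-homomorphisms such that $s\circ q$ is the canonical map $-\rtimes_{\max}G\to-\rtimes_rG$. It is a *correspondence* crossed product functor if for every $G$-equivariant completely positive map $\varphi\colon A\to B$ there is a completely positive map $A\rtimes_\mu G\to B\rtimes_\mu G$ with $f\mapsto\varphi\circ f$ for $f\in C_c(G,A)$. Write $C^*_\mu G=\mathbb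 C\rtimes_\mu G$ and $C^*_{\max}G=\mathbb C\rtimes_{\max}G$, let $u_{G,\mu}\colon G\to\mathcal{UM}(C^*_\mu G)$ and $u_{G,\max}\colon G\to\mathcal{UM}(C^*_{\max}G)$ be the canonical unitary representations (left translation on $C_c(G)$), and for a C*-algebra $B$ put $B\otimes_\mu C^*_\mu G:=B\rtimes_{\mu,\mathrm{id}}G$ (trivial action). Here $(b,c)\mapsto b\otimes c$ is the continuous bilinear map $B\times C^*_\mu G\to B\otimes_\mu C^*_\mu G$ that sends $b$ and $f\in C_c(G)$ to the function $s\mapsto f(s)b$. Let $-\rtimes_\mu G$ be a correspondence crossed product functor. 1. Let $A$ be a $G$-C*-algebra. There are a *-homomorphism $\iota_A\otimes_\mu1\colon A\to\mathcal M((A\rtimes_{\max}G)\otimes_\mu C^*_\mu G)$ and a group homomorphism $\iota_G\otimes_\mu u_{G,\mu}\colon G\to\mathcal{UM}((A\rtimes_{\max}G)\otimes_\mu C^*_\mu G)$ with $$(\iota_A\otimes_\mu1)(a)(b\otimes c)=\iota_A(a)b\otimes c,\qquad(\iota_G\otimes_\mu u_{G,\mu})(s)(b\otimes c)=\iota_G(s)b\otimes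 u_{G,\mu}(s)c$$ for all $a\in A$, $s\in G$, $b\in A\rtimes_{\max}G$, $c\in C^*_\mu G$. They form a nondegenerate covariant representation of $A$. Its integrated form $\Phi\colon A\rtimes_{\max}G\to\mathcal M((A\rtimes_{\max}G)\otimes_\mu C^*_\mu G)$, $\Phi(f)=\int_G(\iota_A\otimes_\mu1)(f(s))\,(\iota_G\otimes_\mu u_{G,\mu})(s)\,ds$ for $f\in C_c(G,A)$, factors through $q_A$: there is a unique *-homomorphism $\Psi\colon A\rtimes_\mu G\to\mathcal M((A\rtimes_{\max}G)\otimes_\mu C^*_\mu G)$ with $\Phi=\Psi\circ q_A$. If $G$ is discrete, then $\Psi$ is injective. 2. The coproduct $g\mapsto g\otimes g$ extends to $C^*_\mu G$. That is, there are a group homomorphism $W\colon G\to\mathcal{UM}(C^*_{\max}G\otimes_\mu C^*_\mu G)$ with $W_g(b\otimes c)=u_{G,\max}(g)b\otimes u_{G,\mu}(g)c$, and a nondegenerate *-homomorphism $\Delta\colon C^*_\mu G\to\mathcal M(C^*_{\max}G\otimes_\mu C^*_\mu G)$ with $\Delta(u_{G,\mu}(g)x)=W_g\Delta(x)$ for all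 $g\in G$, $x\in C^*_\mu G$. If $G$ is discrete, then the unitaries $u_{G,\max}(g)$ and $u_{G,\mu}(g)$ lie in $C^*_{\max}G$ and $C^*_\mu G$, and there is a *-homomorphism $\Delta\colon C^*_\mu G\to C^*_{\max}G\otimes_\mu C^*_\mu G$ with $\Delta(u_{G,\mu}(g))=u_{G,\max}(g)\otimes u_{G,\mu}(g)$ for all $g\in G$. -/

import Mathlib

open MeasureTheory
open scoped MultiplierAlgebra ENNReal CompactlySupported CStarAlgebra InnerProductSpace

universe u

namespace ExoticCP

noncomputable section

/-! ### Actions of a topological group on C*-algebras -/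

/-- A `G`-C*-algebra: a C*-algebra with a strongly continuous action of `G` by *-automorphisms
(each `act s` is invertible with inverse `act s⁻¹`). -/
structure GCStarAlg (G : Type u) [Group G] [TopologicalSpace G] where
  carrier : Type u
  [str : NonUnitalCStarAlgebra carrier]
  act : G → carrier →⋆ₙₐ[ℂ] carrier
  act_one : ∀ a, act 1 a = a
  act_mul : ∀ s t a, act (s * t) a = act s (act t a)
  continuous_act : ∀ a, Continuous fun s => act s a

variable {G : Type u} [Group G] [TopologicalSpace G]

instance : CoeSort (GCStarAlg G) (Type u) := ⟨GCStarAlg.carrier⟩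

instance (A : GCStarAlg G) : NonUnitalCStarAlgebra A := A.str

/-- A C*-algebra with the trivial action of `G`. -/
def GCStarAlg.trivial (G : Type u) [Group G] [TopologicalSpace G]
    (B : Type u) [NonUnitalCStarAlgebra B] : GCStarAlg G where
  carrier := B
  act _ := NonUnitalStarAlgHom.id ℂ B
  act_one _ := rfl
  act_mul _ _ _ := rfl
  continuous_act _ := continuous_const

/-- The complex numbers, as a C*-algebra in the universe `u`. -/
instance ulComplexStr : NonUnitalCStarAlgebra (ULift.{u} ℂ) where
  star z := ⟨star z.down⟩
  star_involutive z := by ext; simp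
  star_mul z w := by ext; simp [mul_comm]
  star_add z w := by ext; simp
  norm_mul_self_le z := by
    have h := CStarRing.norm_star_mul_self (x := z.down)
    exact h.ge
  star_smul r z := by ext; simp

/-- The complex numbers with the trivial action of `G`. -/
def GCStarAlg.scalars (G : Type u) [Group G] [TopologicalSpace G] : GCStarAlg G :=
  GCStarAlg.trivial G (ULift.{u} ℂ)

/-- Equivariant *-homomorphisms. -/
structure GHom (A B : GCStarAlg G) where
  hom : A →⋆ₙₐ[ℂ] B
  equivariant : ∀ s a, hom (A.act s a) = B.act s (hom a)

def GHom.id (A : GCStarAlg G) : GHom A A := ⟨NonUnitalStarAlgHom.id ℂ A, fun _ _ => rfl⟩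

def GHom.comp {A B C : GCStarAlg G} (ψ : GHom B C) (φ : GHom A B) : GHom A C where
  hom := ψ.hom.comp φ.hom
  equivariant s a := by simp [φ.equivariant, ψ.equivariant]

/-! ### Operations on compactly supported functions -/

section Cc

/-- The function `s ↦ a f(s)`. -/
def constMul {A : GCStarAlg G} (a : A) (f : C_c(G, A)) : C_c(G, A) where
  toFun s := a * f s
  continuous_toFun := continuous_const.mul f.continuous
  hasCompactSupport' := f.hasCompactSupport.mul_left

/-- The function `s ↦ f(s) b`, for scalar-valued `f`. -/
def smulConst {B : Type u} [NonUnitalCStarAlgebra B] (f : C_c(G, GCStarAlg.scalars G)) (b : B) :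
    C_c(G, GCStarAlg.trivial G B) :=
  ({ toFun := fun s => (ULift.down (α := ℂ) (f s)) • b
     continuous_toFun := (continuous_uliftDown.comp f.continuous).smul continuous_const
     hasCompactSupport' := f.hasCompactSupport.comp_left
       (g := fun z : ULift.{u} ℂ => z.down • b) (zero_smul ℂ b) } : C_c(G, B))

theorem continuous_act_uncurry (A : GCStarAlg G) :
    Continuous fun p : G × A => A.act p.1 p.2 := by
  rw [continuous_iff_continuousAt]
  rintro ⟨s, a⟩
  rw [ContinuousAt, tendsto_iff_norm_sub_tendsto_zero]
  have h1 : Filter.Tendsto (fun p : G × A => ‖p.2 - a‖ + ‖A.act p.1 a - A.act s a‖)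
      (nhds (s, a)) (nhds 0) := by
    have : Continuous fun p : G × A => ‖p.2 - a‖ + ‖A.act p.1 a - A.act s a‖ := by
      have := A.continuous_act a
      fun_prop
    simpa using this.tendsto (s, a)
  refine squeeze_zero (fun _ => norm_nonneg _) (fun p => ?_) h1
  calc ‖A.act p.1 p.2 - A.act s a‖
      = ‖A.act p.1 (p.2 - a) + (A.act p.1 a - A.act s a)‖ := by rw [map_sub]; abel_nf
    _ ≤ _ := (norm_add_le _ _).trans (by
        gcongr; exact NonUnitalStarAlgHom.norm_apply_le (A.act p.1) _)

variable [IsTopologicalGroup G]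

/-- The function `t ↦ α_s(f(s⁻¹ t))`, where `α` is the action on the coefficients. -/
def translate {A : GCStarAlg G} (s : G) (f : C_c(G, A)) : C_c(G, A) where
  toFun t := A.act s (f (s⁻¹ * t))
  continuous_toFun := (continuous_act_uncurry A).comp
    (continuous_const.prodMk (f.continuous.comp (continuous_const.mul continuous_id)))
  hasCompactSupport' := (f.hasCompactSupport.comp_homeomorph (Homeomorph.mulLeft s⁻¹)).comp_left
    (g := fun a => A.act s a) (map_zero _)

end Cc

/-! ### Integration of strongly continuous operator families -/

section opIntegral

variable [MeasurableSpace G] [BorelSpace G] (ν : Measure G) [IsFiniteMeasureOnCompacts ν]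
  {X : Type u} [NormedAddCommGroup X] [NormedSpace ℂ X]
  {E : Type u} [NormedAddCommGroup E]

theorem integrable_apply {Φ : G → X →L[ℂ] X} (f : C_c(G, E)) (hΦ : ∀ x, Continuous fun s => Φ s x)
    (hb : ∀ s, ‖Φ s‖ ≤ ‖f s‖) (x : X) : Integrable (fun s => Φ s x) ν := by
  refine (hΦ x).integrable_of_hasCompactSupport (f.hasCompactSupport.mono fun s hs => ?_)
  intro h0
  apply hs
  have : Φ s = 0 := norm_le_zero_iff.1 ((hb s).trans (by simp [h0]))
  simp [this]

theorem integrable_norm (f : C_c(G, E)) : Integrable (fun s => ‖f s‖) ν :=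
  f.continuous.norm.integrable_of_hasCompactSupport f.hasCompactSupport.norm

/-- The operator `x ↦ ∫ Φ(s) x ds`, for a strongly continuous family `Φ` of operators that is
dominated in norm by a compactly supported function `f`. -/
def opIntegral [CompleteSpace X] (Φ : G → X →L[ℂ] X) (f : C_c(G, E))
    (hΦ : ∀ x, Continuous fun s => Φ s x) (hb : ∀ s, ‖Φ s‖ ≤ ‖f s‖) : X →L[ℂ] X :=
  LinearMap.mkContinuous
    { toFun := fun x => ∫ s, Φ s x ∂ν
      map_add' := fun x y => by
        simp only [map_add]
        exact integral_add (integrable_apply ν f hΦ hb x) (integrable_apply ν f hΦ hb y)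
      map_smul' := fun c x => by
        simp only [map_smul, RingHom.id_apply]
        exact integral_smul c _ }
    (∫ s, ‖f s‖ ∂ν) fun x => by
      rw [← integral_mul_const]
      refine norm_integral_le_of_norm_le ((integrable_norm ν f).mul_const _)
        (Filter.Eventually.of_forall fun s => ?_)
      exact ((Φ s).le_opNorm x).trans (by gcongr; exact hb s)

theorem opIntegral_apply [CompleteSpace X] (Φ : G → X →L[ℂ] X) (f : C_c(G, E))
    (hΦ : ∀ x, Continuous fun s => Φ s x) (hb : ∀ s, ‖Φ s‖ ≤ ‖f s‖) (x : X) :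
    opIntegral ν Φ f hΦ hb x = ∫ s, Φ s x ∂ν := rfl

theorem norm_opIntegral_le [CompleteSpace X] (Φ : G → X →L[ℂ] X) (f : C_c(G, E))
    (hΦ : ∀ x, Continuous fun s => Φ s x) (hb : ∀ s, ‖Φ s‖ ≤ ‖f s‖) :
    ‖opIntegral ν Φ f hΦ hb‖ ≤ ∫ s, ‖f s‖ ∂ν :=
  LinearMap.mkContinuous_norm_le _ (integral_nonneg fun _ => norm_nonneg _) _

end opIntegral

/-! ### Covariant representations in multiplier algebras and their integrated forms -/

/-- A covariant representation of the `G`-C*-algebra `A` in the multiplier algebra of `D`. -/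
structure CovRep (A : GCStarAlg G) (D : Type u) [NonUnitalCStarAlgebra D] where
  π : A →⋆ₙₐ[ℂ] 𝓜(ℂ, D)
  U : G →* unitary 𝓜(ℂ, D)
  /-- strict continuity of `U` -/
  continuous_left : ∀ d, Continuous fun s => (U s : 𝓜(ℂ, D)).fst d
  continuous_right : ∀ d, Continuous fun s => (U s : 𝓜(ℂ, D)).snd d
  covariant : ∀ s a, π (A.act s a) = (U s : 𝓜(ℂ, D)) * π a * star (U s : 𝓜(ℂ, D))

section integrate

variable {A : GCStarAlg G} {D : Type u} [NonUnitalCStarAlgebra D]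

/-- A covariant representation `(π, U)` is nondegenerate if `π(A)D` spans a dense subspace. -/
def CovRep.Nondegenerate (ρ : CovRep A D) : Prop :=
  Dense (Submodule.span ℂ {x : D | ∃ a d, x = (ρ.π a).fst d} : Set D)

theorem norm_unitary_le (u : unitary 𝓜(ℂ, D)) : ‖(u : 𝓜(ℂ, D))‖ ≤ 1 := by
  have h : ‖(u : 𝓜(ℂ, D))‖ * ‖(u : 𝓜(ℂ, D))‖ = ‖(1 : 𝓜(ℂ, D))‖ := by
    rw [← CStarRing.norm_star_mul_self, Unitary.coe_star_mul_self]
  have h1 : ‖(1 : 𝓜(ℂ, D))‖ ≤ 1 := by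
    rw [← DoubleCentralizer.norm_fst, DoubleCentralizer.one_fst]
    exact ContinuousLinearMap.norm_id_le
  nlinarith [norm_nonneg (u : 𝓜(ℂ, D))]

theorem norm_pi_mul_le (ρ : CovRep A D) (a : A) (s : G) :
    ‖ρ.π a * (ρ.U s : 𝓜(ℂ, D))‖ ≤ ‖a‖ := by
  refine (norm_mul_le _ _).trans ?_
  calc ‖ρ.π a‖ * ‖(ρ.U s : 𝓜(ℂ, D))‖ ≤ ‖a‖ * 1 := by
        gcongr
        · exact NonUnitalStarAlgHom.norm_apply_le ρ.π a
        · exact norm_unitary_le _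
    _ = _ := mul_one _

theorem continuous_pi (ρ : CovRep A D) : Continuous ρ.π :=
  AddMonoidHomClass.continuous_of_bound ρ.π 1 fun a => by
    simpa using NonUnitalStarAlgHom.norm_apply_le ρ.π a

theorem continuous_leftMul : Continuous fun m : 𝓜(ℂ, D) => m.fst :=
  AddMonoidHomClass.continuous_of_bound
    ((AddMonoidHom.fst _ _).comp (DoubleCentralizer.toProdHom (𝕜 := ℂ) (A := D))) 1 fun m => by
      simp

theorem continuous_rightMul : Continuous fun m : 𝓜(ℂ, D) => m.snd :=
  AddMonoidHomClass.continuous_of_bound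
    ((AddMonoidHom.snd _ _).comp (DoubleCentralizer.toProdHom (𝕜 := ℂ) (A := D))) 1 fun m => by
      simp

theorem continuous_integrand_fst (ρ : CovRep A D) (f : C_c(G, A)) (d : D) :
    Continuous fun s => (ρ.π (f s) * (ρ.U s : 𝓜(ℂ, D))).fst d := by
  have h : Continuous fun s => (ρ.π (f s)).fst :=
    continuous_leftMul.comp ((continuous_pi ρ).comp f.continuous)
  simpa using h.clm_apply (ρ.continuous_left d)

theorem continuous_integrand_snd (ρ : CovRep A D) (f : C_c(G, A)) (d : D) :
    Continuous fun s => (ρ.π (f s) * (ρ.U s : 𝓜(ℂ, D))).snd d := by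
  have h : Continuous fun s => (ρ.π (f s)).snd d :=
    (continuous_rightMul.comp ((continuous_pi ρ).comp f.continuous)).clm_apply continuous_const
  change Continuous fun s => (ρ.U s : 𝓜(ℂ, D)).snd ((ρ.π (f s)).snd d)
  rw [continuous_iff_continuousAt]
  intro s₀
  rw [ContinuousAt, tendsto_iff_norm_sub_tendsto_zero]
  have h1 : Filter.Tendsto (fun s => ‖(ρ.π (f s)).snd d - (ρ.π (f s₀)).snd d‖ +
      ‖(ρ.U s : 𝓜(ℂ, D)).snd ((ρ.π (f s₀)).snd d) -
        (ρ.U s₀ : 𝓜(ℂ, D)).snd ((ρ.π (f s₀)).snd d)‖) (nhds s₀) (nhds 0) := by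
    have : Continuous fun s => ‖(ρ.π (f s)).snd d - (ρ.π (f s₀)).snd d‖ +
      ‖(ρ.U s : 𝓜(ℂ, D)).snd ((ρ.π (f s₀)).snd d) -
        (ρ.U s₀ : 𝓜(ℂ, D)).snd ((ρ.π (f s₀)).snd d)‖ := by
      have := ρ.continuous_right ((ρ.π (f s₀)).snd d)
      fun_prop
    simpa using this.tendsto s₀
  refine squeeze_zero (fun _ => norm_nonneg _) (fun s => ?_) h1
  calc _ = ‖(ρ.U s : 𝓜(ℂ, D)).snd ((ρ.π (f s)).snd d - (ρ.π (f s₀)).snd d) +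
      ((ρ.U s : 𝓜(ℂ, D)).snd ((ρ.π (f s₀)).snd d) -
        (ρ.U s₀ : 𝓜(ℂ, D)).snd ((ρ.π (f s₀)).snd d))‖ := by
        rw [map_sub]; congr 1; abel
    _ ≤ _ := (norm_add_le _ _).trans (by
        gcongr
        refine (ContinuousLinearMap.le_of_opNorm_le _ (c := 1) ?_ _).trans (by simp)
        rw [DoubleCentralizer.norm_snd]
        exact norm_unitary_le _)

variable [MeasurableSpace G] [BorelSpace G] (ν : Measure G) [IsFiniteMeasureOnCompacts ν]

/-- The integrated form of a covariant representation `(π, U)` on `f ∈ C_c(G, A)`: the multiplier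
`∫ π(f(s)) U_s ds` (strict integral), given by `d ↦ ∫ π(f(s)) U_s d ds` as a left multiplier and by
`d ↦ ∫ d π(f(s)) U_s ds` as a right multiplier. -/
def CovRep.integrate (ρ : CovRep A D) (f : C_c(G, A)) : 𝓜(ℂ, D) where
  fst := opIntegral ν (fun s => (ρ.π (f s) * (ρ.U s : 𝓜(ℂ, D))).fst) f
    (continuous_integrand_fst ρ f)
    fun s => (DoubleCentralizer.norm_fst _).le.trans (norm_pi_mul_le ρ (f s) s)
  snd := opIntegral ν (fun s => (ρ.π (f s) * (ρ.U s : 𝓜(ℂ, D))).snd) f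
    (continuous_integrand_snd ρ f)
    fun s => (DoubleCentralizer.norm_snd _).le.trans (norm_pi_mul_le ρ (f s) s)
  central x y := by
    have h1 := integrable_apply ν f (continuous_integrand_fst ρ f)
      (fun s => (DoubleCentralizer.norm_fst _).le.trans (norm_pi_mul_le ρ (f s) s)) y
    have h2 := integrable_apply ν f (continuous_integrand_snd ρ f)
      (fun s => (DoubleCentralizer.norm_snd _).le.trans (norm_pi_mul_le ρ (f s) s)) x
    rw [opIntegral_apply, opIntegral_apply]
    have e1 := ((ContinuousLinearMap.mul ℂ D).flip y).integral_comp_comm h2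
    have e2 := (ContinuousLinearMap.mul ℂ D x).integral_comp_comm h1
    simp only [ContinuousLinearMap.flip_apply, ContinuousLinearMap.mul_apply'] at e1 e2
    rw [← e1, ← e2]
    exact integral_congr_ae (Filter.Eventually.of_forall fun s => DoubleCentralizer.central _ x y)

theorem CovRep.norm_integrate_le (ρ : CovRep A D) (f : C_c(G, A)) :
    ‖ρ.integrate ν f‖ ≤ ∫ s, ‖f s‖ ∂ν := by
  rw [← DoubleCentralizer.norm_fst]
  exact norm_opIntegral_le ν (fun s => (ρ.π (f s) * (ρ.U s : 𝓜(ℂ, D))).fst) f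
    (continuous_integrand_fst ρ f)
    fun s => (DoubleCentralizer.norm_fst _).le.trans (norm_pi_mul_le ρ (f s) s)

end integrate

/-! ### The C*-subalgebra generated by a family of elements -/

section generated

variable {L : Type*} [NonUnitalCStarAlgebra L] {S : Type*} (v : S → L)

/-- The C*-subalgebra generated by the elements `v s`. -/
def genSub : NonUnitalStarSubalgebra ℂ L :=
  (NonUnitalStarAlgebra.adjoin ℂ (Set.range v)).topologicalClosure

instance : NonUnitalCStarAlgebra (genSub v) :=
  haveI : IsClosed (genSub v : Set L) := NonUnitalStarSubalgebra.isClosed_topologicalClosure _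
  NonUnitalStarSubalgebra.nonUnitalCStarAlgebra (genSub v)

/-- The element `v s` of the generated C*-subalgebra. -/
def genMap (s : S) : genSub v :=
  ⟨v s, NonUnitalStarSubalgebra.le_topologicalClosure _
    (NonUnitalStarAlgebra.subset_adjoin ℂ _ ⟨s, rfl⟩)⟩

end generated

/-! ### The maximal crossed product -/

section maximal

variable [MeasurableSpace G] [BorelSpace G] (ν : Measure G) [IsFiniteMeasureOnCompacts ν]

/-- The set of all functions `f ↦ ‖(π ⋊ U)(f)‖` on `C_c(G, A)`, for the covariant representations
`(π, U)` of `A` in multiplier algebras of arbitrary C*-algebras. -/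
def covNorms (A : GCStarAlg G) : Set (C_c(G, A) → ℝ) :=
  {p | ∃ (D : Type u) (_ : NonUnitalCStarAlgebra D) (ρ : CovRep A D),
    p = fun f => ‖ρ.integrate ν f‖}

/-- A C*-algebra `D` carrying a covariant representation whose integrated form has norm
function `p`. -/
def CovAlg {A : GCStarAlg G} (p : covNorms ν A) : Type u := p.2.choose

instance {A : GCStarAlg G} (p : covNorms ν A) : NonUnitalCStarAlgebra (CovAlg ν p) :=
  p.2.choose_spec.choose

/-- A covariant representation whose integrated form has norm function `p`. -/
def covRepOf {A : GCStarAlg G} (p : covNorms ν A) : CovRep A (CovAlg ν p) :=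
  p.2.choose_spec.choose_spec.choose

/-- The integrated form of `f` in the direct sum of one covariant representation of `A` for each
norm function, so that its norm is the supremum of `‖(π ⋊ U)(f)‖` over all covariant
representations of `A`. -/
def maxVec (A : GCStarAlg G) (f : C_c(G, A)) :
    lp (fun p : covNorms ν A => 𝓜(ℂ, CovAlg ν p)) ∞ :=
  ⟨fun p => (covRepOf ν p).integrate ν f, memℓp_infty
    ⟨∫ s, ‖f s‖ ∂ν, by rintro _ ⟨p, rfl⟩; exact (covRepOf ν p).norm_integrate_le ν f⟩⟩

/-- The maximal crossed product `A ⋊_max G`: the completion of `C_c(G, A)` in the norm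
`‖f‖ = sup ‖(π ⋊ U)(f)‖` over all covariant representations `(π, U)` of `A`. -/
def MaxCP (A : GCStarAlg G) : Type u := genSub (maxVec ν A)

instance (A : GCStarAlg G) : NonUnitalCStarAlgebra (MaxCP ν A) :=
  inferInstanceAs (NonUnitalCStarAlgebra (genSub (maxVec ν A)))

/-- The canonical map `κ_A : C_c(G, A) → A ⋊_max G`. -/
def κ (A : GCStarAlg G) (f : C_c(G, A)) : MaxCP ν A := genMap (maxVec ν A) f

end maximal

/-! ### The reduced crossed product -/

section reduced

variable [IsTopologicalGroup G] [MeasurableSpace G] [BorelSpace G] (ν : Measure G)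
  [IsFiniteMeasureOnCompacts ν]

/-- The space `C_c(G, H)`, to be given the `L²`-inner product. -/
def PreL2 (_ : Measure G) (H : Type u) [NormedAddCommGroup H] [InnerProductSpace ℂ H] : Type u :=
  C_c(G, H)

variable (H : Type u) [NormedAddCommGroup H] [InnerProductSpace ℂ H]

instance : AddCommGroup (PreL2 ν H) := inferInstanceAs (AddCommGroup C_c(G, H))
instance : Module ℂ (PreL2 ν H) := inferInstanceAs (Module ℂ C_c(G, H))

variable {H}

/-- The underlying function. -/
def PreL2.fn {ν : Measure G} (ξ : PreL2 ν H) : C_c(G, H) := ξ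

theorem integrable_inner (ξ η : PreL2 ν H) : Integrable (fun t => ⟪ξ.fn t, η.fn t⟫_ℂ) ν :=
  (ξ.fn.continuous.inner η.fn.continuous).integrable_of_hasCompactSupport
    (ξ.fn.hasCompactSupport.mono fun t ht h => ht (by simp [h]))

variable (H)

/-- The inner product `⟨ξ, η⟩ = ∫ ⟨ξ(t), η(t)⟩ dt`. -/
abbrev preL2Core : PreInnerProductSpace.Core ℂ (PreL2 ν H) where
  inner ξ η := ∫ t, ⟪ξ.fn t, η.fn t⟫_ℂ ∂ν
  conj_inner_symm ξ η := by
    rw [← integral_conj]; simp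
  re_inner_nonneg ξ := by
    rw [← integral_re (integrable_inner ν ξ ξ)]
    exact integral_nonneg fun t => inner_self_nonneg
  add_left ξ η ζ := by
    rw [← integral_add (integrable_inner ν ξ ζ) (integrable_inner ν η ζ)]
    exact integral_congr_ae (Filter.Eventually.of_forall fun t => inner_add_left _ _ _)
  smul_left ξ η c := by
    rw [← integral_const_mul]
    exact integral_congr_ae (Filter.Eventually.of_forall fun t => inner_smul_left _ _ _)

instance : SeminormedAddCommGroup (PreL2 ν H) :=
  InnerProductSpace.Core.toSeminormedAddCommGroup (c := preL2Core ν H)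
instance : InnerProductSpace ℂ (PreL2 ν H) := InnerProductSpace.ofCore (preL2Core ν H)

/-- The Hilbert space `L²(G, H)`, as the completion of `C_c(G, H)`. -/
abbrev L2 : Type u := UniformSpace.Completion (PreL2 ν H)

variable {H}

theorem preL2_norm_sq (ξ : PreL2 ν H) : ‖ξ‖ ^ 2 = ∫ t, ‖ξ.fn t‖ ^ 2 ∂ν := by
  have h : ‖ξ‖ ^ 2 = RCLike.re (∫ t, ⟪ξ.fn t, ξ.fn t⟫_ℂ ∂ν) := by
    rw [← @inner_self_eq_norm_sq ℂ]; rfl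
  rw [h, ← integral_re (integrable_inner ν ξ ξ)]
  exact integral_congr_ae (Filter.Eventually.of_forall fun t => inner_self_eq_norm_sq _)

theorem integrable_norm_sq (f : C_c(G, H)) : Integrable (fun t => ‖f t‖ ^ 2) ν :=
  (f.continuous.norm.pow 2).integrable_of_hasCompactSupport
    (f.hasCompactSupport.mono fun t ht h => ht (by simp [h]))

/-- Left translation `(λ_s ξ)(t) = ξ(s⁻¹ t)` on `C_c(G, H)`. -/
def preTrans [ν.IsMulLeftInvariant] (s : G) : PreL2 ν H →L[ℂ] PreL2 ν H :=
  LinearMap.mkContinuous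
    { toFun := fun ξ => (⟨⟨fun t => ξ.fn (s⁻¹ * t),
          ξ.fn.continuous.comp (continuous_const.mul continuous_id)⟩,
          ξ.fn.hasCompactSupport.comp_homeomorph (Homeomorph.mulLeft s⁻¹)⟩ : C_c(G, H))
      map_add' := fun _ _ => rfl
      map_smul' := fun _ _ => rfl } 1 fun ξ => by
    rw [one_mul, ← sq_le_sq₀ (norm_nonneg _) (norm_nonneg _), preL2_norm_sq, preL2_norm_sq]
    exact (integral_mul_left_eq_self (μ := ν) (fun t => ‖ξ.fn t‖ ^ 2) s⁻¹).le

variable {A : GCStarAlg G} [CompleteSpace H] (π : A →⋆ₙₐ[ℂ] (H →L[ℂ] H))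

theorem continuous_rep : Continuous π :=
  AddMonoidHomClass.continuous_of_bound π 1 fun a => by
    simpa using NonUnitalStarAlgHom.norm_apply_le π a

/-- The operator `(π̃(a) ξ)(t) = π(α_t⁻¹(a)) ξ(t)` on `C_c(G, H)`. -/
def preMult (a : A) : PreL2 ν H →L[ℂ] PreL2 ν H :=
  LinearMap.mkContinuous
    { toFun := fun ξ => (⟨⟨fun t => π (A.act t⁻¹ a) (ξ.fn t),
          ((continuous_rep π).comp
            ((A.continuous_act a).comp continuous_inv)).clm_apply ξ.fn.continuous⟩,
          ξ.fn.hasCompactSupport.mono fun t ht h => ht (by simp [h])⟩ : C_c(G, H))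
      map_add' := fun ξ η => by
        refine DFunLike.ext (F := C_c(G, H)) _ _ fun t => ?_
        exact map_add (π (A.act t⁻¹ a)) (ξ.fn t) (η.fn t)
      map_smul' := fun c ξ => by
        refine DFunLike.ext (F := C_c(G, H)) _ _ fun t => ?_
        exact map_smul (π (A.act t⁻¹ a)) c (ξ.fn t) } ‖a‖ fun ξ => by
    rw [← sq_le_sq₀ (norm_nonneg _) (by positivity), mul_pow, preL2_norm_sq, preL2_norm_sq,
      ← integral_const_mul]
    refine integral_mono (integrable_norm_sq ν _) ((integrable_norm_sq ν ξ.fn).const_mul _)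
      fun t => ?_
    change ‖π (A.act t⁻¹ a) (ξ.fn t)‖ ^ 2 ≤ ‖a‖ ^ 2 * ‖ξ.fn t‖ ^ 2
    rw [← mul_pow]
    gcongr
    refine (ContinuousLinearMap.le_opNorm _ _).trans ?_
    gcongr
    exact (NonUnitalStarAlgHom.norm_apply_le π _).trans
      (NonUnitalStarAlgHom.norm_apply_le (A.act t⁻¹) a)

/-- The operator `π̃(a) λ_s` on `L²(G, H)`. -/
def regOp [ν.IsMulLeftInvariant] (a : A) (s : G) : L2 ν H →L[ℂ] L2 ν H :=
  (preMult ν π a ∘L preTrans ν s).completion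

theorem norm_regOp_le [ν.IsMulLeftInvariant] (a : A) (s : G) : ‖regOp ν π a s‖ ≤ ‖a‖ := by
  refine ContinuousLinearMap.opNorm_le_bound _ (norm_nonneg _) fun x => ?_
  induction x using UniformSpace.Completion.induction_on with
  | hp => exact isClosed_le (by fun_prop) (by fun_prop)
  | ih ξ =>
    rw [regOp, ContinuousLinearMap.completion_apply_coe, UniformSpace.Completion.norm_coe,
      UniformSpace.Completion.norm_coe]
    refine (ContinuousLinearMap.le_of_opNorm_le _
      (show ‖preMult ν π a‖ ≤ ‖a‖ from LinearMap.mkContinuous_norm_le _ (norm_nonneg _) _)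
      (preTrans ν s ξ)).trans ?_
    gcongr
    refine (ContinuousLinearMap.le_of_opNorm_le _
      (show ‖preTrans (H := H) ν s‖ ≤ 1 from LinearMap.mkContinuous_norm_le _ zero_le_one _)
      ξ).trans ?_
    rw [one_mul]

theorem continuous_regOp_coe [ν.IsMulLeftInvariant] (f : C_c(G, A)) (ξ : PreL2 ν H) :
    Continuous fun s => (preMult ν π (f s) ∘L preTrans ν s) ξ := by
  have hF : Continuous fun p : G × G => π (A.act p.2⁻¹ (f p.1)) (ξ.fn (p.1⁻¹ * p.2)) := by
    refine ((continuous_rep π).comp ((continuous_act_uncurry A).comp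
      (continuous_snd.inv.prodMk (f.continuous.comp continuous_fst)))).clm_apply
      (ξ.fn.continuous.comp (continuous_fst.inv.mul continuous_snd))
  have hK : IsCompact ((fun p : G × G => p.1 * p.2) '' (tsupport f ×ˢ tsupport ξ.fn)) :=
    (f.hasCompactSupport.prod ξ.fn.hasCompactSupport).image continuous_mul
  have h0 : ∀ s t, t ∉ (fun p : G × G => p.1 * p.2) '' (tsupport f ×ˢ tsupport ξ.fn) →
      π (A.act t⁻¹ (f s)) (ξ.fn (s⁻¹ * t)) = 0 := by
    intro s t ht
    by_cases hs : s ∈ tsupport f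
    · have : s⁻¹ * t ∉ tsupport ξ.fn := fun h => ht ⟨(s, s⁻¹ * t), ⟨hs, h⟩, by simp⟩
      rw [image_eq_zero_of_notMem_tsupport this, map_zero]
    · rw [image_eq_zero_of_notMem_tsupport hs]; simp
  rw [continuous_iff_continuousAt]
  intro s₀
  have hc : Continuous fun s => ∫ t, ‖π (A.act t⁻¹ (f s)) (ξ.fn (s⁻¹ * t)) -
      π (A.act t⁻¹ (f s₀)) (ξ.fn (s₀⁻¹ * t))‖ ^ 2 ∂ν := by
    rw [← continuousOn_univ]
    refine continuousOn_integral_of_compact_support hK ?_ ?_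
    · refine Continuous.continuousOn ?_
      exact ((hF.sub (hF.comp (continuous_const.prodMk continuous_snd))).norm).pow 2
    · intro s t _ ht
      simp [h0 s t ht, h0 s₀ t ht]
  rw [ContinuousAt, tendsto_iff_norm_sub_tendsto_zero]
  have h1 := (hc.sqrt).tendsto s₀
  simp only [sub_self, norm_zero, ne_eq, OfNat.ofNat_ne_zero, not_false_eq_true, zero_pow,
    integral_zero, Real.sqrt_zero] at h1
  refine h1.congr fun s => ?_
  rw [eq_comm, ← Real.sqrt_sq (norm_nonneg _), preL2_norm_sq]
  rfl

theorem continuous_regOp [ν.IsMulLeftInvariant] (f : C_c(G, A)) (x : L2 ν H) :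
    Continuous fun s => regOp ν π (f s) s x := by
  obtain ⟨C, hC⟩ := f.continuous.bounded_above_of_compact_support f.hasCompactSupport
  have hdense := UniformSpace.Completion.denseRange_coe (α := PreL2 ν H)
  have hC0 : 0 ≤ C := (norm_nonneg _).trans (hC 1)
  rw [continuous_iff_continuousAt]
  intro s₀
  rw [Metric.continuousAt_iff']
  intro ε hε
  obtain ⟨ξ, hξ⟩ := hdense.exists_dist_lt x (show 0 < ε / (3 * (C + 1)) by positivity)
  have hξ' : C * dist x (ξ : L2 ν H) ≤ ε / 3 := by
    calc C * dist x (ξ : L2 ν H) ≤ (C + 1) * (ε / (3 * (C + 1))) := by gcongr; linarith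
      _ = ε / 3 := by field_simp
  have hlip : ∀ s, dist (regOp ν π (f s) s x) (regOp ν π (f s) s (ξ : L2 ν H)) ≤ ε / 3 := by
    intro s
    rw [dist_eq_norm, ← map_sub]
    refine ((ContinuousLinearMap.le_of_opNorm_le _
      ((norm_regOp_le ν π (f s) s).trans (hC s)) _)).trans ?_
    rwa [← dist_eq_norm]
  have hcoe : Continuous fun s => regOp ν π (f s) s (ξ : L2 ν H) := by
    simp only [regOp, ContinuousLinearMap.completion_apply_coe]
    exact (UniformSpace.Completion.continuous_coe _).comp (continuous_regOp_coe ν π f ξ)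
  filter_upwards [Metric.continuousAt_iff'.1 hcoe.continuousAt (ε / 3) (by positivity)] with s hs
  have h3 := hlip s₀
  rw [dist_comm] at h3
  calc _ ≤ _ + _ + _ := dist_triangle4 _ (regOp ν π (f s) s (ξ : L2 ν H))
        (regOp ν π (f s₀) s₀ (ξ : L2 ν H)) _
    _ < ε := by linarith [hlip s]

/-- The integrated form `ξ ↦ ∫ π̃(f(s)) λ_s ξ ds` on `L²(G, H)` of the regular representation
`(π̃, λ)` induced by a representation `π` of `A` on the Hilbert space `H`. -/
def regRep [ν.IsMulLeftInvariant] (f : C_c(G, A)) : L2 ν H →L[ℂ] L2 ν H :=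
  opIntegral ν (fun s => regOp ν π (f s) s) f (continuous_regOp ν π f)
    fun s => norm_regOp_le ν π (f s) s

theorem norm_regRep_le [ν.IsMulLeftInvariant] (f : C_c(G, A)) :
    ‖regRep ν π f‖ ≤ ∫ s, ‖f s‖ ∂ν :=
  norm_opIntegral_le ν (fun s => regOp ν π (f s) s) f (continuous_regOp ν π f)
    fun s => norm_regOp_le ν π (f s) s

variable [ν.IsMulLeftInvariant]

/-- The set of all functions `f ↦ ‖(π̃ ⋊ λ)(f)‖` on `C_c(G, A)`, for the representations `π` of `A`
on Hilbert spaces. -/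
def regNorms (A : GCStarAlg G) : Set (C_c(G, A) → ℝ) :=
  {p | ∃ (H : Type u) (_ : NormedAddCommGroup H) (_ : InnerProductSpace ℂ H)
    (_ : CompleteSpace H) (π : A →⋆ₙₐ[ℂ] (H →L[ℂ] H)), p = fun f => ‖regRep ν π f‖}

section choice

variable {A : GCStarAlg G} (p : regNorms ν A)

/-- A Hilbert space carrying a representation of `A` whose regular representation has norm
function `p`. -/
def RegHilb : Type u := p.2.choose

instance : NormedAddCommGroup (RegHilb ν p) := p.2.choose_spec.choose

instance : InnerProductSpace ℂ (RegHilb ν p) := p.2.choose_spec.choose_spec.choose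

instance : CompleteSpace (RegHilb ν p) := p.2.choose_spec.choose_spec.choose_spec.choose

/-- A representation of `A` whose regular representation has norm function `p`. -/
def regHilbRep : A →⋆ₙₐ[ℂ] (RegHilb ν p →L[ℂ] RegHilb ν p) :=
  p.2.choose_spec.choose_spec.choose_spec.choose_spec.choose

end choice

/-- The algebra of bounded operators on `L²(G, H)`, for the Hilbert space `H` belonging to `p`. -/
def RegAlg {A : GCStarAlg G} (p : regNorms ν A) : Type u :=
  L2 ν (RegHilb ν p) →L[ℂ] L2 ν (RegHilb ν p)

instance {A : GCStarAlg G} (p : regNorms ν A) : NonUnitalCStarAlgebra (RegAlg ν p) :=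
  inferInstanceAs (NonUnitalCStarAlgebra (L2 ν (RegHilb ν p) →L[ℂ] L2 ν (RegHilb ν p)))

/-- The integrated form of `f` in the direct sum of one regular representation of `A` for each
norm function, so that its norm is the supremum of `‖(π̃ ⋊ λ)(f)‖` over all representations `π`
of `A` on Hilbert spaces. -/
def redVec (A : GCStarAlg G) (f : C_c(G, A)) : lp (fun p : regNorms ν A => RegAlg ν p) ∞ :=
  ⟨fun p => regRep ν (regHilbRep ν p) f, memℓp_infty
    ⟨∫ s, ‖f s‖ ∂ν, by rintro _ ⟨p, rfl⟩; exact norm_regRep_le ν (regHilbRep ν p) f⟩⟩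

/-- The reduced crossed product `A ⋊_r G`: the completion of `C_c(G, A)` in the norm
`‖f‖ = sup ‖(π̃ ⋊ λ)(f)‖` over all representations `π` of `A` on Hilbert spaces (attained at every
faithful `π`). -/
def RedCP (A : GCStarAlg G) : Type u := genSub (redVec ν A)

instance (A : GCStarAlg G) : NonUnitalCStarAlgebra (RedCP ν A) :=
  inferInstanceAs (NonUnitalCStarAlgebra (genSub (redVec ν A)))

/-- The canonical map `C_c(G, A) → A ⋊_r G`. -/
def κr (A : GCStarAlg G) (f : C_c(G, A)) : RedCP ν A := genMap (redVec ν A) f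

end reduced

/-! ### Crossed product functors -/

section functor

variable [IsTopologicalGroup G] [MeasurableSpace G] [BorelSpace G] (ν : Measure G)
  [IsFiniteMeasureOnCompacts ν] [ν.IsMulLeftInvariant]

/-- A crossed product functor `- ⋊_μ G`: a functor from `G`-C*-algebras and equivariant
*-homomorphisms to C*-algebras and *-homomorphisms, with surjective natural transformations
`q : - ⋊_max G → - ⋊_μ G` and `s : - ⋊_μ G → - ⋊_r G` such that `s ∘ q` is the canonical map
`Λ : - ⋊_max G → - ⋊_r G`. The functoriality of `⋊_max` and `⋊_r` and the map `Λ` are given on the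
generators `f ∈ C_c(G, A)` by `f ↦ φ ∘ f` and by `κ(f) ↦ κr(f)`, and the conditions are written on
these generators (so `s` is automatically natural). -/
structure CrossedProductFunctor where
  obj : GCStarAlg G → Type u
  [str : ∀ A, NonUnitalCStarAlgebra (obj A)]
  map : ∀ {A B : GCStarAlg G}, GHom A B → (obj A →⋆ₙₐ[ℂ] obj B)
  map_id : ∀ (A : GCStarAlg G) (x : obj A), map (GHom.id A) x = x
  map_comp : ∀ {A B C : GCStarAlg G} (ψ : GHom B C) (φ : GHom A B) (x : obj A),
    map (ψ.comp φ) x = map ψ (map φ x)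
  q : ∀ A : GCStarAlg G, MaxCP ν A →⋆ₙₐ[ℂ] obj A
  q_surjective : ∀ A, Function.Surjective (q A)
  q_natural : ∀ {A B : GCStarAlg G} (φ : GHom A B) (f : C_c(G, A)) (g : C_c(G, B)),
    (∀ t, g t = φ.hom (f t)) → map φ (q A (κ ν A f)) = q B (κ ν B g)
  s : ∀ A : GCStarAlg G, obj A →⋆ₙₐ[ℂ] RedCP ν A
  s_surjective : ∀ A, Function.Surjective (s A)
  s_q : ∀ (A : GCStarAlg G) (f : C_c(G, A)), s A (q A (κ ν A f)) = κr ν A f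

/-- Complete positivity of a linear map, for the usual order on a C*-algebra. -/
def IsCompletelyPositive {A B : Type u} [NonUnitalCStarAlgebra A] [NonUnitalCStarAlgebra B]
    (φ : A →ₗ[ℂ] B) : Prop :=
  letI := CStarAlgebra.spectralOrder A
  letI := CStarAlgebra.spectralOrder B
  haveI := CStarAlgebra.spectralOrderedRing A
  haveI := CStarAlgebra.spectralOrderedRing B
  ∃ ψ : A →CP B, ψ.toLinearMap = φ

variable {ν}

namespace CrossedProductFunctor

variable (μ : CrossedProductFunctor ν)

instance (A : GCStarAlg G) : NonUnitalCStarAlgebra (μ.obj A) := μ.str A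

/-- The canonical map `C_c(G, A) → A ⋊_μ G`. -/
def incl (A : GCStarAlg G) (f : C_c(G, A)) : μ.obj A := μ.q A (κ ν A f)

/-- The cp-map property, which defines correspondence crossed product functors: every equivariant
completely positive map `φ : A → B` induces a completely positive map `A ⋊_μ G → B ⋊_μ G` that is
given by `f ↦ φ ∘ f` on `C_c(G, A)`. -/
def IsCorrespondence : Prop :=
  ∀ (A B : GCStarAlg G) (φ : A →ₗ[ℂ] B), IsCompletelyPositive φ →
    (∀ s a, φ (A.act s a) = B.act s (φ a)) →
    ∃ Φ : μ.obj A →ₗ[ℂ] μ.obj B, IsCompletelyPositive Φ ∧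
      ∀ (f : C_c(G, A)) (g : C_c(G, B)), (∀ t, g t = φ (f t)) →
        Φ (μ.incl A f) = μ.incl B g

/-- The group C*-algebra `C*_μ G = ℂ ⋊_μ G`. -/
abbrev groupAlg : Type u := μ.obj (GCStarAlg.scalars G)

/-- The tensor product `B ⊗_μ C*_μ G`: the crossed product `B ⋊_μ G` by the trivial action. -/
abbrev tensor (B : Type u) [NonUnitalCStarAlgebra B] : Type u := μ.obj (GCStarAlg.trivial G B)

/-- `τ` is the canonical bilinear map `(b, c) ↦ b ⊗ c` from `B × C*_μ G` to `B ⊗_μ C*_μ G`: the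
continuous bilinear map that sends `b` and `f ∈ C_c(G)` to the function `s ↦ f(s) b`. -/
def IsTensorMap {B : Type u} [NonUnitalCStarAlgebra B]
    (τ : B →L[ℂ] μ.groupAlg →L[ℂ] μ.tensor B) : Prop :=
  ∀ (b : B) (f : C_c(G, GCStarAlg.scalars G)),
    τ b (μ.incl (GCStarAlg.scalars G) f) = μ.incl (GCStarAlg.trivial G B) (smulConst f b)

end CrossedProductFunctor

/-- For a completion `k : C_c(G, A) → Q` (for instance `Q = A ⋊_max G` or `Q = A ⋊_μ G`), `ρ` is the
canonical covariant representation of `A` in the multiplier algebra of `Q`, given by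
`(a f)(t) = a f(t)` and `(s f)(t) = α_s(f(s⁻¹ t))`. -/
def IsCanonical {A : GCStarAlg G} {Q : Type u} [NonUnitalCStarAlgebra Q] (k : C_c(G, A) → Q)
    (ρ : CovRep A Q) : Prop :=
  (∀ a f, (ρ.π a).fst (k f) = k (constMul a f)) ∧
    ∀ s f, (ρ.U s : 𝓜(ℂ, Q)).fst (k f) = k (translate s f)

/-- The full group C*-algebra `C*_max G = ℂ ⋊_max G`. -/
abbrev MaxGroupAlg (ν : Measure G) [IsFiniteMeasureOnCompacts ν] : Type u :=
  MaxCP ν (GCStarAlg.scalars G)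

/-- A *-homomorphism `Δ : C → M(D)` is nondegenerate if `Δ(C)D` spans a dense subspace of `D`. -/
def NondegenerateHom {C D : Type u} [NonUnitalCStarAlgebra C] [NonUnitalCStarAlgebra D]
    (Δ : C →⋆ₙₐ[ℂ] 𝓜(ℂ, D)) : Prop :=
  Dense (Submodule.span ℂ {y : D | ∃ x d, y = (Δ x).fst d} : Set D)

end functor

end

end ExoticCP

open ExoticCP

namespace ExoticCP

noncomputable section

/-! ### Multipliers -/

section multipliers

variable {D : Type u} [NonUnitalCStarAlgebra D]

/-! Let (π, U) be a covariant representation of A in M(B); in the application B = A ⋊_max G with its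
universal representation. A crossed product functor only accepts equivariant maps between
G-C*-algebras, so π ⊗ 1 and U ⊗ u have to be found inside the crossed product of one G-algebra. This
is the linking algebra L (`link`): 2 × 2 matrices with first diagonal entry in π(A) + B,
off-diagonal entries in B and an arbitrary multiplier of B as second diagonal entry, where s acts as
conjugation by diag(U_s, 1). Equivariantly, L contains A in the first diagonal corner, and B and the
scalars, both with trivial action, in the second. On the corner B e₁₂ the action is b ↦ U_s b.

The maps x ↦ b* x₂₂ b are equivariant completely positive maps L → B. By the cp-map property they
pass to the crossed products, and on the image of B ⊗_μ C*_μ G they become the compressions e ↦ b* e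
b. Hence the homomorphism j : B ⊗_μ C*_μ G → L ⋊_μ G is injective (`tensorToLink_injective`). The
map R induced by b ↦ b e₁₂ satisfies R(x)* R(y) = j(x* y), so it is isometric and embeds B ⊗_μ C*_μ
G as a Hilbert module (`moduleEmbedding`). Its range is invariant under left multiplication by A, by
G and by the image of A ⋊_μ G, and all three can be pulled back along R to multipliers of B ⊗_μ C*_μ
G. The first two give π ⊗ 1 and U ⊗ u. The third gives Ψ, because on C_c(G, A) it is the integrated
form of the first two (`map_linkA_incl_mul_tensorOff`): the factorization through A ⋊_μ G is
functoriality for A → L. The coproduct is the case A = ℂ.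

For discrete G, π(A) lies in B = A ⋊_max G, so x ↦ x₁₁ maps L to B. Followed by the expectation E :
B → A, f ↦ f(1), it is an equivariant completely positive map L → A that sends (a e₁₂)(b e₁₂)* e to
a multiple of a b* e, for a, b, e in A. If Ψ(y) = 0, then y annihilates the range of R, so (b e₁₂)*
y* = 0, and the map induced on the crossed products gives a b* y* = 0 for all a and b, whence y = 0.
Boundedness of E holds because f(1) is read off from matrix coefficients of regular representations,
whose norms the maximal norm dominates. -/

theorem eq_zero_of_forall_mul_eq_zero {x : D} (h : ∀ y, x * y = 0) : x = 0 :=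
  CStarRing.mul_star_self_eq_zero_iff x |>.1 (h _)

theorem eq_zero_of_forall_mul_left_eq_zero {x : D} (h : ∀ y, y * x = 0) : x = 0 :=
  CStarRing.star_mul_self_eq_zero_iff x |>.1 (h _)

/-- In a C*-algebra, products are dense. -/
theorem mem_closure_range_mul (d : D) : d ∈ closure (Set.range fun p : D × D => p.1 * p.2) := by
  let _ := CStarAlgebra.spectralOrder D
  have := CStarAlgebra.spectralOrderedRing D
  have h := (CStarAlgebra.increasingApproximateUnit D).tendsto_mul_left d
  exact mem_closure_of_tendsto h (Filter.Eventually.of_forall fun e => ⟨(d, e), rfl⟩)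

/-- The form in which the approximate unit is used: membership in a closed subspace need only be
tested on products. -/
theorem mem_of_forall_mul_mem (S : Submodule ℂ D) (hS : IsClosed (S : Set D))
    (h : ∀ x y : D, x * y ∈ S) (d : D) : d ∈ S :=
  closure_minimal (by rintro _ ⟨p, rfl⟩; exact h p.1 p.2) hS (mem_closure_range_mul d)

/-- With D as a right Hilbert module over itself, `star m` is the adjoint of `m`. This is what lets
every multiplier below be built from left actions alone. -/
theorem star_fst_mul (m : 𝓜(ℂ, D)) (x y : D) :
    star (m.fst x) * y = star x * (star m).fst y := by
  have h := DoubleCentralizer.central m (star y) x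
  rw [DoubleCentralizer.star_fst, ← star_star (star x * star (m.snd (star y))), star_mul, star_star,
    star_star, h, star_mul, star_star]

theorem fst_mul (m : 𝓜(ℂ, D)) (x y : D) : m.fst (x * y) = m.fst x * y := by
  rw [← sub_eq_zero]
  refine eq_zero_of_forall_mul_left_eq_zero fun z => ?_
  rw [mul_sub, ← DoubleCentralizer.central, ← mul_assoc z, ← DoubleCentralizer.central, mul_assoc,
    sub_self]

/-- A multiplier is determined by its action from the left. -/
theorem multiplier_ext {m n : 𝓜(ℂ, D)} (h : ∀ d, m.fst d = n.fst d) : m = n := by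
  refine DoubleCentralizer.ext ℂ D m n (Prod.ext (ContinuousLinearMap.ext h) ?_)
  refine ContinuousLinearMap.ext fun x => ?_
  rw [← sub_eq_zero]
  refine eq_zero_of_forall_mul_eq_zero fun y => ?_
  rw [sub_mul, DoubleCentralizer.central, DoubleCentralizer.central, h, sub_self]

/-- The multiplier with left action `L`, where `L'` is an adjoint of `L`. -/
def mkMul (L L' : D →L[ℂ] D) (h : ∀ x y, star (L x) * y = star x * L' y) : 𝓜(ℂ, D) where
  fst := L
  snd := LinearMap.mkContinuous
    { toFun := fun x => star (L' (star x))
      map_add' := fun x y => by simp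
      map_smul' := fun c x => by simp } ‖L'‖ fun x => by
        simpa using L'.le_opNorm (star x)
  central x y := by
    change star (L' (star x)) * y = x * L y
    have h1 := h y (star x)
    rw [← star_star (star (L' (star x)) * y), star_mul, star_star, ← h1, star_mul, star_star,
      star_star]

@[simp] theorem mkMul_fst (L L' : D →L[ℂ] D) (h) (x : D) : (mkMul L L' h).fst x = L x := rfl

@[simp] theorem star_mkMul_fst (L L' : D →L[ℂ] D) (h) (x : D) :
    (star (mkMul L L' h)).fst x = L' x := by
  rw [DoubleCentralizer.star_fst]
  change star (star (L' (star (star x)))) = _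
  simp

theorem coe_mul_eq (m : 𝓜(ℂ, D)) (d : D) :
    m * DoubleCentralizer.coe ℂ d = DoubleCentralizer.coe ℂ (m.fst d) :=
  multiplier_ext fun x => by simp [fst_mul]

theorem mul_coe_eq (m : 𝓜(ℂ, D)) (d : D) :
    DoubleCentralizer.coe ℂ d * m = DoubleCentralizer.coe ℂ (m.snd d) :=
  multiplier_ext fun x => by simp [DoubleCentralizer.central]

theorem norm_coe (d : D) : ‖DoubleCentralizer.coe ℂ d‖ = ‖d‖ := by
  rw [← DoubleCentralizer.norm_fst, DoubleCentralizer.coe_fst]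
  exact ContinuousLinearMap.opNorm_mul_apply ℂ D d

variable (D) in
/-- The inclusion of a C*-algebra in its multiplier algebra. -/
def coeM : D →⋆ₙₐ[ℂ] 𝓜(ℂ, D) := DoubleCentralizer.coeHom

@[simp] theorem coeM_fst (d x : D) : (coeM D d).fst x = d * x := rfl

theorem norm_coeM (d : D) : ‖coeM D d‖ = ‖d‖ := norm_coe d

theorem coeM_injective : Function.Injective (coeM D) :=
  (injective_iff_map_eq_zero _).2 fun d h => by rw [← norm_eq_zero, ← norm_coeM, h, norm_zero]

theorem isClosed_range_coeM : IsClosed (Set.range (coeM D)) :=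
  (AddMonoidHomClass.isometry_of_norm (coeM D) norm_coeM).isClosedEmbedding.isClosed_range

theorem mul_coeM (m : 𝓜(ℂ, D)) (d : D) : m * coeM D d = coeM D (m.fst d) := coe_mul_eq m d

theorem coeM_mul (m : 𝓜(ℂ, D)) (d : D) : coeM D d * m = coeM D (m.snd d) := mul_coe_eq m d

variable {D' : Type u} [NonUnitalCStarAlgebra D']

/-- A *-homomorphism as a continuous linear map. -/
def homL (q : D →⋆ₙₐ[ℂ] D') : D →L[ℂ] D' :=
  LinearMap.mkContinuous ⟨⟨q, map_add q⟩, map_smul q⟩ 1 fun x => by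
    simpa using NonUnitalStarAlgHom.norm_apply_le q x

@[simp] theorem homL_apply (q : D →⋆ₙₐ[ℂ] D') (x : D) : homL q x = q x := rfl

theorem continuous_hom (q : D →⋆ₙₐ[ℂ] D') : Continuous q := (homL q).continuous

variable (q : D →⋆ₙₐ[ℂ] D')

/-- The kernel of q is stable under multipliers, since q(md)* q(md) = q(d)* q(m* m d). -/
theorem map_fst_eq_zero (m : 𝓜(ℂ, D)) {d : D} (hd : q d = 0) : q (m.fst d) = 0 := by
  rw [← CStarRing.star_mul_self_eq_zero_iff, ← map_star, ← map_mul, star_fst_mul, map_mul, map_star, hd,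
    star_zero, zero_mul]

theorem exists_descend (hq : Function.Surjective q) (m : 𝓜(ℂ, D)) : ∃ L : D' →L[ℂ] D', ∀ d, L (q d) = q (m.fst d) := by
  have key : ∀ d e, q d = q e → q (m.fst d) = q (m.fst e) := fun d e h => by
    rw [← sub_eq_zero, ← map_sub, ← map_sub]
    exact map_fst_eq_zero q m (by rw [map_sub, h, sub_self])
  have hs := Function.surjInv_eq hq
  -- The open mapping theorem gives lifts with norm at most C times that of the image; the chosen
  -- section has no such bound, but the value does not depend on the lift.
  obtain ⟨C, -, hC⟩ := (homL q).exists_preimage_norm_le hq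
  refine ⟨LinearMap.mkContinuous
    { toFun := fun x => q (m.fst (Function.surjInv hq x))
      map_add' := fun x y => by
        rw [← map_add, ← map_add]
        exact key _ _ (by rw [map_add, hs, hs, hs])
      map_smul' := fun c x => by
        rw [RingHom.id_apply, ← map_smul, ← map_smul]
        exact key _ _ (by rw [map_smul, hs, hs]) } (‖m.fst‖ * C) fun x => ?_, fun d => ?_⟩
  · obtain ⟨d, hd, hd'⟩ := hC x
    change ‖q (m.fst (Function.surjInv hq x))‖ ≤ _
    rw [key _ d ((hs x).trans hd.symm), mul_assoc]
    exact (NonUnitalStarAlgHom.norm_apply_le q _).trans ((m.fst.le_opNorm d).trans (by gcongr))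
  · exact key _ _ (hs _)

variable (hq : Function.Surjective q)

/-- The left action on `D'` of the image of a multiplier of `D`. -/
def descend (m : 𝓜(ℂ, D)) : D' →L[ℂ] D' := (exists_descend q hq m).choose

theorem descend_apply (m : 𝓜(ℂ, D)) (d : D) : descend q hq m (q d) = q (m.fst d) :=
  (exists_descend q hq m).choose_spec d

/-- The image of a multiplier under a surjective *-homomorphism. -/
def pushMul (m : 𝓜(ℂ, D)) : 𝓜(ℂ, D') :=
  mkMul (descend q hq m) (descend q hq (star m)) fun x y => by
    obtain ⟨x, rfl⟩ := hq x
    obtain ⟨y, rfl⟩ := hq y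
    have h := congrArg q (star_fst_mul m x y)
    simpa only [descend_apply, map_mul, map_star] using h

theorem pushMul_fst (m : 𝓜(ℂ, D)) (d : D) : (pushMul q hq m).fst (q d) = q (m.fst d) :=
  descend_apply q hq m d

theorem pushMul_star (m : 𝓜(ℂ, D)) : pushMul q hq (star m) = star (pushMul q hq m) :=
  multiplier_ext fun x => by
    rw [pushMul, pushMul, star_mkMul_fst, mkMul_fst]

/-- The extension of a surjective *-homomorphism to the multiplier algebras. -/
def pushHom : 𝓜(ℂ, D) →⋆ₙₐ[ℂ] 𝓜(ℂ, D') where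
  toFun := pushMul q hq
  map_smul' c m := multiplier_ext fun x => by
    obtain ⟨x, rfl⟩ := hq x
    simp [pushMul_fst]
  map_zero' := multiplier_ext fun x => by
    obtain ⟨x, rfl⟩ := hq x
    simp [pushMul_fst]
  map_add' m n := multiplier_ext fun x => by
    obtain ⟨x, rfl⟩ := hq x
    simp [pushMul_fst]
  map_mul' m n := multiplier_ext fun x => by
    obtain ⟨x, rfl⟩ := hq x
    simp [pushMul_fst]
  map_star' := pushMul_star q hq

theorem pushHom_fst (m : 𝓜(ℂ, D)) (d : D) : (pushHom q hq m).fst (q d) = q (m.fst d) :=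
  descend_apply q hq m d

theorem pushHom_one : pushHom q hq 1 = 1 := multiplier_ext fun x => by
  obtain ⟨x, rfl⟩ := hq x
  simp [pushHom_fst]

end multipliers

/-! ### Integrals in closed subspaces -/

section integrals

variable {X : Type*} [MeasurableSpace X] {ν : Measure X} {E : Type*} [NormedAddCommGroup E]
  [NormedSpace ℂ E] [CompleteSpace E]

/-- An integrable f is integrated inside the complete space S; otherwise the integral is 0 by
convention, so no integrability hypothesis is needed. -/
theorem integral_mem_of_isClosed (S : Submodule ℂ E) (hS : IsClosed (S : Set E)) {f : X → E}
    (h : ∀ x, f x ∈ S) : ∫ x, f x ∂ν ∈ S := by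
  have : CompleteSpace S := hS.completeSpace_coe
  by_cases hf : Integrable f ν
  · have := S.subtypeL.integral_comp_comm (μ := ν) (φ := fun x => (⟨f x, h x⟩ : S)) ?_
    · have e : ∫ x, f x ∂ν = ((∫ x, (⟨f x, h x⟩ : S) ∂ν : S) : E) := this
      rw [e]
      exact Subtype.property _
    · have : Isometry (Subtype.val : S → E) := isometry_subtype_coe
      exact ⟨this.isEmbedding.aestronglyMeasurable_comp_iff.1 hf.1, hf.2⟩
  · rw [integral_undef hf]
    exact S.zero_mem

end integrals

/-! ### Covariant representations -/

section covariant

variable {G : Type u} [Group G] [TopologicalSpace G] {A : GCStarAlg G} {D : Type u}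
  [NonUnitalCStarAlgebra D] (ρ : CovRep A D)

/-- The operator `U_s` on `D`. -/
def CovRep.u (s : G) : D →L[ℂ] D := (ρ.U s : 𝓜(ℂ, D)).fst

/-- The operator `π(a)` on `D`. -/
def CovRep.p (a : A) : D →L[ℂ] D := (ρ.π a).fst

theorem CovRep.U_fst (s : G) : (ρ.U s : 𝓜(ℂ, D)).fst = ρ.u s := rfl

theorem CovRep.π_fst (a : A) : (ρ.π a).fst = ρ.p a := rfl

theorem CovRep.u_one (d : D) : ρ.u 1 d = d := by simp [CovRep.u]

theorem CovRep.u_mul (s t : G) (d : D) : ρ.u (s * t) d = ρ.u s (ρ.u t d) := by simp [CovRep.u]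

theorem CovRep.star_U (s : G) : star (ρ.U s : 𝓜(ℂ, D)) = (ρ.U s⁻¹ : 𝓜(ℂ, D)) := by
  rw [map_inv]; rfl

theorem CovRep.star_p_mul (a : A) (x y : D) : star (ρ.p a x) * y = star x * ρ.p (star a) y := by
  rw [CovRep.p, star_fst_mul, ← map_star]; rfl

theorem CovRep.p_mul (a b : A) (d : D) : ρ.p (a * b) d = ρ.p a (ρ.p b d) := by simp [CovRep.p]

theorem CovRep.p_act_u (s : G) (a : A) (d : D) : ρ.p (A.act s a) (ρ.u s d) = ρ.u s (ρ.p a d) := by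
  have h : star (ρ.U s : 𝓜(ℂ, D)) * (ρ.U s : 𝓜(ℂ, D)) = 1 := Unitary.coe_star_mul_self _
  have : ρ.π (A.act s a) * (ρ.U s : 𝓜(ℂ, D)) = (ρ.U s : 𝓜(ℂ, D)) * ρ.π a := by
    rw [ρ.covariant, mul_assoc, h, mul_one]
  have := congrArg (fun m : 𝓜(ℂ, D) => m.fst d) this
  simpa [CovRep.u, CovRep.p] using this

theorem CovRep.norm_u_le (s : G) (d : D) : ‖ρ.u s d‖ ≤ ‖d‖ := by
  refine (ContinuousLinearMap.le_of_opNorm_le _ (c := 1) ?_ d).trans (one_mul _).le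
  exact (DoubleCentralizer.norm_fst _).le.trans (norm_unitary_le _)

theorem CovRep.norm_p_le (a : A) (d : D) : ‖ρ.p a d‖ ≤ ‖a‖ * ‖d‖ :=
  ContinuousLinearMap.le_of_opNorm_le _ ((DoubleCentralizer.norm_fst _).le.trans
    (NonUnitalStarAlgHom.norm_apply_le ρ.π a)) d

theorem CovRep.continuous_p : Continuous ρ.p := continuous_leftMul.comp (continuous_pi ρ)

theorem CovRep.continuous_u (d : D) : Continuous fun s => ρ.u s d := ρ.continuous_left d

/-- A covariant representation, from a strongly continuous homomorphism into the multipliers such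
that the adjoint of the image of `s` is the image of `s⁻¹`. -/
def CovRep.mk' [IsTopologicalGroup G] (π : A →⋆ₙₐ[ℂ] 𝓜(ℂ, D)) (V : G → 𝓜(ℂ, D)) (h1 : V 1 = 1)
    (hmul : ∀ s t, V (s * t) = V s * V t) (hstar : ∀ s, star (V s) = V s⁻¹)
    (hc : ∀ d, Continuous fun s => (V s).fst d)
    (hcov : ∀ s a, π (A.act s a) * V s = V s * π a) : CovRep A D where
  π := π
  U :=
    { toFun := fun s => ⟨V s, by
        rw [Unitary.mem_iff, hstar, ← hmul, ← hmul, inv_mul_cancel, mul_inv_cancel, h1]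
        exact ⟨rfl, rfl⟩⟩
      map_one' := Subtype.ext h1
      map_mul' := fun s t => Subtype.ext (hmul s t) }
  continuous_left := hc
  continuous_right d := by
    change Continuous fun s => (V s).snd d
    have : ∀ s, (V s).snd d = star ((V s⁻¹).fst (star d)) := fun s => by
      rw [← hstar, DoubleCentralizer.star_fst, star_star, star_star]
    simp only [this]
    exact ((hc (star d)).comp continuous_inv).star
  covariant s a := by
    change π (A.act s a) = V s * π a * star (V s)
    rw [← hcov, mul_assoc, hstar, ← hmul, mul_inv_cancel, h1, mul_one]

variable {D' : Type u} [NonUnitalCStarAlgebra D']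

/-- The image of a covariant representation under a surjective *-homomorphism. -/
def CovRep.push [IsTopologicalGroup G] (q : D →⋆ₙₐ[ℂ] D') (hq : Function.Surjective q) :
    CovRep A D' :=
  CovRep.mk' ((pushHom q hq).comp ρ.π) (fun s => pushHom q hq (ρ.U s : 𝓜(ℂ, D)))
    (by simp [pushHom_one]) (fun s t => by simp) (fun s => by rw [← map_star, star_U])
    (fun d => by
      obtain ⟨d, rfl⟩ := hq d
      simp only [pushHom_fst]
      exact (continuous_hom q).comp (ρ.continuous_u d))
    (fun s a => by
      refine (map_mul (pushHom q hq) _ _).symm.trans (Eq.trans ?_ (map_mul (pushHom q hq) _ _))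
      congr 1
      exact multiplier_ext fun d => ρ.p_act_u s a d)

theorem CovRep.push_u [IsTopologicalGroup G] (q : D →⋆ₙₐ[ℂ] D') (hq : Function.Surjective q)
    (s : G) (d : D) : (ρ.push q hq).u s (q d) = q (ρ.u s d) :=
  pushHom_fst q hq _ d

theorem CovRep.push_p [IsTopologicalGroup G] (q : D →⋆ₙₐ[ℂ] D') (hq : Function.Surjective q)
    (a : A) (d : D) : (ρ.push q hq).p a (q d) = q (ρ.p a d) :=
  pushHom_fst q hq _ d

end covariant

/-! ### Integrated forms -/

section integratedForm

variable {G : Type u} [Group G] [TopologicalSpace G] [MeasurableSpace G] [BorelSpace G]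
  (ν : Measure G) [IsFiniteMeasureOnCompacts ν] {A : GCStarAlg G} {D : Type u}
  [NonUnitalCStarAlgebra D] (ρ : CovRep A D)

theorem CovRep.continuous_p_u (f : C_c(G, A)) (d : D) :
    Continuous fun s => ρ.p (f s) (ρ.u s d) :=
  (ρ.continuous_p.comp f.continuous).clm_apply (ρ.continuous_u d)

theorem CovRep.integrable_p_u (f : C_c(G, A)) (d : D) :
    Integrable (fun s => ρ.p (f s) (ρ.u s d)) ν :=
  (ρ.continuous_p_u f d).integrable_of_hasCompactSupport
    (f.hasCompactSupport.mono fun s hs h => hs (by simp [h, CovRep.p]))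

theorem CovRep.integrate_fst (f : C_c(G, A)) (d : D) :
    (ρ.integrate ν f).fst d = ∫ s, ρ.p (f s) (ρ.u s d) ∂ν := rfl

theorem CovRep.integrate_add (f g : C_c(G, A)) :
    ρ.integrate ν (f + g) = ρ.integrate ν f + ρ.integrate ν g :=
  multiplier_ext fun d => by
    simp only [DoubleCentralizer.add_fst, _root_.add_apply, integrate_fst]
    rw [← integral_add (ρ.integrable_p_u ν f d) (ρ.integrable_p_u ν g d)]
    exact integral_congr_ae (Filter.Eventually.of_forall fun s => by simp [CovRep.p])

theorem CovRep.integrate_smul (c : ℂ) (f : C_c(G, A)) :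
    ρ.integrate ν (c • f) = c • ρ.integrate ν f :=
  multiplier_ext fun d => by
    simp only [DoubleCentralizer.smul_fst, _root_.smul_apply, integrate_fst]
    rw [← integral_smul]
    exact integral_congr_ae (Filter.Eventually.of_forall fun s => by simp [CovRep.p])

theorem CovRep.integrate_constMul (a : A) (f : C_c(G, A)) :
    ρ.integrate ν (constMul a f) = ρ.π a * ρ.integrate ν f :=
  multiplier_ext fun d => by
    rw [DoubleCentralizer.mul_fst, mul_apply_eq_comp, π_fst, integrate_fst,
      integrate_fst, ← (ρ.p a).integral_comp_comm (ρ.integrable_p_u ν f d)]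
    exact integral_congr_ae (Filter.Eventually.of_forall fun s => ρ.p_mul a (f s) _)

theorem CovRep.integrate_translate [IsTopologicalGroup G] [ν.IsMulLeftInvariant] (s : G)
    (f : C_c(G, A)) :
    ρ.integrate ν (translate s f) = (ρ.U s : 𝓜(ℂ, D)) * ρ.integrate ν f :=
  multiplier_ext fun d => by
    rw [DoubleCentralizer.mul_fst, mul_apply_eq_comp, U_fst, integrate_fst,
      integrate_fst, ← (ρ.u s).integral_comp_comm (ρ.integrable_p_u ν f d),
      ← integral_mul_left_eq_self (fun t => ρ.u s (ρ.p (f t) (ρ.u t d))) s⁻¹]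
    refine integral_congr_ae (Filter.Eventually.of_forall fun t => ?_)
    change ρ.p (A.act s (f (s⁻¹ * t))) (ρ.u t d) = ρ.u s (ρ.p (f (s⁻¹ * t)) (ρ.u (s⁻¹ * t) d))
    rw [← p_act_u, ← u_mul, mul_inv_cancel_left]

/-- Taking adjoints under the integral gives ∫ U_s* π(f(s))* ds, without a modular function.
Products star(f) x are computed in this form throughout. -/
theorem CovRep.star_integrate_fst (f : C_c(G, A)) (d : D) :
    (star (ρ.integrate ν f)).fst d = ∫ s, ρ.u s⁻¹ (ρ.p (star (f s)) d) ∂ν := by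
  rw [DoubleCentralizer.star_fst]
  have h : (ρ.integrate ν f).snd (star d) =
    ∫ s, (ρ.π (f s) * (ρ.U s : 𝓜(ℂ, D))).snd (star d) ∂ν := rfl
  rw [h]
  have := ((starL' ℝ : D ≃L[ℝ] D) : D →L[ℝ] D).integral_comp_comm (μ := ν)
    (φ := fun s => (ρ.π (f s) * (ρ.U s : 𝓜(ℂ, D))).snd (star d))
    (integrable_apply ν f (continuous_integrand_snd ρ f)
      (fun s => (DoubleCentralizer.norm_snd _).le.trans (norm_pi_mul_le ρ (f s) s)) _)
  refine this.symm.trans (integral_congr_ae (Filter.Eventually.of_forall fun s => ?_))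
  change star ((ρ.π (f s) * (ρ.U s : 𝓜(ℂ, D))).snd (star d)) = _
  rw [← DoubleCentralizer.star_fst, star_mul, star_U, ← map_star ρ.π]
  simp [CovRep.u, CovRep.p]

theorem CovRep.continuous_star_integrand [IsTopologicalGroup G] (f : C_c(G, A)) (d : D) :
    Continuous fun s => ρ.u s⁻¹ (ρ.p (star (f s)) d) := by
  have h2 : ∀ s, ρ.u s⁻¹ (ρ.p (star (f s)) d) =
      star ((ρ.π (f s) * (ρ.U s : 𝓜(ℂ, D))).snd (star d)) := fun s => by
    rw [← DoubleCentralizer.star_fst, star_mul, star_U, ← map_star ρ.π]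
    simp [CovRep.u, CovRep.p]
  simp only [h2]
  exact (continuous_integrand_snd ρ f (star d)).star

theorem CovRep.integrable_star_integrand [IsTopologicalGroup G] (f : C_c(G, A)) (d : D) :
    Integrable (fun s => ρ.u s⁻¹ (ρ.p (star (f s)) d)) ν :=
  (ρ.continuous_star_integrand f d).integrable_of_hasCompactSupport
    (f.hasCompactSupport.mono fun s hs h => hs (by simp [h, CovRep.p]))

end integratedForm

/-! ### The modular function -/

section modular

variable {G : Type u} [Group G] [TopologicalSpace G] [IsTopologicalGroup G]
  [LocallyCompactSpace G] [MeasurableSpace G] [BorelSpace G]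
  (ν : Measure G) [ν.IsHaarMeasure]

/-- Uniqueness of Haar measure compares the left-invariant ν with the right-invariant `ν.inv`: for a
fixed bump function g, ν has the continuous density (∫ g(y⁻¹x) dν.inv(y))⁻¹ ∫ g dν with respect to
`ν.inv`. The inversion turns this density, taken at s⁻¹, into m. -/
theorem exists_modular_real : ∃ m : G → ℝ, Continuous m ∧ ∀ f : G → ℝ, Continuous f →
    HasCompactSupport f → ∫ s, f s ∂ν = ∫ s, m s * f s⁻¹ ∂ν := by
  obtain ⟨⟨g, g_cont⟩, g_comp, g_nonneg, g_one⟩ :=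
    exists_continuous_nonneg_pos (1 : G)
  have hD : Continuous fun x => ∫ y, g (y⁻¹ * x) ∂ν.inv :=
    continuous_integral_apply_inv_mul g_cont g_comp
  have hpos : ∀ x, ∫ y, g (y⁻¹ * x) ∂ν.inv ≠ 0 := fun x => by
    have hc : Continuous fun y => g (y⁻¹ * x) := g_cont.comp (continuous_inv.mul continuous_const)
    refine ((integral_pos_iff_support_of_nonneg (fun y => g_nonneg (y⁻¹ * x)) ?_).2 ?_).ne'
    · exact hc.integrable_of_hasCompactSupport
        (g_comp.comp_homeomorph ((Homeomorph.inv G).trans (Homeomorph.mulRight x)))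
    · exact hc.isOpen_support.measure_pos _ ⟨x, by simpa using g_one⟩
  have hinv : ∀ h : G → ℝ, ∫ x, h x ∂ν.inv = ∫ x, h x⁻¹ ∂ν := fun h =>
    integral_map_equiv (MeasurableEquiv.inv G) h
  refine ⟨fun s => (∫ y, g (y⁻¹ * s⁻¹) ∂ν.inv)⁻¹ * ∫ x, g x ∂ν, ?_, fun f hf hf' => ?_⟩
  · exact ((hD.comp continuous_inv).inv₀ fun x => hpos x⁻¹).mul continuous_const
  · rw [Measure.integral_isMulLeftInvariant_isMulRightInvariant_combo (ν := ν.inv) hf hf' g_cont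
      g_comp g_nonneg g_one, ← integral_mul_const, hinv]
    refine integral_congr_ae (Filter.Eventually.of_forall fun s => ?_)
    change f s⁻¹ * _ * _ = _ * f s⁻¹
    rw [mul_assoc, mul_comm]

/-- The function `m` with `∫ F(s) ds = ∫ m(s) F(s⁻¹) ds` for all `F ∈ C_c(G)`. -/
def modular : G → ℝ := (exists_modular_real ν).choose

theorem continuous_modular : Continuous (modular ν) := (exists_modular_real ν).choose_spec.1

theorem integral_eq_modular {E : Type*} [NormedAddCommGroup E] [NormedSpace ℝ E] [CompleteSpace E]
    (f : G → E) (hf : Continuous f) (hf' : HasCompactSupport f) :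
    ∫ s, f s ∂ν = ∫ s, modular ν s • f s⁻¹ ∂ν := by
  have hf2 : HasCompactSupport fun s => modular ν s • f s⁻¹ :=
    (hf'.comp_homeomorph (Homeomorph.inv G)).mono fun s hs h => hs (by
      change f s⁻¹ = 0 at h
      simp [h])
  have hi := hf.integrable_of_hasCompactSupport (μ := ν) hf'
  have hi2 := ((continuous_modular ν).smul (hf.comp continuous_inv)).integrable_of_hasCompactSupport
    (μ := ν) hf2
  -- Continuous functionals separate points and commute with the integral, which reduces the
  -- vector-valued formula to the real one.
  refine SeparatingDual.eq_iff_forall_dual_eq (R := ℝ) |>.2 fun φ => ?_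
  have e1 := φ.integral_comp_comm hi
  have e2 := φ.integral_comp_comm hi2
  rw [← e1]
  refine Eq.trans ?_ e2
  refine ((exists_modular_real ν).choose_spec.2 _ (φ.continuous.comp hf)
    (hf'.comp_left (map_zero φ))).trans ?_
  exact integral_congr_ae (Filter.Eventually.of_forall fun s => (map_smul φ _ _).symm)

variable {A : GCStarAlg G}

/-- The adjoint of `f` in the convolution algebra `C_c(G, A)`. -/
def starC (f : C_c(G, A)) : C_c(G, A) where
  toFun s := modular ν s • A.act s (star (f s⁻¹))
  continuous_toFun := (continuous_modular ν).smul ((continuous_act_uncurry A).comp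
    (continuous_id.prodMk (f.continuous.comp continuous_inv).star))
  hasCompactSupport' := (f.hasCompactSupport.comp_homeomorph (Homeomorph.inv G)).mono
    fun s hs h => hs (by
      change f s⁻¹ = 0 at h
      simp [h])

theorem CovRep.integrate_starC {D : Type u} [NonUnitalCStarAlgebra D] (ρ : CovRep A D)
    (f : C_c(G, A)) : ρ.integrate ν (starC ν f) = star (ρ.integrate ν f) :=
  multiplier_ext fun d => by
    rw [integrate_fst, star_integrate_fst,
      integral_eq_modular ν _ (ρ.continuous_star_integrand f d)
        (f.hasCompactSupport.mono fun s hs h => hs (by simp [h, CovRep.p]))]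
    refine integral_congr_ae (Filter.Eventually.of_forall fun s => ?_)
    change ρ.p (modular ν s • A.act s (star (f s⁻¹))) (ρ.u s d) =
      modular ν s • ρ.u s⁻¹⁻¹ (ρ.p (star (f s⁻¹)) d)
    rw [inv_inv, ← p_act_u]
    have : ∀ (c : ℝ) (a : A), ρ.p (c • a) = c • ρ.p a := fun c a => by
      have : c • a = (c : ℂ) • a := by simp
      rw [this, CovRep.p, map_smul, DoubleCentralizer.smul_fst]
      simp [CovRep.p]
    rw [this]
    rfl

end modular

/-! ### The canonical covariant representation in the maximal crossed product -/

section maximalCanonical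

variable {G : Type u} [Group G] [TopologicalSpace G] [MeasurableSpace G] [BorelSpace G]
  (ν : Measure G) [ν.IsHaarMeasure] (A : GCStarAlg G)

/-- The C*-algebra containing the maximal crossed product. -/
def MaxAmbient : Type u := lp (fun p : covNorms ν A => 𝓜(ℂ, CovAlg ν p)) ∞

instance : NonUnitalCStarAlgebra (MaxAmbient ν A) :=
  inferInstanceAs (NonUnitalCStarAlgebra (lp (fun p : covNorms ν A => 𝓜(ℂ, CovAlg ν p)) ∞))

variable {ν A} in
theorem MaxAmbient.ext {x y : MaxAmbient ν A} (h : ∀ p, x.1 p = y.1 p) : x = y :=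
  lp.ext (funext h)

variable {ν A} in
theorem MaxAmbient.norm_le {x : MaxAmbient ν A} {C : ℝ} (hC : 0 ≤ C) (h : ∀ p, ‖x.1 p‖ ≤ C) :
    ‖x‖ ≤ C :=
  lp.norm_le_of_forall_le hC h

/-- `maxVec` as a linear map. -/
def maxVecL : C_c(G, A) →ₗ[ℂ] MaxAmbient ν A where
  toFun := maxVec ν A
  map_add' f g := MaxAmbient.ext (fun p => (covRepOf ν p).integrate_add ν f g)
  map_smul' c f := MaxAmbient.ext (fun p => (covRepOf ν p).integrate_smul ν c f)

variable {A}

theorem norm_maxVec_le (f : C_c(G, A)) : ‖maxVecL ν A f‖ ≤ ∫ s, ‖f s‖ ∂ν :=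
  MaxAmbient.norm_le (integral_nonneg fun _ => norm_nonneg _)
    fun p => (covRepOf ν p).norm_integrate_le ν f

/-- The direct sum of the multipliers `π(a)`. -/
def piVec (a : A) : MaxAmbient ν A :=
  ⟨fun p => (covRepOf ν p).π a, memℓp_infty ⟨‖a‖, by
    rintro _ ⟨p, rfl⟩; exact NonUnitalStarAlgHom.norm_apply_le (covRepOf ν p).π a⟩⟩

variable (A) in
/-- The direct sum of the multipliers `U_s`. -/
def uVec (s : G) : MaxAmbient ν A :=
  ⟨fun p => ((covRepOf ν p).U s : 𝓜(ℂ, CovAlg ν p)), memℓp_infty ⟨1, by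
    rintro _ ⟨p, rfl⟩; exact norm_unitary_le _⟩⟩

theorem norm_piVec_le (a : A) : ‖piVec ν a‖ ≤ ‖a‖ :=
  MaxAmbient.norm_le (norm_nonneg _)
    fun p => NonUnitalStarAlgHom.norm_apply_le (covRepOf ν p).π a

theorem continuous_piVec : Continuous (piVec ν (A := A)) :=
  AddMonoidHomClass.continuous_of_bound
    (⟨⟨piVec ν, MaxAmbient.ext (fun p => map_zero (covRepOf ν p).π)⟩,
      fun a b => MaxAmbient.ext (fun p => map_add (covRepOf ν p).π a b)⟩ : A →+ MaxAmbient ν A) 1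
    fun a => by simpa using norm_piVec_le ν a

theorem piVec_mul_maxVec (a : A) (f : C_c(G, A)) :
    piVec ν a * maxVecL ν A f = maxVecL ν A (constMul a f) :=
  MaxAmbient.ext (fun p => ((covRepOf ν p).integrate_constMul ν a f).symm)

theorem uVec_mul_maxVec [IsTopologicalGroup G] (s : G) (f : C_c(G, A)) :
    uVec ν A s * maxVecL ν A f = maxVecL ν A (translate s f) :=
  MaxAmbient.ext (fun p => ((covRepOf ν p).integrate_translate ν s f).symm)

theorem star_maxVec [IsTopologicalGroup G] [LocallyCompactSpace G]
    (f : C_c(G, A)) : star (maxVecL ν A f) = maxVecL ν A (starC ν f) :=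
  MaxAmbient.ext (fun p => ((covRepOf ν p).integrate_starC ν f).symm)

theorem star_piVec (a : A) : star (piVec ν a) = piVec ν (star a) :=
  MaxAmbient.ext (fun p => (map_star (covRepOf ν p).π a).symm)

theorem star_uVec (s : G) : star (uVec ν A s) = uVec ν A s⁻¹ :=
  MaxAmbient.ext (fun p => (covRepOf ν p).star_U s)

/-- Evaluation of the left multiplier in the component `p` at `d`. -/
def evalVec (p : covNorms ν A) (d : CovAlg ν p) : MaxAmbient ν A →L[ℂ] CovAlg ν p :=
  LinearMap.mkContinuous
    { toFun := fun x => (x.1 p).fst d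
      map_add' := fun _ _ => rfl
      map_smul' := fun _ _ => rfl } ‖d‖ fun x => by
    refine ((x.1 p).fst.le_opNorm d).trans ?_
    rw [mul_comm, DoubleCentralizer.norm_fst]
    gcongr
    exact lp.norm_apply_le_norm (E := fun p : covNorms ν A => 𝓜(ℂ, CovAlg ν p))
      ENNReal.top_ne_zero x p

/-- The identity is checked by evaluating each component at vectors. Norm continuity of the
integrand is assumed because s ↦ U_s is only strictly continuous, so that a general y in the ambient
algebra need not give a norm integral. -/
theorem maxVec_mul (f : C_c(G, A)) (y : MaxAmbient ν A)
    (hy : Continuous fun s => piVec ν (f s) * (uVec ν A s * y)) :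
    maxVecL ν A f * y = ∫ s, piVec ν (f s) * (uVec ν A s * y) ∂ν := by
  have hi : Integrable (fun s => piVec ν (f s) * (uVec ν A s * y)) ν :=
    hy.integrable_of_hasCompactSupport (f.hasCompactSupport.mono fun s hs h => hs (by
      have : piVec ν (f s) = 0 := norm_le_zero_iff.1 ((norm_piVec_le ν _).trans (by simp [h]))
      simp [this]))
  refine MaxAmbient.ext (fun p => multiplier_ext fun d => ?_)
  refine Eq.trans ?_ ((evalVec ν p d).integral_comp_comm hi)
  rfl

variable [IsTopologicalGroup G] [LocallyCompactSpace G]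

/-- Translation is continuous in the L¹-norm: for s in a compact neighbourhood K of s₀, all
translates are supported in the compact set K · supp f. -/
theorem tendsto_integral_norm_translate (f : C_c(G, A)) (s₀ : G) :
    Filter.Tendsto (fun s => ∫ t, ‖translate s f t - translate s₀ f t‖ ∂ν) (nhds s₀) (nhds 0) := by
  obtain ⟨K, hK, hKs⟩ := exists_compact_mem_nhds s₀
  have hK' : IsCompact ((fun p : G × G => p.1 * p.2) '' (K ×ˢ tsupport f)) :=
    (hK.prod f.hasCompactSupport).image continuous_mul
  have h0 : ∀ s t, s ∈ K → t ∉ (fun p : G × G => p.1 * p.2) '' (K ×ˢ tsupport f) →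
      translate s f t = 0 := fun s t hs ht => by
    have : s⁻¹ * t ∉ tsupport f := fun h => ht ⟨(s, s⁻¹ * t), ⟨hs, h⟩, by simp⟩
    change A.act s (f (s⁻¹ * t)) = 0
    rw [image_eq_zero_of_notMem_tsupport this, map_zero]
  have hF : Continuous fun p : G × G => translate p.1 f p.2 :=
    (continuous_act_uncurry A).comp (continuous_fst.prodMk
      (f.continuous.comp (continuous_fst.inv.mul continuous_snd)))
  have hc : ContinuousOn (fun s => ∫ t, ‖translate s f t - translate s₀ f t‖ ∂ν) K := by
    refine continuousOn_integral_of_compact_support hK' ?_ ?_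
    · exact ((hF.sub (hF.comp (continuous_const.prodMk continuous_snd))).norm).continuousOn
    · intro s t hs ht
      simp [h0 s t hs ht, h0 s₀ t (mem_of_mem_nhds hKs) ht]
  have := (hc.continuousAt hKs).tendsto
  simpa using this

theorem continuous_maxVec_translate (f : C_c(G, A)) :
    Continuous fun s => maxVecL ν A (translate s f) := by
  rw [continuous_iff_continuousAt]
  intro s₀
  rw [ContinuousAt, tendsto_iff_norm_sub_tendsto_zero]
  refine squeeze_zero (fun _ => norm_nonneg _) (fun s => ?_) (tendsto_integral_norm_translate ν f s₀)
  have : maxVecL ν A (translate s f) - maxVecL ν A (translate s₀ f) =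
      maxVecL ν A (translate s f - translate s₀ f) := (map_sub (maxVecL ν A) _ _).symm
  rw [this]
  exact norm_maxVec_le ν _

/-- The product is the norm integral of the elements f(s) · (translate of g by s), all in the image
of C_c(G, A), hence lies in its closure. It is never identified with a convolution in C_c(G, A). -/
theorem maxVec_mul_maxVec_mem (f g : C_c(G, A)) :
    maxVecL ν A f * maxVecL ν A g ∈ (LinearMap.range (maxVecL ν A)).topologicalClosure := by
  have hy : Continuous fun s => piVec ν (f s) * (uVec ν A s * maxVecL ν A g) := by
    simp only [uVec_mul_maxVec]
    exact ((continuous_piVec ν).comp f.continuous).mul (continuous_maxVec_translate ν g)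
  rw [maxVec_mul ν f _ hy]
  refine integral_mem_of_isClosed _ (Submodule.isClosed_topologicalClosure _) fun s => ?_
  rw [uVec_mul_maxVec, piVec_mul_maxVec]
  exact Submodule.le_topologicalClosure _ ⟨_, rfl⟩

variable (A) in
/-- The closure of the image of `C_c(G, A)`. -/
def closureRange : NonUnitalStarSubalgebra ℂ (MaxAmbient ν A) where
  __ := (LinearMap.range (maxVecL ν A)).topologicalClosure
  mul_mem' {x y} hx hy := by
    refine closure_minimal (s := (LinearMap.range (maxVecL ν A) : Set (MaxAmbient ν A)))
      (t := {x | x * y ∈ (LinearMap.range (maxVecL ν A)).topologicalClosure}) ?_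
      ((Submodule.isClosed_topologicalClosure _).preimage (continuous_mul_const y)) hx
    rintro _ ⟨f, rfl⟩
    refine closure_minimal (s := (LinearMap.range (maxVecL ν A) : Set (MaxAmbient ν A)))
      (t := {y | maxVecL ν A f * y ∈ (LinearMap.range (maxVecL ν A)).topologicalClosure}) ?_
      ((Submodule.isClosed_topologicalClosure _).preimage (continuous_const_mul _)) hy
    rintro _ ⟨g, rfl⟩
    exact maxVec_mul_maxVec_mem ν f g
  star_mem' {x} hx := by
    refine closure_minimal (s := (LinearMap.range (maxVecL ν A) : Set (MaxAmbient ν A)))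
      (t := {x | star x ∈ (LinearMap.range (maxVecL ν A)).topologicalClosure}) ?_
      ((Submodule.isClosed_topologicalClosure _).preimage continuous_star) hx
    rintro _ ⟨f, rfl⟩
    exact Submodule.le_topologicalClosure _ ⟨starC ν f, (star_maxVec ν f).symm⟩

/-- The maximal crossed product is defined as a generated C*-algebra. Since the closure of C_c(G, A)
is already closed under products and adjoints, nothing new is generated. -/
theorem genSub_le_closureRange : genSub (maxVec ν A) ≤ closureRange ν A := by
  refine NonUnitalStarSubalgebra.topologicalClosure_minimal _ (NonUnitalStarAlgebra.adjoin_le ?_)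
    (Submodule.isClosed_topologicalClosure (LinearMap.range (maxVecL ν A)))
  rintro _ ⟨f, rfl⟩
  exact Submodule.le_topologicalClosure (LinearMap.range (maxVecL ν A)) ⟨f, rfl⟩

variable (A) in
/-- The inclusion of the maximal crossed product in its ambient algebra. -/
def maxVal : MaxCP ν A →⋆ₙₐ[ℂ] MaxAmbient ν A :=
  NonUnitalStarSubalgebraClass.subtype (genSub (maxVec ν A))

theorem maxVal_injective : Function.Injective (maxVal ν A) := Subtype.val_injective

end maximalCanonical

/-! ### Density of C_c(G, A) and the universal covariant representation. -/

section maximalCanonical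

variable {G : Type u} [Group G] [TopologicalSpace G] [MeasurableSpace G] [BorelSpace G]
  (ν : Measure G) [ν.IsHaarMeasure] {A : GCStarAlg G} [IsTopologicalGroup G] [LocallyCompactSpace G]

theorem norm_maxVal (x : MaxCP ν A) : ‖maxVal ν A x‖ = ‖x‖ :=
  NonUnitalStarAlgHom.norm_map _ (maxVal_injective ν) x

theorem maxVal_κ (f : C_c(G, A)) : maxVal ν A (κ ν A f) = maxVecL ν A f := rfl

variable (A) in
/-- `κ` as a linear map. -/
def κL : C_c(G, A) →ₗ[ℂ] MaxCP ν A where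
  toFun := κ ν A
  map_add' f g := maxVal_injective ν (map_add (maxVecL ν A) f g)
  map_smul' c f := maxVal_injective ν (map_smul (maxVecL ν A) c f)

theorem isInducing_maxVal : Topology.IsInducing (maxVal ν A) :=
  (AddMonoidHomClass.isometry_of_norm (maxVal ν A) (norm_maxVal ν)).isUniformInducing.isInducing

variable (A) in
theorem denseRange_κ : DenseRange (κ ν A) := fun x => by
  rw [(isInducing_maxVal ν).closure_eq_preimage_closure_image, ← Set.range_comp]
  exact genSub_le_closureRange ν x.2

theorem exists_maxVal_eq {y : MaxAmbient ν A} (hy : y ∈ closure (Set.range (maxVecL ν A))) :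
    ∃ x, maxVal ν A x = y := by
  have hc : IsClosed (Set.range (maxVal ν A)) :=
    (AddMonoidHomClass.isometry_of_norm (maxVal ν A)
      (norm_maxVal ν)).isClosedEmbedding.isClosed_range
  exact closure_minimal (by rintro _ ⟨f, rfl⟩; exact ⟨κ ν A f, rfl⟩) hc hy

theorem exists_maxVal_mul {m : MaxAmbient ν A} (hm : ∀ f, ∃ g, m * maxVecL ν A f = maxVecL ν A g)
    (x : MaxCP ν A) : ∃ y, maxVal ν A y = m * maxVal ν A x := by
  refine exists_maxVal_eq ν ?_
  refine (denseRange_κ ν A).induction_on (p := fun x => m * maxVal ν A x ∈ _) x ?_ fun f => ?_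
  · exact isClosed_closure.preimage
      ((continuous_const_mul m).comp (continuous_hom (maxVal ν A)))
  · obtain ⟨g, hg⟩ := hm f
    rw [maxVal_κ, hg]
    exact subset_closure ⟨g, rfl⟩

/-- Left multiplication on the maximal crossed product by an element of the ambient algebra. -/
def maxMulL (m : MaxAmbient ν A) (hm : ∀ f, ∃ g, m * maxVecL ν A f = maxVecL ν A g) :
    MaxCP ν A →L[ℂ] MaxCP ν A :=
  LinearMap.mkContinuous
    { toFun := fun x => (exists_maxVal_mul ν hm x).choose
      map_add' := fun x y => maxVal_injective ν (by
        refine (exists_maxVal_mul ν hm (x + y)).choose_spec.trans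
          (Eq.trans ?_ (map_add (maxVal ν A) _ _).symm)
        rw [(exists_maxVal_mul ν hm x).choose_spec, (exists_maxVal_mul ν hm y).choose_spec,
          map_add, mul_add])
      map_smul' := fun c x => maxVal_injective ν (by
        refine (exists_maxVal_mul ν hm (c • x)).choose_spec.trans
          (Eq.trans ?_ (map_smul (maxVal ν A) _ _).symm)
        rw [(exists_maxVal_mul ν hm x).choose_spec, map_smul, mul_smul_comm]
        rfl) } ‖m‖ fun x => by
    change ‖(exists_maxVal_mul ν hm x).choose‖ ≤ _
    rw [← norm_maxVal, (exists_maxVal_mul ν hm x).choose_spec, ← norm_maxVal ν x]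
    exact norm_mul_le _ _

theorem maxVal_maxMulL (m : MaxAmbient ν A) (hm) (x : MaxCP ν A) :
    maxVal ν A (maxMulL ν m hm x) = m * maxVal ν A x :=
  (exists_maxVal_mul ν hm x).choose_spec

/-- Multiplication by an element of the ambient algebra, as a multiplier of the maximal crossed
product. -/
def maxMul (m : MaxAmbient ν A) (hm : ∀ f, ∃ g, m * maxVecL ν A f = maxVecL ν A g)
    (hm' : ∀ f, ∃ g, star m * maxVecL ν A f = maxVecL ν A g) : 𝓜(ℂ, MaxCP ν A) :=
  mkMul (maxMulL ν m hm) (maxMulL ν (star m) hm') fun x y => maxVal_injective ν (by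
    simp only [map_mul, map_star, maxVal_maxMulL, star_mul, mul_assoc])

theorem maxVal_maxMul (m : MaxAmbient ν A) (hm) (hm') (x : MaxCP ν A) :
    maxVal ν A ((maxMul ν m hm hm').fst x) = m * maxVal ν A x :=
  maxVal_maxMulL ν m hm x

theorem maxVal_star_maxMul (m : MaxAmbient ν A) (hm) (hm') (x : MaxCP ν A) :
    maxVal ν A ((star (maxMul ν m hm hm')).fst x) = star m * maxVal ν A x := by
  rw [maxMul, star_mkMul_fst, maxVal_maxMulL]

/-- Left multiplication by `a ∈ A` on the maximal crossed product. -/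
def piMul (a : A) : 𝓜(ℂ, MaxCP ν A) :=
  maxMul ν (piVec ν a) (fun f => ⟨_, piVec_mul_maxVec ν a f⟩)
    (fun f => ⟨_, by rw [star_piVec, piVec_mul_maxVec]⟩)

theorem maxVal_piMul (a : A) (x : MaxCP ν A) :
    maxVal ν A ((piMul ν a).fst x) = piVec ν a * maxVal ν A x :=
  maxVal_maxMul ν _ _ _ x

variable (A) in
/-- Left multiplication by `s ∈ G` on the maximal crossed product. -/
def uMul (s : G) : 𝓜(ℂ, MaxCP ν A) :=
  maxMul ν (uVec ν A s) (fun f => ⟨_, uVec_mul_maxVec ν s f⟩)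
    (fun f => ⟨_, by rw [star_uVec, uVec_mul_maxVec]⟩)

theorem maxVal_uMul (s : G) (x : MaxCP ν A) :
    maxVal ν A ((uMul ν A s).fst x) = uVec ν A s * maxVal ν A x :=
  maxVal_maxMul ν _ _ _ x

theorem uMul_κ (s : G) (f : C_c(G, A)) : (uMul ν A s).fst (κ ν A f) = κ ν A (translate s f) :=
  maxVal_injective ν (by rw [maxVal_uMul]; exact uVec_mul_maxVec ν s f)

theorem norm_uMul_fst_le (s : G) (x : MaxCP ν A) : ‖(uMul ν A s).fst x‖ ≤ ‖x‖ := by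
  rw [← norm_maxVal, maxVal_uMul, ← norm_maxVal ν x]
  refine (norm_mul_le _ _).trans ?_
  have : ‖uVec ν A s‖ ≤ 1 := MaxAmbient.norm_le zero_le_one fun p => norm_unitary_le _
  exact (mul_le_mul_of_nonneg_right this (norm_nonneg _)).trans (one_mul _).le

/-- An ε/3 argument: contractions transport strong continuity from a dense set to the whole space.
-/
theorem continuous_of_denseRange {X E F : Type*} [TopologicalSpace X] [NormedAddCommGroup E]
    [NormedSpace ℂ E] {Φ : X → E →L[ℂ] E} (hΦ : ∀ s x, ‖Φ s x‖ ≤ ‖x‖) {k : F → E}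
    (hk : DenseRange k) (hc : ∀ f, Continuous fun s => Φ s (k f)) (x : E) :
    Continuous fun s => Φ s x := by
  refine continuous_iff_continuousAt.2 fun s₀ => Metric.continuousAt_iff'.2 fun ε hε => ?_
  obtain ⟨f, hf⟩ := hk.exists_dist_lt x (show 0 < ε / 3 by positivity)
  filter_upwards [Metric.continuousAt_iff'.1 (hc f).continuousAt (ε / 3) (by positivity)] with s hs
  have h1 : ∀ s, dist (Φ s x) (Φ s (k f)) < ε / 3 := fun s => by
    rw [dist_eq_norm, ← map_sub]
    exact (hΦ s _).trans_lt (by rwa [← dist_eq_norm])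
  calc _ ≤ _ + _ + _ := dist_triangle4 _ (Φ s (k f)) (Φ s₀ (k f)) _
    _ < ε / 3 + ε / 3 + ε / 3 := by
      gcongr
      · exact h1 s
      · rw [dist_comm]; exact h1 s₀
    _ = ε := by ring

variable (A) in
/-- The canonical covariant representation of `A` in the multiplier algebra of the maximal crossed
product. -/
def maxCanon : CovRep A (MaxCP ν A) :=
  CovRep.mk'
    { toFun := piMul ν
      map_smul' := fun c a => multiplier_ext fun x => maxVal_injective ν (by
        simp only [maxVal_piMul, DoubleCentralizer.smul_fst, _root_.smul_apply, map_smul,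
          MonoidHom.id_apply]
        rw [← smul_mul_assoc]
        congr 1
        exact MaxAmbient.ext fun p => map_smul (covRepOf ν p).π c a)
      map_zero' := multiplier_ext fun x => maxVal_injective ν (by
        simp only [maxVal_piMul, DoubleCentralizer.zero_fst, _root_.zero_apply, map_zero]
        rw [show piVec ν (0 : A) = 0 from MaxAmbient.ext fun p => map_zero (covRepOf ν p).π,
          zero_mul])
      map_add' := fun a b => multiplier_ext fun x => maxVal_injective ν (by
        simp only [maxVal_piMul, DoubleCentralizer.add_fst, _root_.add_apply, map_add]
        rw [← add_mul]
        congr 1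
        exact MaxAmbient.ext fun p => map_add (covRepOf ν p).π a b)
      map_mul' := fun a b => multiplier_ext fun x => maxVal_injective ν (by
        simp only [maxVal_piMul, DoubleCentralizer.mul_fst, mul_apply_eq_comp]
        rw [← mul_assoc]
        congr 1
        exact MaxAmbient.ext fun p => map_mul (covRepOf ν p).π a b)
      map_star' := fun a => multiplier_ext fun x => maxVal_injective ν (by
        rw [piMul, piMul, maxVal_star_maxMul, maxVal_maxMul, star_piVec]) }
    (uMul ν A)
    (multiplier_ext fun x => maxVal_injective ν (by
      rw [maxVal_uMul]
      exact MaxAmbient.ext fun p => by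
        change ((covRepOf ν p).U 1 : 𝓜(ℂ, CovAlg ν p)) * _ = _
        rw [map_one]
        exact one_mul _))
    (fun s t => multiplier_ext fun x => maxVal_injective ν (by
      simp only [maxVal_uMul, DoubleCentralizer.mul_fst, mul_apply_eq_comp]
      rw [← mul_assoc]
      congr 1
      exact MaxAmbient.ext fun p => congrArg Subtype.val (map_mul (covRepOf ν p).U s t)))
    (fun s => multiplier_ext fun x => maxVal_injective ν (by
      rw [uMul, uMul, maxVal_star_maxMul, maxVal_maxMul, star_uVec]))
    (continuous_of_denseRange (norm_uMul_fst_le ν) (denseRange_κ ν A) fun f => by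
      simp only [uMul_κ]
      exact (isInducing_maxVal ν).continuous_iff.2 (continuous_maxVec_translate ν f))
    (fun s a => multiplier_ext fun x => maxVal_injective ν (by
      change maxVal ν A ((piMul ν (A.act s a) * uMul ν A s).fst x) =
        maxVal ν A ((uMul ν A s * piMul ν a).fst x)
      simp only [maxVal_uMul, maxVal_piMul, DoubleCentralizer.mul_fst, mul_apply_eq_comp]
      rw [← mul_assoc, ← mul_assoc]
      congr 1
      exact MaxAmbient.ext fun p => multiplier_ext fun d => (covRepOf ν p).p_act_u s a d))

theorem maxVal_maxCanon_p (a : A) (x : MaxCP ν A) :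
    maxVal ν A ((maxCanon ν A).p a x) = piVec ν a * maxVal ν A x :=
  maxVal_piMul ν a x

theorem maxVal_maxCanon_u (s : G) (x : MaxCP ν A) :
    maxVal ν A ((maxCanon ν A).u s x) = uVec ν A s * maxVal ν A x :=
  maxVal_uMul ν s x

variable (A) in
theorem isCanonical_maxCanon : IsCanonical (κ ν A) (maxCanon ν A) :=
  ⟨fun a f => maxVal_injective ν ((maxVal_piMul ν a _).trans (piVec_mul_maxVec ν a f)),
    fun s f => uMul_κ ν s f⟩

/-- This says that products f x in the crossed product are the integrals ∫ f(s) U_s x ds. It is the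
substitute for the convolution formula. -/
theorem maxCanon_integrate (f : C_c(G, A)) :
    (maxCanon ν A).integrate ν f = coeM _ (κ ν A f) :=
  multiplier_ext fun x => maxVal_injective ν (by
    have hc := (maxCanon ν A).continuous_p_u f x
    have h1 := (homL (maxVal ν A)).integral_comp_comm ((maxCanon ν A).integrable_p_u ν f x)
    rw [CovRep.integrate_fst, coeM_fst, map_mul, maxVal_κ]
    refine h1.symm.trans ?_
    simp only [homL_apply, maxVal_maxCanon_p, maxVal_maxCanon_u]
    refine (maxVec_mul ν f _ ?_).symm
    simpa only [← maxVal_maxCanon_p, ← maxVal_maxCanon_u, Function.comp_def] using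
      (continuous_hom (maxVal ν A)).comp hc)

end maximalCanonical

/-! ### Completely positive maps -/

section completelyPositive

variable {X Y : Type u} [NonUnitalCStarAlgebra X] [NonUnitalCStarAlgebra Y]

/-- Positivity of a matrix over a C*-algebra. -/
def IsPosMatrix {k : ℕ} (M : Fin k → Fin k → Y) : Prop :=
  letI := CStarAlgebra.spectralOrder Y
  haveI := CStarAlgebra.spectralOrderedRing Y
  (0 : CStarMatrix (Fin k) (Fin k) Y) ≤ CStarMatrix.ofMatrix M

theorem isPosMatrix_gram {k : ℕ} (v : Fin k → Y) : IsPosMatrix fun i j => star (v i) * v j := by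
  let _ := CStarAlgebra.spectralOrder Y
  have := CStarAlgebra.spectralOrderedRing Y
  -- The Gram matrix is V* V for the square matrix V with v as first row and zeros below; an empty
  -- matrix has no first row.
  rcases k with _ | k
  · exact le_of_eq (CStarMatrix.ext fun i => i.elim0)
  · let V : CStarMatrix (Fin (k + 1)) (Fin (k + 1)) Y := fun l j => if l = 0 then v j else 0
    have : CStarMatrix.ofMatrix (fun i j => star (v i) * v j) = star V * V := by
      refine CStarMatrix.ext fun i j => ?_
      rw [CStarMatrix.mul_apply, Finset.sum_eq_single 0 (fun l _ hl => by
        simp [V, hl]) (by simp)]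
      rw [CStarMatrix.star_apply]
      rfl
    change 0 ≤ CStarMatrix.ofMatrix (fun i j => star (v i) * v j)
    rw [this]
    exact star_mul_self_nonneg V

theorem isPosMatrix_sum {k : ℕ} {ι : Type*} (s : Finset ι) (M : ι → Fin k → Fin k → Y)
    (h : ∀ l ∈ s, IsPosMatrix (M l)) : IsPosMatrix fun i j => ∑ l ∈ s, M l i j := by
  let _ := CStarAlgebra.spectralOrder Y
  have := CStarAlgebra.spectralOrderedRing Y
  have : CStarMatrix.ofMatrix (fun i j => ∑ l ∈ s, M l i j) =
      ∑ l ∈ s, CStarMatrix.ofMatrix (M l) := by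
    have h : (fun i j => ∑ l ∈ s, M l i j) = ∑ l ∈ s, M l := by
      ext i j
      rw [Finset.sum_apply, Finset.sum_apply]
    rw [h]
    exact map_sum (CStarMatrix.ofMatrixₗ (R := ℂ) (m := Fin k) (n := Fin k) (A := Y)) _ _
  change 0 ≤ CStarMatrix.ofMatrix (fun i j => ∑ l ∈ s, M l i j)
  rw [this]
  exact Finset.sum_nonneg h

theorem isClosed_isPosMatrix {k : ℕ} : IsClosed {M : Fin k → Fin k → Y | IsPosMatrix M} := by
  let _ := CStarAlgebra.spectralOrder Y
  have := CStarAlgebra.spectralOrderedRing Y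
  exact (CStarAlgebra.isClosed_nonneg (A := CStarMatrix (Fin k) (Fin k) Y)).preimage
    CStarMatrix.ofMatrixL.continuous

theorem exists_eq_star_mul_self [PartialOrder X] [StarOrderedRing X] {x : X} (hx : 0 ≤ x) :
    ∃ y, x = star y * y :=
  CStarAlgebra.nonneg_iff_eq_star_mul_self.1 hx

/-- A positive matrix is N* N, which is the sum of the Gram matrices of the rows of N. So positivity
needs to be tested on Gram matrices only. -/
theorem isCompletelyPositive_of_gram (φ : X →ₗ[ℂ] Y)
    (h : ∀ (k : ℕ) (x : Fin k → X), IsPosMatrix fun i j => φ (star (x i) * x j)) :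
    IsCompletelyPositive φ := by
  let _ := CStarAlgebra.spectralOrder X
  let _ := CStarAlgebra.spectralOrder Y
  have := CStarAlgebra.spectralOrderedRing X
  have := CStarAlgebra.spectralOrderedRing Y
  refine ⟨⟨φ, fun k M hM => ?_⟩, rfl⟩
  obtain ⟨N, rfl⟩ := exists_eq_star_mul_self hM
  have := isPosMatrix_sum Finset.univ (fun l i j => φ (star (N l i) * N l j))
    fun l _ => h k (N l)
  refine this.trans_eq (CStarMatrix.ext fun i j => ?_)
  rw [CStarMatrix.map_apply, CStarMatrix.mul_apply, map_sum]
  rfl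

theorem IsCompletelyPositive.continuous {φ : X →ₗ[ℂ] Y} (h : IsCompletelyPositive φ) :
    Continuous φ := by
  let _ := CStarAlgebra.spectralOrder X
  let _ := CStarAlgebra.spectralOrder Y
  have := CStarAlgebra.spectralOrderedRing X
  have := CStarAlgebra.spectralOrderedRing Y
  obtain ⟨ψ, rfl⟩ := h
  exact map_continuous ψ

end completelyPositive

/-! ### The canonical covariant representation in an exotic crossed product -/

section exoticCanonical

variable {G : Type u} [Group G] [TopologicalSpace G]

/-- Composition of a continuous linear map with a compactly supported function. -/
def compC {A B : Type*} [NormedAddCommGroup A] [NormedSpace ℂ A] [NormedAddCommGroup B]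
    [NormedSpace ℂ B] (φ : A →L[ℂ] B) (f : C_c(G, A)) : C_c(G, B) where
  toFun s := φ (f s)
  continuous_toFun := φ.continuous.comp f.continuous
  hasCompactSupport' := f.hasCompactSupport.comp_left (map_zero φ)

variable [IsTopologicalGroup G] [LocallyCompactSpace G] [MeasurableSpace G] [BorelSpace G]
  {ν : Measure G} [ν.IsHaarMeasure]

/-- A representation whose integrated form is a dense inclusion of C_c(G, A) in D is nondegenerate:
k(f) y = ∫ π(f(s)) U_s y ds is an integral of elements of π(A)D, and such products are dense in D.
-/
theorem CovRep.mem_of_p_mem {A : GCStarAlg G} {D : Type u} [NonUnitalCStarAlgebra D]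
    (ρ : CovRep A D) {k : C_c(G, A) → D} (hk : DenseRange k)
    (hi : ∀ f, ρ.integrate ν f = coeM D (k f)) (S : Submodule ℂ D) (hS : IsClosed (S : Set D))
    (h : ∀ a x, ρ.p a x ∈ S) (d : D) : d ∈ S := by
  refine mem_of_forall_mul_mem S hS (fun x y => ?_) d
  refine hk.induction_on (p := fun x => x * y ∈ S) x (hS.preimage (continuous_mul_const y))
    fun f => ?_
  rw [← coeM_fst, ← hi, CovRep.integrate_fst]
  exact integral_mem_of_isClosed S hS fun s => h _ _

namespace CrossedProductFunctor

variable (μ : CrossedProductFunctor ν) (A : GCStarAlg G)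

/-- The canonical covariant representation of `A` in the multiplier algebra of `A ⋊_μ G`. -/
def canon : CovRep A (μ.obj A) := (maxCanon ν A).push (μ.q A) (μ.q_surjective A)

/-- The canonical map `C_c(G, A) → A ⋊_μ G` as a linear map. -/
def inclL : C_c(G, A) →ₗ[ℂ] μ.obj A := (homL (μ.q A)).toLinearMap.comp (κL ν A)

theorem inclL_apply (f : C_c(G, A)) : μ.inclL A f = μ.incl A f := rfl

theorem denseRange_incl : DenseRange (μ.incl A) :=
  (μ.q_surjective A).denseRange.comp (denseRange_κ ν A) (continuous_hom (μ.q A))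

variable {A}

theorem canon_p_incl (a : A) (f : C_c(G, A)) :
    (μ.canon A).p a (μ.incl A f) = μ.incl A (constMul a f) :=
  ((maxCanon ν A).push_p _ _ a _).trans (congrArg (μ.q A) ((isCanonical_maxCanon ν A).1 a f))

theorem canon_u_incl (s : G) (f : C_c(G, A)) :
    (μ.canon A).u s (μ.incl A f) = μ.incl A (translate s f) :=
  ((maxCanon ν A).push_u _ _ s _).trans (congrArg (μ.q A) ((isCanonical_maxCanon ν A).2 s f))

variable (A) in
theorem isCanonical_canon : IsCanonical (μ.incl A) (μ.canon A) :=
  ⟨μ.canon_p_incl, μ.canon_u_incl⟩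

theorem canon_integrate (f : C_c(G, A)) : (μ.canon A).integrate ν f = coeM _ (μ.incl A f) :=
  multiplier_ext fun x => by
    obtain ⟨x, rfl⟩ := μ.q_surjective A x
    have h1 := (homL (μ.q A)).integral_comp_comm ((maxCanon ν A).integrable_p_u ν f x)
    have h2 := congrArg (fun m : 𝓜(ℂ, MaxCP ν A) => μ.q A (m.fst x)) (maxCanon_integrate ν f)
    simp only [CovRep.integrate_fst, coeM_fst, map_mul] at h2
    rw [CovRep.integrate_fst, coeM_fst]
    refine Eq.trans ?_ (h1.trans h2)
    refine integral_congr_ae (Filter.Eventually.of_forall fun s => ?_)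
    exact (congrArg _ ((maxCanon ν A).push_u _ _ _ _)).trans ((maxCanon ν A).push_p _ _ _ _)

theorem incl_mul (f : C_c(G, A)) (x : μ.obj A) :
    μ.incl A f * x = ∫ s, (μ.canon A).p (f s) ((μ.canon A).u s x) ∂ν := by
  rw [← CovRep.integrate_fst, canon_integrate, coeM_fst]

theorem star_incl_mul (f : C_c(G, A)) (x : μ.obj A) :
    star (μ.incl A f) * x = ∫ s, (μ.canon A).u s⁻¹ ((μ.canon A).p (star (f s)) x) ∂ν := by
  rw [← CovRep.star_integrate_fst, canon_integrate, ← map_star, coeM_fst]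

theorem mem_of_canon_p_mem (S : Submodule ℂ (μ.obj A)) (hS : IsClosed (S : Set (μ.obj A)))
    (h : ∀ a x, (μ.canon A).p a x ∈ S) (d : μ.obj A) : d ∈ S :=
  (μ.canon A).mem_of_p_mem (μ.denseRange_incl A) μ.canon_integrate S hS h d

/-- If A x = 0, then (a z)* x = z* (a* x) = 0, so the closed space of all y with y* x = 0 contains
every a z, hence everything by nondegeneracy. -/
theorem eq_zero_of_canon_p_eq_zero {x : μ.obj A} (h : ∀ a, (μ.canon A).p a x = 0) : x = 0 := by
  let S : Submodule ℂ (μ.obj A) :=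
    { carrier := {y | star y * x = 0}
      add_mem' := fun {y z} hy hz => by
        change star (y + z) * x = 0
        rw [star_add, add_mul, show star y * x = 0 from hy, show star z * x = 0 from hz, add_zero]
      zero_mem' := by
        change star (0 : μ.obj A) * x = 0
        rw [star_zero, zero_mul]
      smul_mem' := fun c y hy => by
        change star (c • y) * x = 0
        rw [star_smul, smul_mul_assoc, show star y * x = 0 from hy, smul_zero] }
  have hS : IsClosed (S : Set (μ.obj A)) :=
    isClosed_eq (continuous_star.mul continuous_const) continuous_const
  refine eq_zero_of_forall_mul_left_eq_zero fun y => ?_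
  rw [← star_star y]
  refine μ.mem_of_canon_p_mem S hS (fun a z => ?_) (star y)
  change star ((μ.canon A).p a z) * x = 0
  rw [CovRep.star_p_mul, h, mul_zero]

variable {B : GCStarAlg G}

theorem map_incl (φ : GHom A B) (f : C_c(G, A)) :
    μ.map φ (μ.incl A f) = μ.incl B (compC (homL φ.hom) f) :=
  μ.q_natural φ f _ fun _ => rfl

theorem map_canon_u (φ : GHom A B) (s : G) (x : μ.obj A) :
    μ.map φ ((μ.canon A).u s x) = (μ.canon B).u s (μ.map φ x) := by
  refine (μ.denseRange_incl A).induction_on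
    (p := fun x => μ.map φ ((μ.canon A).u s x) = (μ.canon B).u s (μ.map φ x)) x
    (isClosed_eq ((continuous_hom _).comp (ContinuousLinearMap.continuous _))
      ((ContinuousLinearMap.continuous _).comp (continuous_hom _))) fun f => ?_
  rw [canon_u_incl, map_incl, map_incl, canon_u_incl]
  congr 1
  exact DFunLike.ext _ _ fun t => φ.equivariant s (f (s⁻¹ * t))

/-- The cp-map property, for a continuous map defined by a completely positive map. -/
theorem IsCorrespondence.exists_map {μ : CrossedProductFunctor ν} (hμ : μ.IsCorrespondence)
    (φ : A →L[ℂ] B) (hφ : IsCompletelyPositive (φ : A →ₗ[ℂ] B))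
    (hG : ∀ s a, φ (A.act s a) = B.act s (φ a)) :
    ∃ Φ : μ.obj A →L[ℂ] μ.obj B, ∀ f, Φ (μ.incl A f) = μ.incl B (compC φ f) := by
  obtain ⟨Φ, hΦ, h⟩ := hμ A B φ hφ hG
  exact ⟨⟨Φ, hΦ.continuous⟩, fun f => h f _ fun _ => rfl⟩

end CrossedProductFunctor

end exoticCanonical

/-! ### The linking algebra of a covariant representation -/

section linking

instance (D : Type u) [NonUnitalCStarAlgebra D] : PartialOrder 𝓜(ℂ, D) :=
  CStarAlgebra.spectralOrder _

instance (D : Type u) [NonUnitalCStarAlgebra D] : StarOrderedRing 𝓜(ℂ, D) :=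
  CStarAlgebra.spectralOrderedRing _

/-- The `2 × 2` matrices over the multiplier algebra of `B`. -/
abbrev Mat2 (B : Type u) [NonUnitalCStarAlgebra B] : Type u :=
  CStarMatrix (Fin 2) (Fin 2) 𝓜(ℂ, B)

section matrices

variable {B : Type u} [NonUnitalCStarAlgebra B]

instance : NonUnitalCStarAlgebra (Mat2 B) := CStarMatrix.instNonUnitalCStarAlgebra

/-- The matrix with entries `a`, `b`, `c`, `d`. -/
def mat2 (a b c d : 𝓜(ℂ, B)) : Mat2 B := CStarMatrix.ofMatrix !![a, b; c, d]

@[simp] theorem mat2_00 (a b c d : 𝓜(ℂ, B)) : mat2 a b c d 0 0 = a := rfl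
@[simp] theorem mat2_01 (a b c d : 𝓜(ℂ, B)) : mat2 a b c d 0 1 = b := rfl
@[simp] theorem mat2_10 (a b c d : 𝓜(ℂ, B)) : mat2 a b c d 1 0 = c := rfl
@[simp] theorem mat2_11 (a b c d : 𝓜(ℂ, B)) : mat2 a b c d 1 1 = d := rfl

theorem Mat2.ext {x y : Mat2 B} (h1 : x 0 0 = y 0 0) (h2 : x 0 1 = y 0 1) (h3 : x 1 0 = y 1 0)
    (h4 : x 1 1 = y 1 1) : x = y :=
  CStarMatrix.ext fun i j => by
    fin_cases i <;> fin_cases j <;> assumption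

theorem Mat2.mul_apply (x y : Mat2 B) (i j : Fin 2) :
    (x * y) i j = x i 0 * y 0 j + x i 1 * y 1 j := by
  rw [CStarMatrix.mul_apply, Fin.sum_univ_two]

theorem Mat2.star_apply (x : Mat2 B) (i j : Fin 2) : (star x) i j = star (x j i) := rfl

theorem Mat2.continuous_apply (i j : Fin 2) : Continuous fun x : Mat2 B => x i j :=
  (_root_.continuous_apply j).comp (_root_.continuous_apply (A := fun _ => Fin 2 → 𝓜(ℂ, B)) i)

theorem Mat2.continuous_iff {X : Type*} [TopologicalSpace X] {f : X → Mat2 B} :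
    Continuous f ↔ ∀ i j, Continuous fun x => f x i j :=
  ⟨fun h i j => (Mat2.continuous_apply i j).comp h,
    fun h => _root_.continuous_pi fun i => _root_.continuous_pi fun j => h i j⟩

/-- Conjugation by `diag(v, 1)`. -/
def conjMat (v : 𝓜(ℂ, B)) (x : Mat2 B) : Mat2 B :=
  mat2 (v * x 0 0 * star v) (v * x 0 1) (x 1 0 * star v) (x 1 1)

@[simp] theorem conjMat_00 (v : 𝓜(ℂ, B)) (x : Mat2 B) :
    conjMat v x 0 0 = v * x 0 0 * star v := rfl
@[simp] theorem conjMat_01 (v : 𝓜(ℂ, B)) (x : Mat2 B) : conjMat v x 0 1 = v * x 0 1 := rfl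
@[simp] theorem conjMat_10 (v : 𝓜(ℂ, B)) (x : Mat2 B) : conjMat v x 1 0 = x 1 0 * star v := rfl
@[simp] theorem conjMat_11 (v : 𝓜(ℂ, B)) (x : Mat2 B) : conjMat v x 1 1 = x 1 1 := rfl

theorem conjMat_one (x : Mat2 B) : conjMat 1 x = x := by
  refine Mat2.ext ?_ ?_ ?_ ?_ <;> simp

theorem conjMat_mul (v w : 𝓜(ℂ, B)) (x : Mat2 B) :
    conjMat (v * w) x = conjMat v (conjMat w x) := by
  refine Mat2.ext ?_ ?_ ?_ ?_ <;> simp [mul_assoc]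

/-- Conjugation by `diag(v, 1)`, for a unitary `v`. -/
def conjMatHom (v : unitary 𝓜(ℂ, B)) : Mat2 B →⋆ₙₐ[ℂ] Mat2 B where
  toFun := conjMat (v : 𝓜(ℂ, B))
  map_smul' c x := by
    refine Mat2.ext ?_ ?_ ?_ ?_ <;> simp [conjMat]
  map_zero' := by
    refine Mat2.ext ?_ ?_ ?_ ?_ <;> simp [conjMat]
  map_add' x y := by
    refine Mat2.ext ?_ ?_ ?_ ?_ <;> simp [conjMat, mul_add, add_mul]
  map_mul' x y := by
    have h : star (v : 𝓜(ℂ, B)) * (v : 𝓜(ℂ, B)) = 1 := Unitary.coe_star_mul_self v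
    have h' : ∀ m : 𝓜(ℂ, B), star (v : 𝓜(ℂ, B)) * ((v : 𝓜(ℂ, B)) * m) = m := fun m => by
      rw [← mul_assoc, h, one_mul]
    refine Mat2.ext ?_ ?_ ?_ ?_ <;>
      simp [conjMat, Mat2.mul_apply, mul_add, add_mul, mul_assoc, h']
  map_star' x := by
    refine Mat2.ext ?_ ?_ ?_ ?_ <;> simp [conjMat, Mat2.star_apply, mul_assoc]

end matrices

variable {G : Type u} [Group G] [TopologicalSpace G] {A : GCStarAlg G} {B : Type u}
  [NonUnitalCStarAlgebra B] (ρ : CovRep A B)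

theorem CovRep.continuous_u_comp {F : G → B} (hF : Continuous F) :
    Continuous fun s => ρ.u s (F s) := by
  rw [continuous_iff_continuousAt]
  intro s₀
  rw [ContinuousAt, tendsto_iff_norm_sub_tendsto_zero]
  have h1 : Filter.Tendsto (fun s => ‖F s - F s₀‖ + ‖ρ.u s (F s₀) - ρ.u s₀ (F s₀)‖) (nhds s₀)
      (nhds 0) := by
    have : Continuous fun s => ‖F s - F s₀‖ + ‖ρ.u s (F s₀) - ρ.u s₀ (F s₀)‖ :=
      (hF.sub continuous_const).norm.add ((ρ.continuous_u (F s₀)).sub continuous_const).norm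
    simpa using this.tendsto s₀
  refine squeeze_zero (fun _ => norm_nonneg _) (fun s => ?_) h1
  calc _ = ‖ρ.u s (F s - F s₀) + (ρ.u s (F s₀) - ρ.u s₀ (F s₀))‖ := by rw [map_sub]; abel_nf
    _ ≤ _ := (norm_add_le _ _).trans (by gcongr; exact ρ.norm_u_le _ _)

theorem CovRep.U_mul_coeM (s : G) (b : B) :
    (ρ.U s : 𝓜(ℂ, B)) * coeM B b = coeM B (ρ.u s b) := mul_coeM _ _

theorem CovRep.coeM_mul_star_U (s : G) (b : B) :
    coeM B b * star (ρ.U s : 𝓜(ℂ, B)) = coeM B (star (ρ.u s (star b))) := by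
  rw [map_star, ← U_mul_coeM, star_mul, ← map_star, star_star]

theorem CovRep.π_mul_coeM (a : A) (b : B) : ρ.π a * coeM B b = coeM B (ρ.p a b) := mul_coeM _ _

theorem CovRep.coeM_mul_π (a : A) (b : B) :
    coeM B b * ρ.π a = coeM B (star (ρ.p (star a) (star b))) := by
  rw [map_star, ← π_mul_coeM, star_mul, ← map_star, ← map_star, star_star, star_star]

/-- The pairs `(a, x)` such that the matrix `x` differs from `diag(π(a), *)` by a matrix over
`B`. -/
def linkSub : NonUnitalStarSubalgebra ℂ (A × Mat2 B) where
  -- Entries moved by U lie in B, or in π(A) + B on the diagonal, so that the action is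
  -- norm-continuous. The second diagonal entry is fixed by the action and may be any multiplier,
  -- which makes room for the scalars. The coordinate in A is recorded separately because π need not
  -- be injective.
  carrier := {z | (∃ b, z.2 0 0 = ρ.π z.1 + coeM B b) ∧ (∃ b, z.2 0 1 = coeM B b) ∧
    ∃ b, z.2 1 0 = coeM B b}
  zero_mem' := ⟨⟨0, by simp⟩, ⟨0, by simp⟩, ⟨0, by simp⟩⟩
  add_mem' := by
    rintro x y ⟨⟨a, ha⟩, ⟨b, hb⟩, ⟨c, hc⟩⟩ ⟨⟨a', ha'⟩, ⟨b', hb'⟩, ⟨c', hc'⟩⟩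
    refine ⟨⟨a + a', ?_⟩, ⟨b + b', ?_⟩, ⟨c + c', ?_⟩⟩
    · simp only [Prod.snd_add, Prod.fst_add, CStarMatrix.add_apply, map_add, ha, ha']; abel
    · simp [hb, hb']
    · simp [hc, hc']
  smul_mem' := by
    rintro r x ⟨⟨a, ha⟩, ⟨b, hb⟩, ⟨c, hc⟩⟩
    exact ⟨⟨r • a, by simp [ha]⟩, ⟨r • b, by simp [hb]⟩, ⟨r • c, by simp [hc]⟩⟩
  mul_mem' := by
    rintro x y ⟨⟨a, ha⟩, ⟨b, hb⟩, ⟨c, hc⟩⟩ ⟨⟨a', ha'⟩, ⟨b', hb'⟩, ⟨c', hc'⟩⟩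
    refine ⟨⟨ρ.p x.1 a' + star (ρ.p (star y.1) (star a)) + a * a' + b * c', ?_⟩,
      ⟨ρ.p x.1 b' + a * b' + (y.2 1 1).snd b, ?_⟩,
      ⟨star (ρ.p (star y.1) (star c)) + c * a' + (x.2 1 1).fst c', ?_⟩⟩
    · rw [Prod.snd_mul, Prod.fst_mul, Mat2.mul_apply, ha, ha', hb, hc', map_mul, map_add, map_add,
        map_add, map_mul, map_mul, ← ρ.π_mul_coeM, ← ρ.coeM_mul_π, mul_add, add_mul, add_mul]
      abel
    · rw [Prod.snd_mul, Mat2.mul_apply, ha, hb, hb', map_add, map_add, map_mul, ← ρ.π_mul_coeM,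
        ← coeM_mul, add_mul]
    · rw [Prod.snd_mul, Mat2.mul_apply, hc, ha', hc', map_add, map_add, map_mul, ← ρ.coeM_mul_π,
        ← mul_coeM, mul_add]
  star_mem' := by
    rintro x ⟨⟨a, ha⟩, ⟨b, hb⟩, ⟨c, hc⟩⟩
    refine ⟨⟨star a, ?_⟩, ⟨star c, ?_⟩, ⟨star b, ?_⟩⟩
    · rw [Prod.snd_star, Prod.fst_star, Mat2.star_apply, ha, star_add, map_star, map_star]
    · rw [Prod.snd_star, Mat2.star_apply, hc, map_star]
    · rw [Prod.snd_star, Mat2.star_apply, hb, map_star]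

theorem isClosed_linkSub : IsClosed (linkSub ρ : Set (A × Mat2 B)) := by
  have h : (linkSub ρ : Set (A × Mat2 B)) =
      {z | z.2 0 0 - ρ.π z.1 ∈ Set.range (coeM B)} ∩ ({z | z.2 0 1 ∈ Set.range (coeM B)} ∩
        {z | z.2 1 0 ∈ Set.range (coeM B)}) := by
    ext z
    change (_ ∧ _ ∧ _) ↔ (_ ∧ _ ∧ _)
    refine and_congr ?_ (and_congr ?_ ?_)
    · exact exists_congr fun b => ⟨fun h => by simp [h], fun h => by rw [h]; abel⟩
    · exact exists_congr fun b => eq_comm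
    · exact exists_congr fun b => eq_comm
  rw [h]
  refine IsClosed.inter ?_ (IsClosed.inter ?_ ?_)
  · exact isClosed_range_coeM.preimage (((Mat2.continuous_apply 0 0).comp continuous_snd).sub
      ((continuous_pi ρ).comp continuous_fst))
  · exact isClosed_range_coeM.preimage ((Mat2.continuous_apply 0 1).comp continuous_snd)
  · exact isClosed_range_coeM.preimage ((Mat2.continuous_apply 1 0).comp continuous_snd)

/-- The linking algebra, as a C*-algebra. -/
def LinkAlg : Type u := linkSub ρ

instance : NonUnitalCStarAlgebra (LinkAlg ρ) :=
  haveI := isClosed_linkSub ρ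
  inferInstanceAs (NonUnitalCStarAlgebra (linkSub ρ))

variable {ρ}

/-- The component in `A`. -/
def LinkAlg.base : LinkAlg ρ →⋆ₙₐ[ℂ] A :=
  (NonUnitalStarAlgHom.fst ℂ A (Mat2 B)).comp (NonUnitalStarSubalgebraClass.subtype (linkSub ρ))

/-- The component in the matrices. -/
def LinkAlg.mat : LinkAlg ρ →⋆ₙₐ[ℂ] Mat2 B :=
  (NonUnitalStarAlgHom.snd ℂ A (Mat2 B)).comp (NonUnitalStarSubalgebraClass.subtype (linkSub ρ))

theorem LinkAlg.ext {x y : LinkAlg ρ} (h1 : x.base = y.base) (h2 : x.mat = y.mat) : x = y :=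
  Subtype.ext (Prod.ext h1 h2)

theorem LinkAlg.continuous_iff {X : Type*} [TopologicalSpace X] {f : X → LinkAlg ρ} :
    Continuous f ↔ Continuous (fun x => (f x).base) ∧ Continuous fun x => (f x).mat :=
  ⟨fun h => ⟨(continuous_hom _).comp h, (continuous_hom _).comp h⟩,
    fun h => Continuous.subtype_mk (h.1.prodMk h.2) _⟩

/-- The element `(a, x)` of the linking algebra, where the entries of `x` are given by `a` and
elements of `B` and of its multiplier algebra. -/
def LinkAlg.mk (a : A) (b b₁ b₂ : B) (m : 𝓜(ℂ, B)) : LinkAlg ρ :=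
  ⟨(a, mat2 (ρ.π a + coeM B b) (coeM B b₁) (coeM B b₂) m), ⟨b, rfl⟩, ⟨b₁, rfl⟩, ⟨b₂, rfl⟩⟩

@[simp] theorem LinkAlg.base_mk (a : A) (b b₁ b₂ : B) (m : 𝓜(ℂ, B)) :
    (LinkAlg.mk (ρ := ρ) a b b₁ b₂ m).base = a := rfl

@[simp] theorem LinkAlg.mat_mk (a : A) (b b₁ b₂ : B) (m : 𝓜(ℂ, B)) :
    (LinkAlg.mk (ρ := ρ) a b b₁ b₂ m).mat =
      mat2 (ρ.π a + coeM B b) (coeM B b₁) (coeM B b₂) m := rfl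

theorem LinkAlg.exists_eq_mk (x : LinkAlg ρ) : ∃ b b₁ b₂, x = LinkAlg.mk x.base b b₁ b₂ (x.mat 1 1) := by
  obtain ⟨⟨b, hb⟩, ⟨b₁, hb₁⟩, ⟨b₂, hb₂⟩⟩ := x.2
  exact ⟨b, b₁, b₂, LinkAlg.ext rfl (Mat2.ext hb hb₁ hb₂ rfl)⟩

variable (ρ)

/-- The action of `s ∈ G` on the linking algebra. -/
def linkAct (s : G) : LinkAlg ρ →⋆ₙₐ[ℂ] LinkAlg ρ :=
  NonUnitalStarAlgHom.codRestrict
    (((A.act s).comp LinkAlg.base).prod ((conjMatHom (ρ.U s)).comp LinkAlg.mat)) (linkSub ρ)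
    fun x => by
      obtain ⟨b, b₁, b₂, hx⟩ := x.exists_eq_mk
      rw [hx]
      refine ⟨⟨ρ.u s (star (ρ.u s (star b))), ?_⟩, ⟨ρ.u s b₁, ?_⟩, ⟨star (ρ.u s (star b₂)), ?_⟩⟩
      · change (ρ.U s : 𝓜(ℂ, B)) * (ρ.π x.base + coeM B b) * star (ρ.U s : 𝓜(ℂ, B)) =
          ρ.π (A.act s x.base) + _
        rw [mul_add, add_mul, ← ρ.covariant, mul_assoc _ (coeM B b), ρ.coeM_mul_star_U,
          ρ.U_mul_coeM]
      · exact ρ.U_mul_coeM s b₁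
      · exact ρ.coeM_mul_star_U s b₂

@[simp] theorem linkAct_base (s : G) (x : LinkAlg ρ) :
    (linkAct ρ s x).base = A.act s x.base := rfl

@[simp] theorem linkAct_mat (s : G) (x : LinkAlg ρ) :
    (linkAct ρ s x).mat = conjMat (ρ.U s : 𝓜(ℂ, B)) x.mat := rfl

theorem linkAct_mk (s : G) (a : A) (b b₁ b₂ : B) (m : 𝓜(ℂ, B)) :
    linkAct ρ s (LinkAlg.mk a b b₁ b₂ m) = LinkAlg.mk (A.act s a) (ρ.u s (star (ρ.u s (star b))))
      (ρ.u s b₁) (star (ρ.u s (star b₂))) m := by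
  refine LinkAlg.ext ?_ ?_
  · rw [linkAct_base, LinkAlg.base_mk, LinkAlg.base_mk]
  · rw [linkAct_mat, LinkAlg.mat_mk, LinkAlg.mat_mk]
    refine Mat2.ext ?_ ?_ ?_ ?_
    · rw [conjMat_00, mat2_00, mat2_00, mul_add, add_mul, ← ρ.covariant, mul_assoc _ (coeM B b),
        ρ.coeM_mul_star_U, ρ.U_mul_coeM]
    · rw [conjMat_01, mat2_01, mat2_01, ρ.U_mul_coeM]
    · rw [conjMat_10, mat2_10, mat2_10, ρ.coeM_mul_star_U]
    · rw [conjMat_11, mat2_11, mat2_11]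

theorem continuous_linkAct (x : LinkAlg ρ) : Continuous fun s => linkAct ρ s x := by
  obtain ⟨b, b₁, b₂, hx⟩ := x.exists_eq_mk
  rw [hx]
  simp only [linkAct_mk]
  refine LinkAlg.continuous_iff.2 ⟨?_, ?_⟩
  · simp only [LinkAlg.base_mk]
    exact A.continuous_act _
  · simp only [LinkAlg.mat_mk]
    have hc := continuous_hom (coeM B)
    refine Mat2.continuous_iff.2 (Fin.forall_fin_two.2
      ⟨Fin.forall_fin_two.2 ⟨?_, ?_⟩, Fin.forall_fin_two.2 ⟨?_, ?_⟩⟩)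
    · simp only [mat2_00]
      exact ((continuous_pi ρ).comp (A.continuous_act _)).add
        (hc.comp (ρ.continuous_u_comp (ρ.continuous_u _).star))
    · simp only [mat2_01]
      exact hc.comp (ρ.continuous_u _)
    · simp only [mat2_10]
      exact hc.comp (ρ.continuous_u _).star
    · simp only [mat2_11]
      exact continuous_const

/-- The linking algebra with the action of `G`. -/
def link : GCStarAlg G where
  carrier := LinkAlg ρ
  act := linkAct ρ
  act_one x := LinkAlg.ext (by rw [linkAct_base, A.act_one])
    (by rw [linkAct_mat, map_one, OneMemClass.coe_one, conjMat_one])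
  act_mul s t x := LinkAlg.ext (by rw [linkAct_base, linkAct_base, linkAct_base, A.act_mul])
    (by rw [linkAct_mat, linkAct_mat, linkAct_mat, map_mul, Submonoid.coe_mul, conjMat_mul])
  continuous_act := continuous_linkAct ρ

end linking

/-! ### The corners of the linking algebra and their products. -/

section linkingMaps

variable {G : Type u} [Group G] [TopologicalSpace G] {A : GCStarAlg G} {B : Type u}
  [NonUnitalCStarAlgebra B] (ρ : CovRep A B)

@[simp] theorem LinkAlg.base_star {ρ : CovRep A B} (x : LinkAlg ρ) :
    (star x).base = star x.base := map_star LinkAlg.base x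

@[simp] theorem LinkAlg.mat_star {ρ : CovRep A B} (x : LinkAlg ρ) :
    (star x).mat = star x.mat := map_star LinkAlg.mat x

/-- The embedding of `A` in the linking algebra. -/
def linkAHom : A →⋆ₙₐ[ℂ] LinkAlg ρ where
  toFun a := LinkAlg.mk (ρ := ρ) a 0 0 0 0
  map_smul' c a := LinkAlg.ext (by simp) (Mat2.ext (by simp) (by simp) (by simp) (by simp))
  map_zero' := LinkAlg.ext (by simp) (Mat2.ext (by simp) (by simp) (by simp) (by simp))
  map_add' a b := LinkAlg.ext (by simp) (Mat2.ext (by simp) (by simp) (by simp) (by simp))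
  map_mul' a b := LinkAlg.ext (by simp) (Mat2.ext (by simp [Mat2.mul_apply])
    (by simp [Mat2.mul_apply]) (by simp [Mat2.mul_apply]) (by simp [Mat2.mul_apply]))
  map_star' a := LinkAlg.ext (by simp) (Mat2.ext (by simp [Mat2.star_apply, map_star ρ.π])
    (by simp [Mat2.star_apply]) (by simp [Mat2.star_apply]) (by simp [Mat2.star_apply]))

/-- The equivariant embedding of `A` in the linking algebra. -/
def linkA : GHom A (link ρ) where
  hom := linkAHom ρ
  equivariant s a := by
    change LinkAlg.mk (A.act s a) 0 0 0 0 = linkAct ρ s (LinkAlg.mk a 0 0 0 0)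
    rw [linkAct_mk]
    simp

/-- The embedding of the multiplier algebra of `B` as the second diagonal corner of the linking
algebra. -/
def linkM : 𝓜(ℂ, B) →⋆ₙₐ[ℂ] LinkAlg ρ where
  toFun m := LinkAlg.mk (ρ := ρ) 0 0 0 0 m
  map_smul' c a := LinkAlg.ext (by simp) (Mat2.ext (by simp) (by simp) (by simp) (by simp))
  map_zero' := LinkAlg.ext (by simp) (Mat2.ext (by simp) (by simp) (by simp) (by simp))
  map_add' a b := LinkAlg.ext (by simp) (Mat2.ext (by simp) (by simp) (by simp) (by simp))
  map_mul' a b := LinkAlg.ext (by simp) (Mat2.ext (by simp [Mat2.mul_apply])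
    (by simp [Mat2.mul_apply]) (by simp [Mat2.mul_apply]) (by simp [Mat2.mul_apply]))
  map_star' a := LinkAlg.ext (by simp) (Mat2.ext (by simp [Mat2.star_apply])
    (by simp [Mat2.star_apply]) (by simp [Mat2.star_apply]) (by simp [Mat2.star_apply]))

theorem linkAct_linkM (s : G) (m : 𝓜(ℂ, B)) : linkAct ρ s (linkM ρ m) = linkM ρ m := by
  change linkAct ρ s (LinkAlg.mk 0 0 0 0 m) = LinkAlg.mk 0 0 0 0 m
  rw [linkAct_mk]
  simp

/-- The equivariant embedding of `B` in the linking algebra. -/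
def linkB : GHom (GCStarAlg.trivial G B) (link ρ) where
  hom := (linkM ρ).comp (coeM B)
  equivariant s b := (linkAct_linkM ρ s (coeM B b)).symm

variable (B) in
/-- The scalar multipliers. -/
def scalarHom : ULift.{u} ℂ →⋆ₙₐ[ℂ] 𝓜(ℂ, B) where
  toFun z := z.down • 1
  map_smul' c z := by
    change (c • z.down) • (1 : 𝓜(ℂ, B)) = c • (z.down • 1)
    rw [smul_assoc]
  map_zero' := zero_smul ℂ _
  map_add' z w := add_smul _ _ _
  map_mul' z w := by
    change (z.down * w.down) • (1 : 𝓜(ℂ, B)) = (z.down • 1) * (w.down • 1)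
    rw [smul_mul_smul_comm, one_mul]
  map_star' z := by
    change (star z.down) • (1 : 𝓜(ℂ, B)) = star (z.down • 1)
    rw [star_smul, star_one]

/-- The equivariant embedding of the scalars in the linking algebra. -/
def linkC : GHom (GCStarAlg.scalars G) (link ρ) where
  hom := (linkM ρ).comp (scalarHom B)
  equivariant s z := (linkAct_linkM ρ s (scalarHom B z)).symm

/-- The embedding of `B` as an off-diagonal corner of the linking algebra. -/
def linkOff : B →L[ℂ] LinkAlg ρ where
  toFun b := LinkAlg.mk (ρ := ρ) 0 0 b 0 0
  map_add' a b := LinkAlg.ext (by simp) (Mat2.ext (by simp) (by simp) (by simp) (by simp))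
  map_smul' c a := LinkAlg.ext (by simp) (Mat2.ext (by simp) (by simp) (by simp) (by simp))
  cont := by
    refine LinkAlg.continuous_iff.2 ⟨?_, ?_⟩
    · simp only [LinkAlg.base_mk]
      exact continuous_const
    · simp only [LinkAlg.mat_mk]
      refine Mat2.continuous_iff.2 (Fin.forall_fin_two.2
        ⟨Fin.forall_fin_two.2 ⟨?_, ?_⟩, Fin.forall_fin_two.2 ⟨?_, ?_⟩⟩)
      · simp only [mat2_00]
        exact continuous_const
      · simp only [mat2_01]
        exact continuous_hom (coeM B)
      · simp only [mat2_10]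
        exact continuous_const
      · simp only [mat2_11]
        exact continuous_const

theorem linkAHom_apply (a : A) : linkAHom ρ a = LinkAlg.mk (ρ := ρ) a 0 0 0 0 := rfl

theorem linkM_apply (m : 𝓜(ℂ, B)) : linkM ρ m = LinkAlg.mk (ρ := ρ) 0 0 0 0 m := rfl

theorem linkOff_apply (b : B) : linkOff ρ b = LinkAlg.mk (ρ := ρ) 0 0 b 0 0 := rfl

theorem mk_mul_linkOff (a : A) (b c : B) :
    LinkAlg.mk (ρ := ρ) a b 0 0 0 * linkOff ρ c = linkOff ρ (ρ.p a c + b * c) := by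
  rw [linkOff_apply, linkOff_apply]
  refine LinkAlg.ext (by simp) (Mat2.ext ?_ ?_ ?_ ?_)
  · simp [Mat2.mul_apply]
  · simp [Mat2.mul_apply, add_mul, ρ.π_mul_coeM]
  · simp [Mat2.mul_apply]
  · simp [Mat2.mul_apply]

theorem linkAHom_mul_linkOff (a : A) (b : B) :
    linkAHom ρ a * linkOff ρ b = linkOff ρ (ρ.p a b) :=
  (mk_mul_linkOff ρ a 0 b).trans (by rw [zero_mul, add_zero])

theorem star_linkOff_mul_linkOff (b c : B) :
    star (linkOff ρ b) * linkOff ρ c = linkM ρ (coeM B (star b * c)) := by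
  rw [linkOff_apply, linkOff_apply, linkM_apply]
  refine LinkAlg.ext (by simp) (Mat2.ext ?_ ?_ ?_ ?_)
  · simp [Mat2.mul_apply, Mat2.star_apply, map_star (coeM B)]
  · simp [Mat2.mul_apply, Mat2.star_apply, map_star (coeM B)]
  · simp [Mat2.mul_apply, Mat2.star_apply, map_star (coeM B)]
  · simp [Mat2.mul_apply, Mat2.star_apply, map_star (coeM B)]

theorem linkOff_mul_star_linkOff (b c : B) :
    linkOff ρ b * star (linkOff ρ c) = LinkAlg.mk (ρ := ρ) 0 (b * star c) 0 0 0 := by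
  rw [linkOff_apply, linkOff_apply]
  refine LinkAlg.ext (by simp) (Mat2.ext ?_ ?_ ?_ ?_)
  · simp [Mat2.mul_apply, Mat2.star_apply, map_star (coeM B)]
  · simp [Mat2.mul_apply, Mat2.star_apply, map_star (coeM B)]
  · simp [Mat2.mul_apply, Mat2.star_apply, map_star (coeM B)]
  · simp [Mat2.mul_apply, Mat2.star_apply, map_star (coeM B)]

/-- The off-diagonal corner carries the twisted action b ↦ U_s b, which is the source of the factor
U in U ⊗ u. -/
theorem linkAct_linkOff (s : G) (b : B) : linkAct ρ s (linkOff ρ b) = linkOff ρ (ρ.u s b) := by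
  rw [linkOff_apply, linkOff_apply, linkAct_mk]
  simp

/-- The compression of the second diagonal corner of the linking algebra by `b ∈ B`. -/
def compress (b : B) : LinkAlg ρ →L[ℂ] B where
  toFun x := star b * (x.mat 1 1).fst b
  map_add' x y := by simp [mul_add]
  map_smul' c x := by simp [mul_smul_comm]
  cont := continuous_const.mul (((continuous_leftMul.comp (Mat2.continuous_apply 1 1)).comp
    (continuous_hom LinkAlg.mat)).clm_apply continuous_const)

theorem compress_apply (b : B) (x : LinkAlg ρ) : compress ρ b x = star b * (x.mat 1 1).fst b := rfl

theorem compress_linkM (b : B) (m : 𝓜(ℂ, B)) : compress ρ b (linkM ρ m) = star b * m.fst b := by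
  rw [compress_apply, linkM_apply, LinkAlg.mat_mk, mat2_11]

theorem compress_linkAct (b : B) (s : G) (x : LinkAlg ρ) :
    compress ρ b (linkAct ρ s x) = compress ρ b x := by
  rw [compress_apply, compress_apply, linkAct_mat, conjMat_11]

/-- Only the second column of x enters: b* (x* y)₂₂ b is the sum over c of (x_{c2} b)* (y_{c2} b), a
sum of Gram matrices. -/
theorem isCompletelyPositive_compress (b : B) :
    IsCompletelyPositive (compress ρ b : LinkAlg ρ →ₗ[ℂ] B) := by
  refine isCompletelyPositive_of_gram _ fun k x => ?_
  have : ∀ i j, (compress ρ b : LinkAlg ρ →ₗ[ℂ] B) (star (x i) * x j) =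
      ∑ c : Fin 2, star (((x i).mat c 1).fst b) * ((x j).mat c 1).fst b := fun i j => by
    change compress ρ b (star (x i) * x j) = _
    rw [compress_apply, map_mul, map_star, Mat2.mul_apply, Fin.sum_univ_two, Mat2.star_apply,
      Mat2.star_apply, star_fst_mul, star_fst_mul, ← mul_add]
    simp
  simp only [this]
  exact isPosMatrix_sum _ _ fun c _ => isPosMatrix_gram fun i => ((x i).mat c 1).fst b

end linkingMaps

/-! ### The crossed product by the linking algebra -/

section linkingCrossed

variable {G : Type u} [Group G] [TopologicalSpace G] [IsTopologicalGroup G]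
  [LocallyCompactSpace G] [MeasurableSpace G] [BorelSpace G] {ν : Measure G} [ν.IsHaarMeasure]
  (μ : CrossedProductFunctor ν) {A : GCStarAlg G} {B : Type u}
  [NonUnitalCStarAlgebra B] (ρ : CovRep A B)

namespace CrossedProductFunctor

/-- The canonical representation of `B` on `B ⊗_μ C*_μ G`. -/
abbrev tensorRep (B : Type u) [NonUnitalCStarAlgebra B] :
    CovRep (GCStarAlg.trivial G B) (μ.tensor B) := μ.canon (GCStarAlg.trivial G B)

/-- The map from `B ⊗_μ C*_μ G` to the crossed product by the linking algebra. -/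
def tensorToLink : μ.tensor B →⋆ₙₐ[ℂ] μ.obj (link ρ) := μ.map (linkB ρ)

variable {μ}

/-- Functoriality alone gives no injectivity. The cp-map property supplies maps Ψ back to B ⊗_μ C*_μ
G that compress by elements b of B, and these compressions together detect every element. -/
theorem IsCorrespondence.tensorToLink_injective (hμ : μ.IsCorrespondence) :
    Function.Injective (μ.tensorToLink ρ) := by
  refine (injective_iff_map_eq_zero _).2 fun d hd => ?_
  have h1 : μ.tensorToLink ρ (star d * d) = 0 := by rw [map_mul, hd, mul_zero]
  have h2 : ∀ b x, d * (μ.tensorRep B).p b x = 0 := fun b x => by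
    obtain ⟨Ψ, hΨ⟩ := hμ.exists_map (A := link ρ) (B := GCStarAlg.trivial G B) (compress ρ b)
      (isCompletelyPositive_compress ρ b) (fun s x => compress_linkAct ρ b s x)
    -- Ψ ∘ j is e ↦ b* e b. On C_c(G, B) both sides are integrals of b* f(s) b U_s x, because b
    -- commutes with U_s for the trivial action.
    have key : ∀ e, Ψ (μ.tensorToLink ρ e) * x =
        (μ.tensorRep B).p (star b) (e * (μ.tensorRep B).p b x) := fun e => by
      refine (μ.denseRange_incl (GCStarAlg.trivial G B)).induction_on
        (p := fun e => Ψ (μ.tensorToLink ρ e) * x =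
          (μ.tensorRep B).p (star b) (e * (μ.tensorRep B).p b x)) e
        (isClosed_eq ((Ψ.continuous.comp (continuous_hom _)).mul continuous_const)
          ((ContinuousLinearMap.continuous _).comp (continuous_id.mul continuous_const)))
        fun f => ?_
      rw [tensorToLink, map_incl, hΨ, incl_mul, incl_mul,
        ← ((μ.tensorRep B).p (star b)).integral_comp_comm (CovRep.integrable_p_u ν _ f _)]
      refine integral_congr_ae (Filter.Eventually.of_forall fun s => ?_)
      have e1 := (μ.tensorRep B).p_act_u s b x
      change (μ.tensorRep B).p b _ = _ at e1
      have e2 : compC (compress ρ b) (compC (homL (linkB ρ).hom) f) s = star b * (f s * b) :=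
        compress_linkM ρ b (coeM B (f s))
      change (μ.tensorRep B).p (compC (compress ρ b) (compC (homL (linkB ρ).hom) f) s) _ =
        (μ.tensorRep B).p (star b) _
      rw [e2, ← e1]
      exact ((μ.tensorRep B).p_mul (star b) (f s * b : B) _).trans
        (congrArg _ ((μ.tensorRep B).p_mul (f s) b _))
    -- With e = d* d and j(d) = 0, the key identity gives (d b x)* (d b x) = x* (b* d* d b x) = 0.
    have h3 := key (star d * d)
    rw [h1, map_zero, zero_mul] at h3
    rw [← CStarRing.star_mul_self_eq_zero_iff, star_mul, mul_assoc, ← mul_assoc (star d),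
      CovRep.star_p_mul]
    exact (congrArg (star x * ·) h3.symm).trans (mul_zero _)
  refine eq_zero_of_forall_mul_eq_zero fun y => ?_
  exact μ.mem_of_canon_p_mem (LinearMap.ker (LinearMap.mulLeft ℂ d))
    (isClosed_eq (continuous_const_mul d) continuous_const) h2 y

end CrossedProductFunctor

end linkingCrossed

/-! ### Restriction of multipliers to a Hilbert submodule -/

section restriction

variable {T Q : Type u} [NonUnitalCStarAlgebra T] [NonUnitalCStarAlgebra Q]

/-- `R` is an isometric embedding of `T` in `Q`, as right Hilbert modules over `T` when `T` is
identified with a subalgebra of `Q` along `j`. -/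
structure ModuleEmbedding (R : T →L[ℂ] Q) (j : T →⋆ₙₐ[ℂ] Q) : Prop where
  injective : Function.Injective j
  inner : ∀ x y, star (R x) * R y = j (star x * y)

variable {R : T →L[ℂ] Q} {j : T →⋆ₙₐ[ℂ] Q}

theorem ModuleEmbedding.norm_map (hR : ModuleEmbedding R j) (x : T) : ‖R x‖ = ‖x‖ := by
  rw [← sq_eq_sq₀ (norm_nonneg _) (norm_nonneg _), sq, sq, ← CStarRing.norm_star_mul_self,
    ← CStarRing.norm_star_mul_self, hR.inner, NonUnitalStarAlgHom.norm_map j hR.injective]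

theorem ModuleEmbedding.map_injective (hR : ModuleEmbedding R j) : Function.Injective R :=
  (injective_iff_map_eq_zero _).2 fun x h => by rw [← norm_eq_zero, ← hR.norm_map, h, norm_zero]

theorem ModuleEmbedding.isClosed_range (hR : ModuleEmbedding R j) : IsClosed (Set.range R) :=
  (AddMonoidHomClass.isometry_of_norm R hR.norm_map).isClosedEmbedding.isClosed_range

variable (hR : ModuleEmbedding R j)

/-- The restriction to `T` of an operator on `Q`. -/
def ModuleEmbedding.resL (m : Q →L[ℂ] Q) (h : ∀ x, ∃ y, R y = m (R x)) : T →L[ℂ] T :=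
  LinearMap.mkContinuous
    { toFun := fun x => (h x).choose
      map_add' := fun x y => hR.map_injective (by
        refine (h (x + y)).choose_spec.trans (Eq.trans ?_ (map_add R _ _).symm)
        rw [(h x).choose_spec, (h y).choose_spec, map_add, map_add])
      map_smul' := fun c x => hR.map_injective (by
        refine (h (c • x)).choose_spec.trans (Eq.trans ?_ (map_smul R _ _).symm)
        rw [(h x).choose_spec, map_smul, map_smul]
        rfl) } ‖m‖ fun x => by
    change ‖(h x).choose‖ ≤ _
    rw [← hR.norm_map, (h x).choose_spec, ← hR.norm_map x]
    exact m.le_opNorm _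

theorem ModuleEmbedding.map_resL (m : Q →L[ℂ] Q) (h) (x : T) : R (hR.resL m h x) = m (R x) :=
  (h x).choose_spec

/-- The restriction to `T` of a multiplier of `Q`. -/
def ModuleEmbedding.res (m : 𝓜(ℂ, Q)) (h : ∀ x, ∃ y, R y = m.fst (R x))
    (h' : ∀ x, ∃ y, R y = (star m).fst (R x)) : 𝓜(ℂ, T) :=
  mkMul (hR.resL m.fst h) (hR.resL (star m).fst h') fun x y => hR.injective (by
    rw [← hR.inner, ← hR.inner, map_resL, map_resL, star_fst_mul])

theorem ModuleEmbedding.map_res (m : 𝓜(ℂ, Q)) (h) (h') (x : T) :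
    R ((hR.res m h h').fst x) = m.fst (R x) :=
  hR.map_resL m.fst h x

theorem ModuleEmbedding.map_star_res (m : 𝓜(ℂ, Q)) (h) (h') (x : T) :
    R ((star (hR.res m h h')).fst x) = (star m).fst (R x) := by
  rw [res, star_mkMul_fst, map_resL]

/-- The restriction to `T` of a *-homomorphism to the multipliers of `Q`. -/
def ModuleEmbedding.resHom {C : Type u} [NonUnitalCStarAlgebra C] (θ : C →⋆ₙₐ[ℂ] 𝓜(ℂ, Q))
    (h : ∀ c x, ∃ y, R y = (θ c).fst (R x)) : C →⋆ₙₐ[ℂ] 𝓜(ℂ, T) where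
  toFun c := hR.res (θ c) (h c) (by rw [← map_star]; exact h (star c))
  map_smul' r c := multiplier_ext fun x => hR.map_injective (by
    rw [DoubleCentralizer.smul_fst, _root_.smul_apply, map_smul R, map_res, map_res, map_smul θ]
    rfl)
  map_zero' := multiplier_ext fun x => hR.map_injective (by
    rw [map_res, map_zero, DoubleCentralizer.zero_fst, DoubleCentralizer.zero_fst,
      _root_.zero_apply, _root_.zero_apply, map_zero])
  map_add' c d := multiplier_ext fun x => hR.map_injective (by
    rw [DoubleCentralizer.add_fst, _root_.add_apply, map_add R, map_res, map_res, map_res,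
      map_add θ]
    rfl)
  map_mul' c d := multiplier_ext fun x => hR.map_injective (by
    rw [DoubleCentralizer.mul_fst, mul_apply_eq_comp, map_res, map_res, map_res, map_mul θ]
    rfl)
  map_star' c := multiplier_ext fun x => hR.map_injective (by
    rw [map_res, map_star_res, map_star])

theorem ModuleEmbedding.map_resHom {C : Type u} [NonUnitalCStarAlgebra C]
    (θ : C →⋆ₙₐ[ℂ] 𝓜(ℂ, Q)) (h) (c : C) (x : T) :
    R ((hR.resHom θ h c).fst x) = (θ c).fst (R x) :=
  hR.map_res _ _ _ x

variable {G : Type u} [Group G] [TopologicalSpace G] {A : GCStarAlg G}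

/-- The restriction to `T` of a covariant representation in the multipliers of `Q`. -/
def ModuleEmbedding.resRep [IsTopologicalGroup G] (σ : CovRep A Q)
    (hp : ∀ a x, ∃ y, R y = (σ.π a).fst (R x))
    (hu : ∀ s x, ∃ y, R y = (σ.U s : 𝓜(ℂ, Q)).fst (R x)) : CovRep A T :=
  have hs : ∀ s x, ∃ y, R y = (star (σ.U s : 𝓜(ℂ, Q))).fst (R x) := fun s => by
    rw [σ.star_U]
    exact hu s⁻¹
  CovRep.mk' (hR.resHom σ.π hp) (fun s => hR.res (σ.U s : 𝓜(ℂ, Q)) (hu s) (hs s))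
    (multiplier_ext fun x => hR.map_injective (by
      rw [map_res]
      exact σ.u_one (R x)))
    (fun s t => multiplier_ext fun x => hR.map_injective (by
      rw [DoubleCentralizer.mul_fst, mul_apply_eq_comp, map_res, map_res, map_res]
      exact σ.u_mul s t (R x)))
    (fun s => multiplier_ext fun x => hR.map_injective (by
      rw [map_res, map_star_res, σ.star_U]))
    (fun x => by
      rw [(AddMonoidHomClass.isometry_of_norm R
        hR.norm_map).isUniformInducing.isInducing.continuous_iff]
      simp only [Function.comp_def, map_res]
      exact σ.continuous_u (R x))
    (fun s a => multiplier_ext fun x => hR.map_injective (by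
      rw [DoubleCentralizer.mul_fst, DoubleCentralizer.mul_fst, mul_apply_eq_comp,
        mul_apply_eq_comp, map_res, map_resHom, map_res, map_resHom]
      exact σ.p_act_u s a (R x)))

theorem ModuleEmbedding.map_resRep_p [IsTopologicalGroup G] (σ : CovRep A Q) (hp) (hu) (a : A)
    (x : T) : R ((hR.resRep σ hp hu).p a x) = σ.p a (R x) :=
  hR.map_resHom _ _ a x

theorem ModuleEmbedding.map_resRep_u [IsTopologicalGroup G] (σ : CovRep A Q) (hp) (hu) (s : G)
    (x : T) : R ((hR.resRep σ hp hu).u s x) = σ.u s (R x) :=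
  hR.map_res _ _ _ x

end restriction

/-- The composition of a covariant representation with an equivariant *-homomorphism. -/
def CovRep.compHom {G : Type u} [Group G] [TopologicalSpace G] {A A' : GCStarAlg G} {D : Type u}
    [NonUnitalCStarAlgebra D] (σ : CovRep A' D) (φ : GHom A A') : CovRep A D where
  π := σ.π.comp φ.hom
  U := σ.U
  continuous_left := σ.continuous_left
  continuous_right := σ.continuous_right
  covariant s a := by
    change σ.π (φ.hom (A.act s a)) = _
    rw [φ.equivariant, σ.covariant]
    rfl

/-! ### Fell absorption -/

section absorption

variable {G : Type u} [Group G] [TopologicalSpace G] [IsTopologicalGroup G]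
  [LocallyCompactSpace G] [MeasurableSpace G] [BorelSpace G] {ν : Measure G} [ν.IsHaarMeasure]
  (μ : CrossedProductFunctor ν) {A : GCStarAlg G} {B : Type u}
  [NonUnitalCStarAlgebra B] (ρ : CovRep A B)

/-- A linear map on `B`, as a linear map on the `G`-C*-algebra with the trivial action. -/
def trivialL {G : Type u} [Group G] [TopologicalSpace G] {B : Type u} [NonUnitalCStarAlgebra B]
    (φ : B →L[ℂ] B) : GCStarAlg.trivial G B →L[ℂ] GCStarAlg.trivial G B := φ

/-- The embedding of `B` as an off-diagonal corner, between the underlying `G`-C*-algebras. -/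
def linkOffL {G : Type u} [Group G] [TopologicalSpace G] {A : GCStarAlg G} {B : Type u}
    [NonUnitalCStarAlgebra B] (ρ : CovRep A B) : GCStarAlg.trivial G B →L[ℂ] link ρ := linkOff ρ

namespace CrossedProductFunctor

/-- The map `f ↦ b e₁₂ ∘ f` from `C_c(G, B)` to the crossed product by the linking algebra. -/
def offL : C_c(G, GCStarAlg.trivial G B) →ₗ[ℂ] μ.obj (link ρ) where
  toFun f := μ.incl (link ρ) (compC (linkOffL ρ) f)
  map_add' f g := by
    rw [← inclL_apply, ← inclL_apply, ← inclL_apply, ← map_add]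
    exact congrArg _ (DFunLike.ext _ _ fun t => map_add (linkOffL ρ) (f t) (g t))
  map_smul' c f := by
    rw [← inclL_apply, ← inclL_apply, RingHom.id_apply, ← map_smul]
    exact congrArg _ (DFunLike.ext _ _ fun t => map_smul (linkOffL ρ) c (f t))

theorem offL_apply (f : C_c(G, GCStarAlg.trivial G B)) : μ.offL ρ f =
    μ.incl (link ρ) (compC (linkOffL ρ) f) := rfl

theorem tensorToLink_incl (f : C_c(G, GCStarAlg.trivial G B)) :
    μ.tensorToLink ρ (μ.incl _ f) =
      μ.incl (link ρ) (compC (homL (linkB ρ).hom) f) := μ.map_incl _ f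

theorem canon_p_star_offL (b : GCStarAlg.trivial G B) (f : C_c(G, GCStarAlg.trivial G B)) :
    (μ.canon (link ρ)).p (star (linkOffL ρ b)) (μ.offL ρ f) =
      μ.tensorToLink ρ ((μ.tensorRep B).p (star b) (μ.incl _ f)) := by
  rw [offL_apply, canon_p_incl, canon_p_incl, tensorToLink_incl]
  congr 1
  exact DFunLike.ext _ _ fun t => star_linkOff_mul_linkOff ρ b (f t)

theorem canon_p_offL (a : A) (f : C_c(G, GCStarAlg.trivial G B)) :
    (μ.canon (link ρ)).p ((linkA ρ).hom a) (μ.offL ρ f) =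
      μ.offL ρ (compC (trivialL (ρ.p a)) f) := by
  rw [offL_apply, canon_p_incl, offL_apply]
  congr 1
  exact DFunLike.ext _ _ fun t => linkAHom_mul_linkOff ρ a (f t)

theorem canon_u_offL (s : G) (f : C_c(G, GCStarAlg.trivial G B)) :
    (μ.canon (link ρ)).u s (μ.offL ρ f) =
      μ.offL ρ (compC (trivialL (ρ.u s)) (translate s f)) := by
  rw [offL_apply, canon_u_incl, offL_apply]
  congr 1
  exact DFunLike.ext _ _ fun t => linkAct_linkOff ρ s (f (s⁻¹ * t))

/-- The identity (b e₁₂)* (c e₁₂) = b* c e₂₂, integrated over the group. It makes the corner a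
Hilbert module over the image of B ⊗_μ C*_μ G. -/
theorem star_offL_mul_offL (f g : C_c(G, GCStarAlg.trivial G B)) :
    star (μ.offL ρ f) * μ.offL ρ g = μ.tensorToLink ρ (star (μ.incl _ f) * μ.incl _ g) := by
  rw [star_incl_mul, offL_apply, star_incl_mul]
  have h := (homL (μ.tensorToLink ρ)).integral_comp_comm
    ((μ.tensorRep B).integrable_star_integrand ν f (μ.incl _ g))
  refine Eq.trans ?_ h
  refine integral_congr_ae (Filter.Eventually.of_forall fun s => ?_)
  exact (congrArg _ (μ.canon_p_star_offL ρ (f s) g)).trans (μ.map_canon_u (linkB ρ) s⁻¹ _).symm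

variable {μ}

/-- The inner products agree through an injective, hence isometric, homomorphism. This is the bound
needed to extend the map from C_c(G, B) to the completion. -/
theorem IsCorrespondence.norm_offL (hμ : μ.IsCorrespondence)
    (f : C_c(G, GCStarAlg.trivial G B)) : ‖μ.offL ρ f‖ = ‖μ.inclL _ f‖ := by
  rw [← sq_eq_sq₀ (norm_nonneg _) (norm_nonneg _), sq, sq, ← CStarRing.norm_star_mul_self,
    ← CStarRing.norm_star_mul_self, star_offL_mul_offL,
    NonUnitalStarAlgHom.norm_map _ (hμ.tensorToLink_injective ρ)]
  rfl

variable (μ) in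
/-- The embedding of `B ⊗_μ C*_μ G` as an off-diagonal corner of the crossed product by the linking
algebra. -/
def tensorOff : μ.tensor B →L[ℂ] μ.obj (link ρ) :=
  -- The bound behind this extension comes from the correspondence property and is supplied in
  -- `tensorOff_incl`.
  (μ.offL ρ).extendOfNorm (μ.inclL (GCStarAlg.trivial G B))

theorem IsCorrespondence.tensorOff_incl (hμ : μ.IsCorrespondence)
    (f : C_c(G, GCStarAlg.trivial G B)) : μ.tensorOff ρ (μ.incl _ f) = μ.offL ρ f :=
  LinearMap.extendOfNorm_eq (μ.denseRange_incl (GCStarAlg.trivial G B))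
    ⟨1, fun f => by rw [one_mul, hμ.norm_offL]⟩ f

theorem IsCorrespondence.moduleEmbedding (hμ : μ.IsCorrespondence) :
    ModuleEmbedding (μ.tensorOff ρ) (μ.tensorToLink ρ) where
  injective := hμ.tensorToLink_injective ρ
  inner x y := by
    have hR := (μ.tensorOff ρ).continuous
    refine (μ.denseRange_incl (GCStarAlg.trivial G B)).induction_on₂
      (p := fun x y => star (μ.tensorOff ρ x) * μ.tensorOff ρ y =
        μ.tensorToLink ρ (star x * y))
      (isClosed_eq ((hR.comp continuous_fst).star.mul (hR.comp continuous_snd))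
        ((continuous_hom _).comp (continuous_fst.star.mul continuous_snd))) (fun f g => ?_) x y
    rw [hμ.tensorOff_incl, hμ.tensorOff_incl, star_offL_mul_offL]

/-- Invariance of the corner follows from invariance of the image of C_c(G, B), since an isometric
embedding has closed range. -/
theorem IsCorrespondence.mem_range_of_incl (hμ : μ.IsCorrespondence)
    (m : μ.obj (link ρ) →L[ℂ] μ.obj (link ρ)) (h : ∀ f, ∃ g, m (μ.offL ρ f) = μ.offL ρ g)
    (x : μ.tensor B) : ∃ y, μ.tensorOff ρ y = m (μ.tensorOff ρ x) := by
  refine (μ.denseRange_incl (GCStarAlg.trivial G B)).induction_on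
    (p := fun x => m (μ.tensorOff ρ x) ∈ Set.range (μ.tensorOff ρ)) x
    ((hμ.moduleEmbedding ρ).isClosed_range.preimage (m.continuous.comp
      (μ.tensorOff ρ).continuous)) fun f => ?_
  obtain ⟨g, hg⟩ := h f
  exact ⟨μ.incl _ g, by rw [hμ.tensorOff_incl, hμ.tensorOff_incl, hg]⟩

/-- The covariant representation `(π ⊗_μ 1, U ⊗_μ u)` on `B ⊗_μ C*_μ G`, for a covariant
representation `(π, U)` of `A` in the multipliers of `B`. -/
def IsCorrespondence.absorb (hμ : μ.IsCorrespondence) : CovRep A (μ.tensor B) :=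
  (hμ.moduleEmbedding ρ).resRep ((μ.canon (link ρ)).compHom (linkA ρ))
    (fun a => hμ.mem_range_of_incl ρ _ fun f => ⟨_, μ.canon_p_offL ρ a f⟩)
    (fun s => hμ.mem_range_of_incl ρ _ fun f => ⟨_, μ.canon_u_offL ρ s f⟩)

theorem IsCorrespondence.tensorOff_absorb_p (hμ : μ.IsCorrespondence) (a : A) (x : μ.tensor B) :
    μ.tensorOff ρ ((hμ.absorb ρ).p a x) =
      (μ.canon (link ρ)).p ((linkA ρ).hom a) (μ.tensorOff ρ x) :=
  ModuleEmbedding.map_resRep_p _ _ _ _ a x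

theorem IsCorrespondence.tensorOff_absorb_u (hμ : μ.IsCorrespondence) (s : G) (x : μ.tensor B) :
    μ.tensorOff ρ ((hμ.absorb ρ).u s x) = (μ.canon (link ρ)).u s (μ.tensorOff ρ x) :=
  ModuleEmbedding.map_resRep_u _ _ _ _ s x

theorem IsCorrespondence.absorb_p_incl (hμ : μ.IsCorrespondence) (a : A)
    (f : C_c(G, GCStarAlg.trivial G B)) :
    (hμ.absorb ρ).p a (μ.incl _ f) = μ.incl _ (compC (trivialL (ρ.p a)) f) :=
  (hμ.moduleEmbedding ρ).map_injective (by
    rw [hμ.tensorOff_absorb_p, hμ.tensorOff_incl, hμ.tensorOff_incl, canon_p_offL])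

theorem IsCorrespondence.absorb_u_incl (hμ : μ.IsCorrespondence) (s : G)
    (f : C_c(G, GCStarAlg.trivial G B)) :
    (hμ.absorb ρ).u s (μ.incl _ f) =
      μ.incl _ (compC (trivialL (ρ.u s)) (translate s f)) :=
  (hμ.moduleEmbedding ρ).map_injective (by
    rw [hμ.tensorOff_absorb_u, hμ.tensorOff_incl, hμ.tensorOff_incl, canon_u_offL])

/-- The heart of the factorization: left multiplication on the corner by the image of f under A ⋊_μ
G → L ⋊_μ G is the integrated form of the absorbed representation. Since the former makes sense on
all of A ⋊_μ G, so does the latter. -/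
theorem map_linkA_incl_mul_tensorOff (hμ : μ.IsCorrespondence) (f : C_c(G, A)) (x : μ.tensor B) :
    μ.map (linkA ρ) (μ.incl A f) * μ.tensorOff ρ x =
      μ.tensorOff ρ (((hμ.absorb ρ).integrate ν f).fst x) := by
  rw [map_incl, incl_mul, CovRep.integrate_fst,
    ← (μ.tensorOff ρ).integral_comp_comm ((hμ.absorb ρ).integrable_p_u ν f x)]
  refine integral_congr_ae (Filter.Eventually.of_forall fun s => ?_)
  beta_reduce
  rw [hμ.tensorOff_absorb_p, hμ.tensorOff_absorb_u]
  rfl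

theorem IsCorrespondence.mem_range_map_linkA (hμ : μ.IsCorrespondence) (y : μ.obj A)
    (x : μ.tensor B) :
    ∃ z, μ.tensorOff ρ z = (coeM _ (μ.map (linkA ρ) y)).fst (μ.tensorOff ρ x) := by
  refine (μ.denseRange_incl A).induction_on
    (p := fun y => μ.map (linkA ρ) y * μ.tensorOff ρ x ∈ Set.range (μ.tensorOff ρ)) y
    ((hμ.moduleEmbedding ρ).isClosed_range.preimage
      ((continuous_hom _).mul continuous_const)) fun f => ?_
  exact ⟨_, (map_linkA_incl_mul_tensorOff ρ hμ f x).symm⟩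

/-- The *-homomorphism from `A ⋊_μ G` to the multipliers of `B ⊗_μ C*_μ G` that is given by the
integrated form of `(π ⊗_μ 1, U ⊗_μ u)`. -/
def IsCorrespondence.absorbHom (hμ : μ.IsCorrespondence) :
    μ.obj A →⋆ₙₐ[ℂ] 𝓜(ℂ, μ.tensor B) :=
  (hμ.moduleEmbedding ρ).resHom ((coeM _).comp (μ.map (linkA ρ))) (hμ.mem_range_map_linkA ρ)

theorem IsCorrespondence.tensorOff_absorbHom (hμ : μ.IsCorrespondence) (y : μ.obj A)
    (x : μ.tensor B) :
    μ.tensorOff ρ ((hμ.absorbHom ρ y).fst x) = μ.map (linkA ρ) y * μ.tensorOff ρ x :=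
  ModuleEmbedding.map_resHom _ _ _ y x

theorem IsCorrespondence.absorbHom_incl (hμ : μ.IsCorrespondence) (f : C_c(G, A)) :
    hμ.absorbHom ρ (μ.incl A f) = (hμ.absorb ρ).integrate ν f :=
  multiplier_ext fun x => (hμ.moduleEmbedding ρ).map_injective (by
    rw [hμ.tensorOff_absorbHom, map_linkA_incl_mul_tensorOff])

end CrossedProductFunctor

end absorption

/-! ### The canonical bilinear map -/

section tensorMap

theorem CovRep.p_add {G : Type u} [Group G] [TopologicalSpace G] {A : GCStarAlg G} {D : Type u}
    [NonUnitalCStarAlgebra D] (σ : CovRep A D) (a b : A) (d : D) :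
    σ.p (a + b) d = σ.p a d + σ.p b d := by simp [CovRep.p]

theorem CovRep.p_smul {G : Type u} [Group G] [TopologicalSpace G] {A : GCStarAlg G} {D : Type u}
    [NonUnitalCStarAlgebra D] (σ : CovRep A D) (c : ℂ) (a : A) (d : D) :
    σ.p (c • a) d = c • σ.p a d := by simp [CovRep.p]

variable {G : Type u} [Group G] [TopologicalSpace G] [IsTopologicalGroup G]
  [LocallyCompactSpace G] [MeasurableSpace G] [BorelSpace G] {ν : Measure G} [ν.IsHaarMeasure]
  {μ : CrossedProductFunctor ν} {A : GCStarAlg G} {B : Type u}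
  [NonUnitalCStarAlgebra B] (ρ : CovRep A B)

namespace CrossedProductFunctor

/-- In L ⋊_μ G the tensor b ⊗ c is an honest product: b acts as a multiplier on the image of C*_μ G,
which enters through the scalars in the second diagonal corner. This shows continuity of the tensor
map. -/
theorem canon_p_linkB_incl (b : B) (f : C_c(G, GCStarAlg.scalars G)) :
    (μ.canon (link ρ)).p ((linkB ρ).hom b) (μ.map (linkC ρ) (μ.incl _ f)) =
      μ.tensorToLink ρ (μ.incl _ (smulConst f b)) := by
  rw [map_incl, canon_p_incl, tensorToLink_incl]
  congr 1
  refine DFunLike.ext _ _ fun t => ?_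
  refine (map_mul (linkM ρ) (coeM B b) (scalarHom B (f t))).symm.trans ?_
  refine congrArg (linkM ρ) ?_
  refine Eq.trans ?_ (map_smul (coeM B) (ULift.down (α := ℂ) (f t)) b).symm
  exact (mul_smul_comm (ULift.down (α := ℂ) (f t)) (coeM B b) 1).trans (by rw [mul_one])

theorem IsCorrespondence.exists_tensor (hμ : μ.IsCorrespondence) (b : B) (c : μ.groupAlg) :
    ∃ y, μ.tensorToLink ρ y =
      (μ.canon (link ρ)).p ((linkB ρ).hom b) (μ.map (linkC ρ) c) := by
  have hcl : IsClosed (Set.range (μ.tensorToLink ρ)) :=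
    (AddMonoidHomClass.isometry_of_norm (μ.tensorToLink ρ) (NonUnitalStarAlgHom.norm_map _
      (hμ.tensorToLink_injective ρ))).isClosedEmbedding.isClosed_range
  refine (μ.denseRange_incl (GCStarAlg.scalars G)).induction_on
    (p := fun c => (μ.canon (link ρ)).p ((linkB ρ).hom b) (μ.map (linkC ρ) c) ∈
      Set.range (μ.tensorToLink ρ)) c
    (hcl.preimage ((ContinuousLinearMap.continuous _).comp (continuous_hom _))) fun f => ?_
  exact ⟨_, (canon_p_linkB_incl ρ b f).symm⟩

/-- The canonical bilinear map `B × C*_μ G → B ⊗_μ C*_μ G`. -/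
def IsCorrespondence.tensorMap (hμ : μ.IsCorrespondence) :
    B →L[ℂ] μ.groupAlg →L[ℂ] μ.tensor B :=
  LinearMap.mkContinuous₂ (LinearMap.mk₂ ℂ (fun b c => (hμ.exists_tensor ρ b c).choose)
    (fun b b' c => hμ.tensorToLink_injective ρ (by
      refine (hμ.exists_tensor ρ (b + b') c).choose_spec.trans
        (Eq.trans ?_ (map_add (μ.tensorToLink ρ) _ _).symm)
      rw [(hμ.exists_tensor ρ b c).choose_spec, (hμ.exists_tensor ρ b' c).choose_spec,
        ← CovRep.p_add]
      exact congrArg (fun e => (μ.canon (link ρ)).p e _) (map_add (linkB ρ).hom b b')))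
    (fun r b c => hμ.tensorToLink_injective ρ (by
      refine (hμ.exists_tensor ρ (r • b) c).choose_spec.trans
        (Eq.trans ?_ (map_smul (μ.tensorToLink ρ) _ _).symm)
      rw [(hμ.exists_tensor ρ b c).choose_spec, ← CovRep.p_smul]
      exact congrArg (fun e => (μ.canon (link ρ)).p e _) (map_smul (linkB ρ).hom r b)))
    (fun b c c' => hμ.tensorToLink_injective ρ (by
      refine (hμ.exists_tensor ρ b (c + c')).choose_spec.trans
        (Eq.trans ?_ (map_add (μ.tensorToLink ρ) _ _).symm)
      rw [(hμ.exists_tensor ρ b c).choose_spec, (hμ.exists_tensor ρ b c').choose_spec,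
        map_add, map_add]))
    (fun r b c => hμ.tensorToLink_injective ρ (by
      refine (hμ.exists_tensor ρ b (r • c)).choose_spec.trans
        (Eq.trans ?_ (map_smul (μ.tensorToLink ρ) _ _).symm)
      rw [(hμ.exists_tensor ρ b c).choose_spec, map_smul, map_smul]))) 1 fun b c => by
    rw [LinearMap.mk₂_apply, one_mul, ← NonUnitalStarAlgHom.norm_map _ (hμ.tensorToLink_injective ρ),
      (hμ.exists_tensor ρ b c).choose_spec]
    refine (CovRep.norm_p_le _ _ _).trans ?_
    gcongr
    · exact NonUnitalStarAlgHom.norm_apply_le (linkB ρ).hom b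
    · exact NonUnitalStarAlgHom.norm_apply_le (μ.map (linkC ρ)) c

theorem IsCorrespondence.tensorToLink_tensorMap (hμ : μ.IsCorrespondence) (b : B)
    (c : μ.groupAlg) : μ.tensorToLink ρ (hμ.tensorMap ρ b c) =
      (μ.canon (link ρ)).p ((linkB ρ).hom b) (μ.map (linkC ρ) c) :=
  (hμ.exists_tensor ρ b c).choose_spec

theorem IsCorrespondence.tensorMap_incl (hμ : μ.IsCorrespondence) (b : B)
    (f : C_c(G, GCStarAlg.scalars G)) :
    hμ.tensorMap ρ b (μ.incl _ f) = μ.incl _ (smulConst f b) :=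
  hμ.tensorToLink_injective ρ (by rw [hμ.tensorToLink_tensorMap, canon_p_linkB_incl])

theorem IsCorrespondence.absorb_p_tensorMap (hμ : μ.IsCorrespondence) (a : A) (b : B)
    (c : μ.groupAlg) :
    (hμ.absorb ρ).p a (hμ.tensorMap ρ b c) = hμ.tensorMap ρ (ρ.p a b) c := by
  refine (μ.denseRange_incl (GCStarAlg.scalars G)).induction_on
    (p := fun c => (hμ.absorb ρ).p a (hμ.tensorMap ρ b c) = hμ.tensorMap ρ (ρ.p a b) c) c
    (isClosed_eq (by fun_prop) (by fun_prop)) fun f => ?_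
  rw [hμ.tensorMap_incl, hμ.tensorMap_incl, hμ.absorb_p_incl]
  congr 1
  exact DFunLike.ext _ _ fun t => map_smul (ρ.p a) (ULift.down (α := ℂ) (f t)) b

theorem IsCorrespondence.absorb_u_tensorMap (hμ : μ.IsCorrespondence) (s : G) (b : B)
    (c : μ.groupAlg) :
    (hμ.absorb ρ).u s (hμ.tensorMap ρ b c) =
      hμ.tensorMap ρ (ρ.u s b) ((μ.canon (GCStarAlg.scalars G)).u s c) := by
  refine (μ.denseRange_incl (GCStarAlg.scalars G)).induction_on
    (p := fun c => (hμ.absorb ρ).u s (hμ.tensorMap ρ b c) =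
      hμ.tensorMap ρ (ρ.u s b) ((μ.canon (GCStarAlg.scalars G)).u s c)) c
    (isClosed_eq (by fun_prop) (by fun_prop)) fun f => ?_
  rw [canon_u_incl, hμ.tensorMap_incl, hμ.tensorMap_incl, hμ.absorb_u_incl]
  congr 1
  exact DFunLike.ext _ _ fun t => map_smul (ρ.u s) (ULift.down (α := ℂ) (f (s⁻¹ * t))) b

/-- The associativity (π(a) ⊗ 1)(b x) = (π(a) b) x, through which nondegeneracy of π passes to π ⊗
1. -/
theorem IsCorrespondence.absorb_p_tensorRep_p (hμ : μ.IsCorrespondence) (a : A) (b : B)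
    (x : μ.tensor B) :
    (hμ.absorb ρ).p a ((μ.tensorRep B).p b x) = (μ.tensorRep B).p (ρ.p a b) x := by
  refine (μ.denseRange_incl (GCStarAlg.trivial G B)).induction_on
    (p := fun x => (hμ.absorb ρ).p a ((μ.tensorRep B).p b x) =
      (μ.tensorRep B).p (ρ.p a b) x) x
    (isClosed_eq (by fun_prop) (by fun_prop)) fun f => ?_
  refine (congrArg _ (μ.canon_p_incl (A := GCStarAlg.trivial G B) b f)).trans
    (Eq.trans ?_ (μ.canon_p_incl (A := GCStarAlg.trivial G B) (ρ.p a b) f).symm)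
  rw [hμ.absorb_p_incl]
  congr 1
  exact DFunLike.ext _ _ fun t => fst_mul (ρ.π a) b (f t)

/-- Nondegeneracy is used twice: B acts nondegenerately on B ⊗_μ C*_μ G, and π(A)B is dense in B, so
the elements (π(a) b) x suffice. -/
theorem IsCorrespondence.absorb_nondegenerate (hμ : μ.IsCorrespondence) {k : C_c(G, A) → B}
    (hk : DenseRange k) (hi : ∀ f, ρ.integrate ν f = coeM B (k f)) :
    (hμ.absorb ρ).Nondegenerate := by
  let S := Submodule.span ℂ {x | ∃ a d, x = ((hμ.absorb ρ).π a).fst d}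
  have hS : IsClosed (S.topologicalClosure : Set (μ.tensor B)) :=
    S.isClosed_topologicalClosure
  intro x
  change x ∈ S.topologicalClosure
  refine μ.mem_of_canon_p_mem _ hS (fun b x => ?_) x
  let F : GCStarAlg.trivial G B →ₗ[ℂ] μ.tensor B :=
    { toFun := fun b => (μ.tensorRep B).p b x
      map_add' := fun b b' => CovRep.p_add _ _ _ _
      map_smul' := fun c b => CovRep.p_smul _ _ _ _ }
  have hF : Continuous F := (μ.tensorRep B).continuous_p.clm_apply continuous_const
  refine ρ.mem_of_p_mem hk hi (S.topologicalClosure.comap F) (hS.preimage hF) (fun a b => ?_) b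
  refine S.le_topologicalClosure (Submodule.subset_span ⟨a, (μ.tensorRep B).p b x, ?_⟩)
  exact (hμ.absorb_p_tensorRep_p ρ a b x).symm

end CrossedProductFunctor

end tensorMap

/-! ### Nondegeneracy and equivariance of the integrated form -/

section coproduct

theorem exists_dual_ne_zero {X : Type*} [NormedAddCommGroup X] [NormedSpace ℂ X]
    (S : Submodule ℂ X) (hS : IsClosed (S : Set X)) {x : X} (hx : x ∉ S) :
    ∃ l : X →L[ℂ] ℂ, (∀ y ∈ S, l y = 0) ∧ l x ≠ 0 := by
  have : IsClosed (S : Set X) := hS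
  have hx' : S.mkQ x ≠ 0 := fun h => hx ((Submodule.Quotient.mk_eq_zero S).1 h)
  obtain ⟨l, hl⟩ := SeparatingDual.exists_ne_zero (R := ℂ) hx'
  refine ⟨l.comp S.mkQL, fun y hy => ?_, hl⟩
  have : S.mkQL y = 0 := (Submodule.Quotient.mk_eq_zero S).2 hy
  rw [ContinuousLinearMap.comp_apply, this, map_zero]

variable {G : Type u} [Group G] [TopologicalSpace G] [IsTopologicalGroup G]
  [LocallyCompactSpace G] [MeasurableSpace G] [BorelSpace G] {ν : Measure G} [ν.IsHaarMeasure]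

/-- A point value is recovered from averages. If F(1) were outside S, a functional l vanishing on S
with l(F(1)) ≠ 0 could be tested against φ = g · conj(l ∘ F) with a bump function g, and the
integral of g |l ∘ F|² would be both zero and positive. -/
theorem mem_of_integral_mem {X : Type*} [NormedAddCommGroup X] [NormedSpace ℂ X] [CompleteSpace X]
    (S : Submodule ℂ X) (hS : IsClosed (S : Set X)) {F : G → X} (hF : Continuous F)
    (h : ∀ φ : G → ℂ, Continuous φ → HasCompactSupport φ → ∫ s, φ s • F s ∂ν ∈ S) : F 1 ∈ S := by
  by_contra hx
  obtain ⟨l, hl, hl1⟩ := exists_dual_ne_zero S hS hx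
  obtain ⟨g, hg, hg0, hg1⟩ := exists_continuous_nonneg_pos (1 : G)
  have hlF : Continuous fun s => l (F s) := l.continuous.comp hF
  have hφ : Continuous fun s => (g s : ℂ) * star (l (F s)) :=
    (Complex.continuous_ofReal.comp g.continuous).mul hlF.star
  have hφ' : HasCompactSupport fun s => (g s : ℂ) * star (l (F s)) :=
    (hg.comp_left (g := Complex.ofReal) Complex.ofReal_zero).mul_right
  have hi : Integrable (fun s => ((g s : ℂ) * star (l (F s))) • F s) ν :=
    (hφ.smul hF).integrable_of_hasCompactSupport hφ'.smul_right
  have h0 : ∫ s, ((g s * ‖l (F s)‖ ^ 2 : ℝ) : ℂ) ∂ν = 0 := by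
    rw [← hl _ (h _ hφ hφ'), ← l.integral_comp_comm hi]
    refine integral_congr_ae (Filter.Eventually.of_forall fun s => ?_)
    beta_reduce
    rw [map_smul, smul_eq_mul, mul_assoc, Complex.star_def, ← Complex.normSq_eq_conj_mul_self,
      Complex.normSq_eq_norm_sq, Complex.ofReal_mul]
  rw [integral_complex_ofReal, Complex.ofReal_eq_zero] at h0
  have hc : Continuous fun s => g s * ‖l (F s)‖ ^ 2 := g.continuous.mul (hlF.norm.pow 2)
  have hs : HasCompactSupport fun s => g s * ‖l (F s)‖ ^ 2 := hg.mul_right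
  have hn : ∀ s, 0 ≤ g s * ‖l (F s)‖ ^ 2 := fun s => mul_nonneg (hg0 s) (sq_nonneg _)
  have h1 : g 1 * ‖l (F 1)‖ ^ 2 ≠ 0 := mul_ne_zero hg1 (pow_ne_zero 2 (norm_ne_zero_iff.2 hl1))
  exact (hc.integral_pos_of_hasCompactSupport_nonneg_nonzero (μ := ν) hs hn h1).ne' h0

/-- The function `s ↦ φ(s) a`. -/
def smulC {A : GCStarAlg G} (φ : G → ℂ) (hφ : Continuous φ) (hφ' : HasCompactSupport φ) (a : A) :
    C_c(G, A) where
  toFun s := φ s • a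
  continuous_toFun := hφ.smul continuous_const
  hasCompactSupport' := hφ'.smul_right

variable {μ : CrossedProductFunctor ν} {A : GCStarAlg G} {B : Type u}
  [NonUnitalCStarAlgebra B] (ρ : CovRep A B)

namespace CrossedProductFunctor

/-- The averages ∫ φ(s) π(a) U_s d ds are values of the integrated form at φ · a, and they recover
π(a) d at the unit element. -/
theorem IsCorrespondence.absorbHom_nondegenerate (hμ : μ.IsCorrespondence)
    (h : (hμ.absorb ρ).Nondegenerate) : NondegenerateHom (hμ.absorbHom ρ) := by
  let S := Submodule.span ℂ {y | ∃ x d, y = (hμ.absorbHom ρ x).fst d}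
  have hS : IsClosed (S.topologicalClosure : Set (μ.tensor B)) :=
    S.isClosed_topologicalClosure
  have key : ∀ a d, (hμ.absorb ρ).p a d ∈ S.topologicalClosure := fun a d => by
    have h1 := mem_of_integral_mem (ν := ν) S.topologicalClosure hS
      (F := fun s => (hμ.absorb ρ).p a ((hμ.absorb ρ).u s d))
      (((hμ.absorb ρ).p a).continuous.comp ((hμ.absorb ρ).continuous_u d)) fun φ hφ hφ' => ?_
    · rwa [CovRep.u_one] at h1
    · refine S.le_topologicalClosure (Submodule.subset_span ⟨μ.incl A (smulC φ hφ hφ' a), d, ?_⟩)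
      rw [hμ.absorbHom_incl, CovRep.integrate_fst]
      exact integral_congr_ae (Filter.Eventually.of_forall fun s =>
        (CovRep.p_smul _ (φ s) a _).symm)
  intro x
  change x ∈ S.topologicalClosure
  refine closure_minimal ?_ hS (h x)
  change _ ≤ S.topologicalClosure
  refine Submodule.span_le.2 ?_
  rintro _ ⟨a, d, rfl⟩
  exact key a d

theorem IsCorrespondence.absorbHom_canon_u (hμ : μ.IsCorrespondence) (s : G) (x : μ.obj A) :
    hμ.absorbHom ρ ((μ.canon A).u s x) =
      ((hμ.absorb ρ).U s : 𝓜(ℂ, μ.tensor B)) * hμ.absorbHom ρ x := by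
  refine (μ.denseRange_incl A).induction_on
    (p := fun x => hμ.absorbHom ρ ((μ.canon A).u s x) =
      ((hμ.absorb ρ).U s : 𝓜(ℂ, μ.tensor B)) * hμ.absorbHom ρ x) x
    (isClosed_eq ((continuous_hom _).comp (ContinuousLinearMap.continuous _))
      (continuous_const.mul (continuous_hom _))) fun f => ?_
  rw [canon_u_incl, hμ.absorbHom_incl, hμ.absorbHom_incl, CovRep.integrate_translate]

end CrossedProductFunctor

end coproduct

/-! ### Discrete groups -/

section discrete

/-- The factorization of a *-homomorphism through an injective *-homomorphism. -/
def liftHom {C D E : Type*} [NonUnitalCStarAlgebra C] [NonUnitalCStarAlgebra D]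
    [NonUnitalCStarAlgebra E] (j : D →⋆ₙₐ[ℂ] E) (hj : Function.Injective j) (θ : C →⋆ₙₐ[ℂ] E)
    (h : ∀ x, ∃ y, j y = θ x) : C →⋆ₙₐ[ℂ] D where
  toFun x := (h x).choose
  map_smul' c x := hj (by
    refine (h _).choose_spec.trans (Eq.trans ?_ (map_smul j _ _).symm)
    rw [(h x).choose_spec, map_smul]
    rfl)
  map_zero' := hj (by
    refine (h _).choose_spec.trans (Eq.trans ?_ (map_zero j).symm)
    rw [map_zero])
  map_add' x y := hj (by
    refine (h _).choose_spec.trans (Eq.trans ?_ (map_add j _ _).symm)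
    rw [(h x).choose_spec, (h y).choose_spec, map_add])
  map_mul' x y := hj (by
    refine (h _).choose_spec.trans (Eq.trans ?_ (map_mul j _ _).symm)
    rw [(h x).choose_spec, (h y).choose_spec, map_mul])
  map_star' x := hj (by
    refine (h _).choose_spec.trans (Eq.trans ?_ (map_star j _).symm)
    rw [(h x).choose_spec, map_star])

theorem liftHom_apply {C D E : Type*} [NonUnitalCStarAlgebra C] [NonUnitalCStarAlgebra D]
    [NonUnitalCStarAlgebra E] (j : D →⋆ₙₐ[ℂ] E) (hj) (θ : C →⋆ₙₐ[ℂ] E) (h) (x : C) :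
    j (liftHom j hj θ h x) = θ x :=
  (h x).choose_spec

variable {G : Type u} [Group G] [TopologicalSpace G] [DiscreteTopology G]

open scoped Classical in
/-- The function with value `a` at `g` and `0` elsewhere. -/
def singleC {E : Type*} [TopologicalSpace E] [Zero E] (g : G) (a : E) : C_c(G, E) where
  toFun s := if s = g then a else 0
  continuous_toFun := continuous_of_discreteTopology
  hasCompactSupport' := HasCompactSupport.intro (isCompact_singleton (x := g))
    fun _ hs => if_neg hs

theorem singleC_self {E : Type*} [TopologicalSpace E] [Zero E] (g : G) (a : E) :
    singleC g a g = a := if_pos rfl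

theorem singleC_of_ne {E : Type*} [TopologicalSpace E] [Zero E] {g s : G} (h : s ≠ g) (a : E) :
    singleC g a s = 0 :=
  if_neg h

theorem mem_of_singleC_mem {A : GCStarAlg G} (S : Submodule ℂ C_c(G, A))
    (h : ∀ g a, singleC g a ∈ S) (f : C_c(G, A)) : f ∈ S := by
  have hf : (Function.support f).Finite := f.hasCompactSupport.isCompact.finite_of_discrete.subset
    (subset_tsupport f)
  have : f = ∑ g ∈ hf.toFinset, singleC g (f g) := by
    refine DFunLike.ext _ _ fun t => ?_
    rw [CompactlySupportedContinuousMap.sum_apply]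
    by_cases ht : t ∈ hf.toFinset
    · rw [Finset.sum_eq_single_of_mem t ht fun g _ hg => singleC_of_ne hg.symm _, singleC_self]
    · rw [Finset.sum_eq_zero fun g hg => singleC_of_ne (fun e : t = g => ht (by rwa [e])) _]
      simpa using ht
  rw [this]
  exact S.sum_mem fun g _ => h g _

variable [MeasurableSpace G] [BorelSpace G] (ν : Measure G)

/-- The Haar measure of a discrete group is not assumed to be counting measure, so point masses
appear as factors from here on. -/
theorem integral_eq_of_eq_zero {E : Type*} [NormedAddCommGroup E] [NormedSpace ℝ E]
    [CompleteSpace E] (g : G) (F : G → E) (h : ∀ s, s ≠ g → F s = 0) : ∫ s, F s ∂ν = ν.real {g} • F g := by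
  rw [← setIntegral_eq_integral_of_forall_compl_eq_zero (s := {g}) fun s hs => h s hs]
  exact integral_singleton F g

end discrete

/-! ### The coproduct of a discrete group -/

section discreteCoproduct

variable {G : Type u} [Group G] [TopologicalSpace G]

/-- The complex numbers as elements of the `G`-C*-algebra of scalars. -/
def scalarOf (z : ℂ) : GCStarAlg.scalars G := (⟨z⟩ : ULift.{u} ℂ)

theorem eq_smul_scalarOf (a : GCStarAlg.scalars G) :
    a = (ULift.down (α := ℂ) a) • (scalarOf 1 : GCStarAlg.scalars G) :=
  ULift.ext _ _ (mul_one (ULift.down (α := ℂ) a)).symm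

theorem scalarOf_mul (z : ℂ) (a : GCStarAlg.scalars G) : scalarOf z * a = z • a := rfl

theorem CovRep.p_eq_smul {D : Type u} [NonUnitalCStarAlgebra D]
    (ρ : CovRep (GCStarAlg.scalars G) D) (h : ∀ d, ρ.p (scalarOf 1) d = d)
    (a : GCStarAlg.scalars G) (d : D) : ρ.p a d = (ULift.down (α := ℂ) a) • d := by
  rw [eq_smul_scalarOf a, CovRep.p_smul, h]
  congr 1
  exact (mul_one (ULift.down (α := ℂ) a)).symm

/-- The elements of `B` as elements of the `G`-C*-algebra with the trivial action. -/
def trivialOf (G : Type u) [Group G] [TopologicalSpace G] {B : Type u} [NonUnitalCStarAlgebra B]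
    (b : B) : GCStarAlg.trivial G B := b

variable [IsTopologicalGroup G]

theorem IsCanonical.p_one {D : Type u} [NonUnitalCStarAlgebra D]
    {ρ : CovRep (GCStarAlg.scalars G) D} {k : C_c(G, GCStarAlg.scalars G) → D}
    (h : IsCanonical k ρ) (hk : DenseRange k) (d : D) : ρ.p (scalarOf 1) d = d := by
  refine hk.induction_on (p := fun d => ρ.p (scalarOf 1) d = d) d
    (isClosed_eq (ContinuousLinearMap.continuous _) continuous_id) fun f => ?_
  refine (h.1 (scalarOf 1) f).trans (congrArg k (DFunLike.ext _ _ fun t => ?_))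
  exact (scalarOf_mul 1 (f t)).trans (one_smul ℂ (f t))

variable [DiscreteTopology G] [MeasurableSpace G] [BorelSpace G]

section

variable (ν : Measure G) [IsFiniteMeasureOnCompacts ν] {A : GCStarAlg G} {D : Type u}
  [NonUnitalCStarAlgebra D] (ρ : CovRep A D)

theorem CovRep.integrate_singleC_fst (g : G) (a : A) (d : D) :
    (ρ.integrate ν (singleC g a)).fst d = ν.real {g} • ρ.p a (ρ.u g d) := by
  rw [integrate_fst, integral_eq_of_eq_zero ν g, singleC_self]
  intro s hs
  rw [singleC_of_ne hs]
  simp [CovRep.p]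

theorem measureReal_singleton_ne_zero [ν.IsOpenPosMeasure] (g : G) : ν.real {g} ≠ 0 :=
  (measureReal_ne_zero_iff isCompact_singleton.measure_lt_top.ne).2
    ((isOpen_discrete {g}).measure_pos ν (Set.singleton_nonempty g)).ne'

/-- The function on `G` that represents the unitary `u_g` in the group C*-algebras. -/
def deltaC (g : G) : C_c(G, GCStarAlg.scalars G) := singleC g (scalarOf (ν.real {g})⁻¹)

theorem CovRep.integrate_deltaC [ν.IsOpenPosMeasure] (ρ : CovRep (GCStarAlg.scalars G) D)
    (h : ∀ d, ρ.p (scalarOf 1) d = d) (g : G) :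
    ρ.integrate ν (deltaC ν g) = (ρ.U g : 𝓜(ℂ, D)) :=
  multiplier_ext fun d => by
    rw [deltaC, integrate_singleC_fst, ρ.p_eq_smul h, ← Complex.coe_smul, smul_smul, U_fst]
    change ((ν.real {g} : ℂ) * ((ν.real {g} : ℂ))⁻¹) • _ = _
    rw [mul_inv_cancel₀ (Complex.ofReal_ne_zero.2 (measureReal_singleton_ne_zero ν g)), one_smul]

theorem smulConst_deltaC {B : Type u} [NonUnitalCStarAlgebra B] (g : G) (b : B) :
    smulConst (deltaC ν g) b = singleC g (((ν.real {g})⁻¹ : ℂ) • trivialOf G b) := by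
  refine DFunLike.ext _ _ fun t => ?_
  change (ULift.down (α := ℂ) (deltaC ν g t)) • b = _
  by_cases ht : t = g
  · have e1 : deltaC ν g t = scalarOf (ν.real {g})⁻¹ := by rw [ht, deltaC, singleC_self]
    have e2 : singleC g (((ν.real {g})⁻¹ : ℂ) • trivialOf G b) t =
        ((ν.real {g})⁻¹ : ℂ) • trivialOf G b := by rw [ht, singleC_self]
    exact (congrArg (fun z : ULift.{u} ℂ => z.down • b) e1).trans e2.symm
  · have e1 : deltaC ν g t = 0 := singleC_of_ne ht _
    have e2 : singleC g (((ν.real {g})⁻¹ : ℂ) • trivialOf G b) t = 0 := singleC_of_ne ht _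
    exact ((congrArg (fun z : ULift.{u} ℂ => z.down • b) e1).trans (zero_smul ℂ b)).trans e2.symm

end

variable {ν : Measure G} [ν.IsHaarMeasure] {μ : CrossedProductFunctor ν} {B : Type u}
  [NonUnitalCStarAlgebra B] (ρ : CovRep (GCStarAlg.scalars G) B)

namespace CrossedProductFunctor

theorem IsCorrespondence.absorb_p_one (hμ : μ.IsCorrespondence)
    (h : ∀ b, ρ.p (scalarOf 1) b = b) (x : μ.tensor B) : (hμ.absorb ρ).p (scalarOf 1) x = x := by
  refine (μ.denseRange_incl (GCStarAlg.trivial G B)).induction_on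
    (p := fun x => (hμ.absorb ρ).p (scalarOf 1) x = x) x
    (isClosed_eq (ContinuousLinearMap.continuous _) continuous_id) fun f => ?_
  rw [hμ.absorb_p_incl]
  exact congrArg (μ.incl _) (DFunLike.ext _ _ fun t => h (f t))

/-- For discrete G both unitaries come from algebra elements, and then (U ⊗ u)_g is itself the
algebra element w ⊗ u_g. -/
theorem IsCorrespondence.coeM_tensorMap_deltaC (hμ : μ.IsCorrespondence) (g : G) (w : B)
    (hw : coeM B w = (ρ.U g : 𝓜(ℂ, B))) :
    coeM _ (hμ.tensorMap ρ w (μ.incl _ (deltaC ν g))) =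
      ((hμ.absorb ρ).U g : 𝓜(ℂ, μ.tensor B)) :=
  multiplier_ext fun x => by
    rw [hμ.tensorMap_incl, smulConst_deltaC, ← canon_integrate, CovRep.integrate_singleC_fst,
      CovRep.p_smul, ← Complex.coe_smul, smul_smul,
      mul_inv_cancel₀ (Complex.ofReal_ne_zero.2 (measureReal_singleton_ne_zero ν g)), one_smul,
      CovRep.U_fst]
    refine (μ.denseRange_incl (GCStarAlg.trivial G B)).induction_on
      (p := fun x => (μ.tensorRep B).p (trivialOf G w) ((μ.tensorRep B).u g x) = (hμ.absorb ρ).u g x) x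
      (isClosed_eq (by fun_prop) (by fun_prop)) fun f => ?_
    rw [hμ.absorb_u_incl, canon_u_incl]
    refine (μ.canon_p_incl (trivialOf G w) (translate g f)).trans ?_
    refine congrArg (μ.incl _) (DFunLike.ext _ _ fun t => ?_)
    exact congrArg (fun m : 𝓜(ℂ, B) => m.fst (f (g⁻¹ * t))) hw

/-- The multiplier-valued homomorphism sends point masses, hence by density everything, into the
closed subalgebra B ⊗_μ C*_μ G, so it corestricts. -/
theorem IsCorrespondence.exists_coproduct (hμ : μ.IsCorrespondence)
    (h : ∀ b, ρ.p (scalarOf 1) b = b) (w : G → B) (hw : ∀ g, coeM B (w g) = (ρ.U g : 𝓜(ℂ, B))) :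
    ∃ Δ : μ.groupAlg →⋆ₙₐ[ℂ] μ.tensor B,
      ∀ g, Δ (μ.incl _ (deltaC ν g)) = hμ.tensorMap ρ (w g) (μ.incl _ (deltaC ν g)) := by
  have h1 := hμ.absorb_p_one ρ h
  have hr : ∀ x, ∃ y, coeM _ y = hμ.absorbHom ρ x := fun x => by
    refine (μ.denseRange_incl (GCStarAlg.scalars G)).induction_on
      (p := fun x => hμ.absorbHom ρ x ∈ Set.range (coeM (μ.tensor B))) x
      (isClosed_range_coeM.preimage (continuous_hom _)) fun f => ?_
    refine mem_of_singleC_mem ((LinearMap.range (homL (coeM (μ.tensor B))).toLinearMap).comap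
      ((homL (hμ.absorbHom ρ)).toLinearMap.comp (μ.inclL (GCStarAlg.scalars G)))) (fun g a => ?_) f
    refine ⟨(ν.real {g} : ℂ) • (ULift.down (α := ℂ) a) •
      hμ.tensorMap ρ (w g) (μ.incl _ (deltaC ν g)), ?_⟩
    change coeM _ _ = hμ.absorbHom ρ (μ.incl _ (singleC g a))
    rw [map_smul, map_smul, hμ.coeM_tensorMap_deltaC ρ g _ (hw g), hμ.absorbHom_incl]
    refine multiplier_ext fun x => ?_
    rw [CovRep.integrate_singleC_fst, CovRep.p_eq_smul _ h1, DoubleCentralizer.smul_fst,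
      DoubleCentralizer.smul_fst, ← Complex.coe_smul]
    rfl
  refine ⟨liftHom (coeM _) coeM_injective (hμ.absorbHom ρ) hr, fun g => coeM_injective ?_⟩
  rw [liftHom_apply, hμ.absorbHom_incl, CovRep.integrate_deltaC ν _ h1,
    hμ.coeM_tensorMap_deltaC ρ g _ (hw g)]

end CrossedProductFunctor

end discreteCoproduct

/-! ### Norms in representations on Hilbert spaces -/

section states

open scoped ComplexOrder

variable {U : Type*} [CStarAlgebra U] [PartialOrder U] [StarOrderedRing U]

/-- The number ‖h‖ lies in the spectrum of the positive element h, hence 2‖h‖ lies in that of ‖h‖ +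
h. A functional norming this sum must therefore be extremal at both 1 and h. -/
theorem two_mul_norm_le_norm_add {h : U} (hh : 0 ≤ h) : 2 * ‖h‖ ≤ ‖(‖h‖ : ℂ) • (1 : U) + h‖ := by
  rcases subsingleton_or_nontrivial U with hU | hU
  · rw [Subsingleton.elim h 0]
    simp
  · have h1 : ‖h‖ + ‖h‖ ∈ spectrum ℝ (algebraMap ℝ U ‖h‖ + h) :=
      spectrum.add_mem_add_iff.2 (CStarAlgebra.norm_mem_spectrum_of_nonneg hh)
    have h2 := spectrum.norm_le_norm_of_mem h1
    rw [Real.norm_of_nonneg (by positivity), Algebra.algebraMap_eq_smul_one] at h2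
    rw [two_mul, Complex.coe_smul]
    exact h2

theorem norm_norm_smul_one_sub_le {h : U} (hh : 0 ≤ h) : ‖(‖h‖ : ℂ) • (1 : U) - h‖ ≤ ‖h‖ := by
  rcases subsingleton_or_nontrivial U with hU | hU
  · rw [Subsingleton.elim h 0]
    simp
  · have h1 : h ≤ algebraMap ℝ U ‖h‖ := IsSelfAdjoint.le_algebraMap_norm_self (.of_nonneg hh)
    have h2 := CStarAlgebra.norm_le_norm_of_nonneg_of_le (sub_nonneg.2 h1) (sub_le_self _ hh)
    rw [norm_algebraMap', norm_norm, Algebra.algebraMap_eq_smul_one] at h2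
    rwa [Complex.coe_smul]

/-- A norm-attaining positive functional. -/
theorem exists_positive_functional {h : U} (hh : 0 ≤ h) : ∃ l : U →ₗ[ℂ] ℂ,
    (∀ x, 0 ≤ x → 0 ≤ l x) ∧ (∀ x, ‖l x‖ ≤ ‖x‖) ∧ l h = ‖h‖ := by
  by_cases h0 : h = 0
  · exact ⟨0, by simp, by simp, by simp [h0]⟩
  have hpos : 0 < ‖h‖ := norm_pos_iff.2 h0
  -- Since Re l(1) ≤ 1 and Re l(h) ≤ ‖h‖ while the combination reaches 2‖h‖, both inequalities are
  -- equalities.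
  obtain ⟨l, hl, hlx⟩ := exists_dual_vector'' ℂ ((‖h‖ : ℂ) • (1 : U) + h)
  have hle : ∀ x, ‖l x‖ ≤ ‖x‖ := fun x =>
    (ContinuousLinearMap.le_of_opNorm_le _ hl x).trans (one_mul _).le
  have hre : ∀ x, (l x).re ≤ ‖x‖ := fun x => (Complex.re_le_norm _).trans (hle x)
  have h1 : ‖(1 : U)‖ ≤ 1 := by
    rcases subsingleton_or_nontrivial U with hU | hU
    · rw [Subsingleton.elim (1 : U) 0]
      simp
    · exact CStarRing.norm_one.le
  have e := two_mul_norm_le_norm_add hh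
  have hlx' : l ((‖h‖ : ℂ) • (1 : U) + h) = Complex.ofReal ‖(‖h‖ : ℂ) • (1 : U) + h‖ := hlx
  have e2 := congrArg Complex.re hlx'
  rw [map_add, map_smul, smul_eq_mul, Complex.add_re, Complex.re_ofReal_mul,
    Complex.ofReal_re] at e2
  have e3 := hre h
  have e4 := (hre 1).trans h1
  have e5 : (l 1).re = 1 := by nlinarith
  have e6 : (l h).re = ‖h‖ := by nlinarith
  -- The Hermitian part of l, which takes the value Re l(x) at selfadjoint x.
  let l' : U →ₗ[ℂ] ℂ :=
    { toFun := fun x => (1 / 2 : ℂ) * (l x + star (l (star x)))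
      map_add' := fun x y => by simp only [map_add, star_add]; ring
      map_smul' := fun c x => by
        simp only [map_smul, star_smul, star_star, smul_eq_mul, RingHom.id_apply, star_mul]
        ring }
  have hl' : ∀ x, IsSelfAdjoint x → l' x = ((l x).re : ℂ) := fun x hx => by
    change (1 / 2 : ℂ) * (l x + star (l (star x))) = _
    rw [hx.star_eq, Complex.star_def, Complex.add_conj]
    push_cast
    ring
  refine ⟨l', fun x hx => ?_, fun x => ?_, ?_⟩
  · rw [hl' x (.of_nonneg hx), Complex.zero_le_real]
    -- Positivity from the norm: ‖x‖ − Re l(x) = Re l(‖x‖ 1 − x) ≤ ‖x‖.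
    have := (hre _).trans (norm_norm_smul_one_sub_le hx)
    rw [map_sub, map_smul, smul_eq_mul, Complex.sub_re, Complex.re_ofReal_mul, e5] at this
    linarith
  · change ‖(1 / 2 : ℂ) * (l x + star (l (star x)))‖ ≤ _
    rw [norm_mul]
    have := norm_add_le (l x) (star (l (star x)))
    have e7 := hle x
    have e8 := hle (star x)
    rw [norm_star] at this e8
    rw [show ‖(1 / 2 : ℂ)‖ = 1 / 2 by norm_num]
    linarith
  · rw [hl' h (.of_nonneg hh), e6]

end states

/-! ### Representations that attain the norm of a given element. -/

section representations

open scoped ComplexOrder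

/-- The GNS representation of a positive functional norming p* p, with p = a a*, tested on the class
ξ of a*. Here ‖ξ‖ ≤ ‖a‖ and ‖π(a) ξ‖² = φ(p* p) = ‖a‖⁴, so ‖π(a)‖ ≥ ‖a‖. Taking a* as the test
vector avoids a cyclic vector, which would need a unit. -/
theorem exists_rep_norm_le {A : Type u} [NonUnitalCStarAlgebra A] (a : A) :
    ∃ (H : Type u) (_ : NormedAddCommGroup H) (_ : InnerProductSpace ℂ H) (_ : CompleteSpace H)
      (π : A →⋆ₙₐ[ℂ] (H →L[ℂ] H)), ‖a‖ ≤ ‖π a‖ := by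
  let _ := CStarAlgebra.spectralOrder A
  have := CStarAlgebra.spectralOrderedRing A
  let _ := CStarAlgebra.spectralOrder (Unitization ℂ A)
  have := CStarAlgebra.spectralOrderedRing (Unitization ℂ A)
  have hinr : ∀ x : A, 0 ≤ x → (0 : Unitization ℂ A) ≤ x := fun x hx => by
    obtain ⟨y, rfl⟩ := exists_eq_star_mul_self hx
    rw [Unitization.inr_mul, Unitization.inr_star]
    exact star_mul_self_nonneg _
  let p : A := a * star a
  obtain ⟨l, hl0, hl1, hl2⟩ := exists_positive_functional (hinr _ (star_mul_self_nonneg p))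
  let φ : A →ₚ[ℂ] ℂ := PositiveLinearMap.mk₀
    (l.comp (Unitization.inrNonUnitalAlgHom ℂ A : A →ₗ[ℂ] Unitization ℂ A))
    fun x hx => hl0 _ (hinr x hx)
  refine ⟨φ.GNS, inferInstance, inferInstance, inferInstance, φ.gnsNonUnitalStarAlgHom, ?_⟩
  let ξ : φ.PreGNS := φ.toPreGNS (star a)
  have hpa : ‖p‖ = ‖a‖ * ‖a‖ := CStarRing.norm_self_mul_star
  have h1 : ‖ξ‖ ≤ ‖a‖ := by
    rw [← sq_le_sq₀ (norm_nonneg _) (norm_nonneg _)]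
    have h2 : ((‖ξ‖ : ℂ)) ^ 2 = φ (star (star a) * star a) := φ.preGNS_norm_sq ξ
    have h3 : ‖φ (star (star a) * star a)‖ ≤ ‖a‖ ^ 2 := by
      refine (hl1 _).trans ?_
      change ‖((star (star a) * star a : A) : Unitization ℂ A)‖ ≤ _
      rw [Unitization.norm_inr, star_star, sq]
      exact hpa.le
    rwa [← h2, norm_pow, Complex.norm_real, norm_norm] at h3
  have h2 : ‖φ.leftMulMapPreGNS a ξ‖ = ‖a‖ * ‖a‖ := by
    rw [← sq_eq_sq₀ (norm_nonneg _) (by positivity), ← Complex.ofReal_inj]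
    push_cast
    rw [φ.preGNS_norm_sq, ← Complex.ofReal_mul, ← hpa]
    refine hl2.trans ?_
    rw [Unitization.norm_inr, CStarRing.norm_star_mul_self]
    push_cast
    ring
  rcases eq_or_ne ‖a‖ 0 with h0 | h0
  · rw [h0]
    exact norm_nonneg _
  have h3 := (φ.gnsNonUnitalStarAlgHom a).le_opNorm (ξ : φ.GNS)
  rw [φ.gnsNonUnitalStarAlgHom_apply_coe, UniformSpace.Completion.norm_coe,
    UniformSpace.Completion.norm_coe, h2] at h3
  have h4 : ‖a‖ * ‖a‖ ≤ ‖φ.gnsNonUnitalStarAlgHom a‖ * ‖a‖ := h3.trans (by gcongr)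
  exact le_of_mul_le_mul_right h4 (lt_of_le_of_ne (norm_nonneg _) h0.symm)

end representations

/-! ### The conditional expectation of a crossed product by a discrete group -/

section reducedNorm

variable {G : Type u} [Group G] [TopologicalSpace G] [IsTopologicalGroup G] [MeasurableSpace G]
  [BorelSpace G] {ν : Measure G} [IsFiniteMeasureOnCompacts ν] [ν.IsMulLeftInvariant]
  {A : GCStarAlg G} {H : Type u} [NormedAddCommGroup H] [InnerProductSpace ℂ H] [CompleteSpace H]

set_option maxHeartbeats 1000000 in
theorem regNorms_apply (p : regNorms ν A) (f : C_c(G, A)) :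
    p.1 f = ‖regRep ν (regHilbRep ν p) f‖ :=
  congrFun p.2.choose_spec.choose_spec.choose_spec.choose_spec.choose_spec f

theorem norm_redVec_apply_le (p : regNorms ν A) (f : C_c(G, A)) :
    ‖(redVec ν A f).1 p‖ ≤ ‖redVec ν A f‖ :=
  lp.norm_apply_le_norm ENNReal.top_ne_zero _ p

theorem regNorms_apply_le (p : regNorms ν A) (f : C_c(G, A)) : p.1 f ≤ ‖κr ν A f‖ :=
  (regNorms_apply p f).trans_le (norm_redVec_apply_le p f)

/-- The direct sum has one summand for each norm function, so this particular norm function occurs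
in it. -/
theorem norm_regRep_le_norm_κr (π : A →⋆ₙₐ[ℂ] (H →L[ℂ] H)) (f : C_c(G, A)) :
    ‖regRep ν π f‖ ≤ ‖κr ν A f‖ :=
  regNorms_apply_le (⟨fun f => ‖regRep ν π f‖, H, _, _, _, π, rfl⟩ : regNorms ν A) f

theorem CrossedProductFunctor.norm_κr_le (μ : CrossedProductFunctor ν) (f : C_c(G, A)) :
    ‖κr ν A f‖ ≤ ‖κ ν A f‖ := by
  rw [← μ.s_q]
  exact (NonUnitalStarAlgHom.norm_apply_le (μ.s A) _).trans
    (NonUnitalStarAlgHom.norm_apply_le (μ.q A) _)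

variable [DiscreteTopology G]

/-- The vector `δ₁ ⊗ ξ` in `L²(G, H)`. -/
def singleVec (ν : Measure G) [IsFiniteMeasureOnCompacts ν] (ξ : H) : PreL2 ν H :=
  singleC (1 : G) ξ

theorem singleVec_fn_one (ξ : H) : (singleVec ν ξ).fn 1 = ξ := singleC_self 1 ξ

theorem singleVec_fn_of_ne (ξ : H) {s : G} (h : s ≠ 1) : (singleVec ν ξ).fn s = 0 :=
  singleC_of_ne h ξ

theorem norm_singleVec_sq (ξ : H) : ‖singleVec ν ξ‖ ^ 2 = ν.real {1} * ‖ξ‖ ^ 2 := by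
  rw [preL2_norm_sq, integral_eq_of_eq_zero ν 1, singleVec_fn_one, smul_eq_mul]
  intro s hs
  rw [singleVec_fn_of_ne ξ hs, norm_zero, zero_pow two_ne_zero]

/-- The matrix coefficient at δ₁ sees only f(1). One factor ν{1} comes from the inner product and
one from the integral over the group. -/
theorem inner_regRep_singleVec (π : A →⋆ₙₐ[ℂ] (H →L[ℂ] H)) (f : C_c(G, A)) (ξ η : H) :
    ⟪(singleVec ν η : L2 ν H), regRep ν π f (singleVec ν ξ : L2 ν H)⟫_ℂ =
      ν.real {1} • ν.real {1} • ⟪η, π (f 1) ξ⟫_ℂ := by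
  have h0 : ∀ s, ⟪(singleVec ν η : L2 ν H), regOp ν π (f s) s (singleVec ν ξ : L2 ν H)⟫_ℂ =
      ν.real {1} • ⟪η, π (f s) ((singleVec ν ξ).fn s⁻¹)⟫_ℂ := fun s => by
    rw [regOp, ContinuousLinearMap.completion_apply_coe, UniformSpace.Completion.inner_coe]
    refine (integral_eq_of_eq_zero ν 1 _ fun t ht => ?_).trans ?_
    · rw [singleVec_fn_of_ne η ht, inner_zero_left]
    · rw [singleVec_fn_one]
      change ν.real {1} • ⟪η, π (A.act 1⁻¹ (f s)) ((singleVec ν ξ).fn (s⁻¹ * 1))⟫_ℂ = _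
      rw [inv_one, A.act_one, mul_one]
  have hi := integrable_apply ν f (continuous_regOp ν π f) (fun s => norm_regOp_le ν π (f s) s)
    (singleVec ν ξ : L2 ν H)
  have h1 := (innerSL ℂ (singleVec ν η : L2 ν H)).integral_comp_comm hi
  refine h1.symm.trans ?_
  simp only [innerSL_apply_apply, h0]
  rw [integral_eq_of_eq_zero ν 1, inv_one, singleVec_fn_one]
  intro s hs
  rw [singleVec_fn_of_ne ξ (inv_ne_one.2 hs), map_zero, inner_zero_right, smul_zero]

/-- Cauchy–Schwarz for the coefficient with η = π(f(1)) ξ. Both test vectors carry a factor √ν{1},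
which cancels one of the two masses in the coefficient. -/
theorem norm_le_norm_regRep [ν.IsOpenPosMeasure] (π : A →⋆ₙₐ[ℂ] (H →L[ℂ] H)) (f : C_c(G, A)) :
    ν.real {1} * ‖π (f 1)‖ ≤ ‖regRep ν π f‖ := by
  have hν : 0 < ν.real {(1 : G)} :=
    lt_of_le_of_ne measureReal_nonneg (measureReal_singleton_ne_zero ν 1).symm
  rw [← le_div_iff₀' hν]
  refine ContinuousLinearMap.opNorm_le_bound _ (by positivity) fun ξ => ?_
  set η := π (f 1) ξ
  have h1 := norm_inner_le_norm (𝕜 := ℂ) (singleVec ν η : L2 ν H)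
    (regRep ν π f (singleVec ν ξ : L2 ν H))
  rw [inner_regRep_singleVec, norm_smul, norm_smul, Real.norm_of_nonneg hν.le,
    inner_self_eq_norm_sq_to_K, norm_pow] at h1
  have h2 := (regRep ν π f).le_opNorm (singleVec ν ξ : L2 ν H)
  rw [UniformSpace.Completion.norm_coe] at h1 h2
  have e1 := norm_singleVec_sq (ν := ν) η
  have e2 := norm_singleVec_sq (ν := ν) ξ
  have n1 : ‖singleVec ν η‖ = √(ν.real {1}) * ‖η‖ := by
    rw [← Real.sqrt_sq (norm_nonneg (singleVec ν η)), e1, Real.sqrt_mul hν.le,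
      Real.sqrt_sq (norm_nonneg _)]
  have n2 : ‖singleVec ν ξ‖ = √(ν.real {1}) * ‖ξ‖ := by
    rw [← Real.sqrt_sq (norm_nonneg (singleVec ν ξ)), e2, Real.sqrt_mul hν.le,
      Real.sqrt_sq (norm_nonneg _)]
  rw [n2] at h2
  rw [n1] at h1
  have h3 : ν.real {(1 : G)} * (ν.real {(1 : G)} * ‖η‖ ^ 2) ≤
      ν.real {(1 : G)} * ‖η‖ * (‖regRep ν π f‖ * ‖ξ‖) := by
    have hs : √(ν.real {(1 : G)}) * √(ν.real {(1 : G)}) = ν.real {1} := Real.mul_self_sqrt hν.le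
    have h4 := h1.trans (mul_le_mul_of_nonneg_left h2 (by positivity))
    have h5 : ‖((‖η‖ : ℝ) : ℂ)‖ = ‖η‖ := by simp
    refine le_trans (le_of_eq ?_) (h4.trans (le_of_eq ?_))
    · congr 3
      exact h5.symm
    · rw [show ∀ r x y z : ℝ, r * x * (y * (r * z)) = r * r * x * (y * z) from
        fun r x y z => by ring, hs]
  rcases eq_or_ne ‖η‖ 0 with h | h
  · rw [h]
    positivity
  · have hη : 0 < ‖η‖ := lt_of_le_of_ne (norm_nonneg _) h.symm
    have : ν.real {(1 : G)} * ‖η‖ ≤ ‖regRep ν π f‖ * ‖ξ‖ := by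
      refine le_of_mul_le_mul_left ?_ (mul_pos hν hη)
      linarith
    rw [div_mul_eq_mul_div, le_div_iff₀' hν]
    exact this

/-- Boundedness of f ↦ f(1). The functor μ enters because the comparison of the reduced norm with
the maximal one is read off from s ∘ q. -/
theorem CrossedProductFunctor.norm_apply_one_le [ν.IsOpenPosMeasure] (μ : CrossedProductFunctor ν)
    (f : C_c(G, A)) : ‖f 1‖ ≤ (ν.real {1})⁻¹ * ‖κ ν A f‖ := by
  have hν : 0 < ν.real {(1 : G)} :=
    lt_of_le_of_ne measureReal_nonneg (measureReal_singleton_ne_zero ν 1).symm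
  obtain ⟨H, _, _, _, π, hπ⟩ := exists_rep_norm_le (f 1)
  rw [← mul_le_mul_iff_right₀ hν, mul_inv_cancel_left₀ hν.ne']
  calc ν.real {1} * ‖f 1‖ ≤ ν.real {1} * ‖π (f 1)‖ := by gcongr
    _ ≤ ‖regRep ν π f‖ := norm_le_norm_regRep π f
    _ ≤ ‖κr ν A f‖ := norm_regRep_le_norm_κr π f
    _ ≤ ‖κ ν A f‖ := μ.norm_κr_le f

end reducedNorm

/-! ### The expectation f ↦ f(1) and its complete positivity. -/

section expectation

variable {G : Type u} [Group G] [TopologicalSpace G] [IsTopologicalGroup G]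
  [LocallyCompactSpace G] [MeasurableSpace G] [BorelSpace G] {ν : Measure G} [ν.IsHaarMeasure]
  {A : GCStarAlg G}

theorem star_κ_mul (f : C_c(G, A)) (x : MaxCP ν A) : star (κ ν A f) * x =
    ∫ s, (maxCanon ν A).u s⁻¹ ((maxCanon ν A).p (star (f s)) x) ∂ν := by
  rw [← CovRep.star_integrate_fst, maxCanon_integrate, ← map_star, coeM_fst]

variable (A) in
/-- The evaluation of functions at the unit element. -/
def evalOne : C_c(G, A) →ₗ[ℂ] A where
  toFun f := f 1
  map_add' _ _ := rfl
  map_smul' _ _ := rfl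

variable (ν A) in
/-- The extension of the evaluation at the unit element to the maximal crossed product. -/
def expectation : MaxCP ν A →L[ℂ] A := (evalOne A).extendOfNorm (κL ν A)

variable [DiscreteTopology G]

namespace CrossedProductFunctor

theorem expectation_κ (μ : CrossedProductFunctor ν) (f : C_c(G, A)) : expectation ν A (κ ν A f) = f 1 :=
  LinearMap.extendOfNorm_eq (denseRange_κ ν A)
    ⟨(ν.real {1})⁻¹, fun f => μ.norm_apply_one_le f⟩ f

theorem expectation_star_κ_mul_κ (μ : CrossedProductFunctor ν) (f g : C_c(G, A)) :
    expectation ν A (star (κ ν A f) * κ ν A g) =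
      ∫ s, star (A.act s⁻¹ (f s)) * A.act s⁻¹ (g s) ∂ν := by
  rw [star_κ_mul, ← (expectation ν A).integral_comp_comm
    ((maxCanon ν A).integrable_star_integrand ν f _)]
  refine integral_congr_ae (Filter.Eventually.of_forall fun s => ?_)
  have h1 : (maxCanon ν A).u s⁻¹ ((maxCanon ν A).p (star (f s)) (κ ν A g)) =
      κ ν A (translate s⁻¹ (constMul (star (f s)) g)) :=
    (congrArg _ ((isCanonical_maxCanon ν A).1 _ _)).trans ((isCanonical_maxCanon ν A).2 _ _)
  beta_reduce
  rw [h1, μ.expectation_κ]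
  change A.act s⁻¹ (star (f s) * g (s⁻¹⁻¹ * 1)) = _
  rw [inv_inv, mul_one, map_mul, map_star]

/-- On functions of finite support, E(f* g) is a finite sum of α_s⁻¹(f(s))* α_s⁻¹(g(s)) weighted by
ν{s}. With √ν{s} put into each factor it is a sum of Gram matrices, and positivity is a closed
condition. -/
theorem isPosMatrix_expectation (μ : CrossedProductFunctor ν) {k : ℕ}
    (x : Fin k → MaxCP ν A) :
    IsPosMatrix fun i j => expectation ν A (star (x i) * x j) := by
  refine (DenseRange.piMap fun _ : Fin k => denseRange_κ ν A).induction_on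
    (p := fun x => IsPosMatrix fun i j => expectation ν A (star (x i) * x j)) x ?_ fun f => ?_
  · refine isClosed_isPosMatrix.preimage (f := fun (x : Fin k → MaxCP ν A) i j =>
      expectation ν A (star (x i) * x j)) ?_
    fun_prop
  · have hfin : (⋃ i, Function.support (f i)).Finite := Set.finite_iUnion fun i =>
      (f i).hasCompactSupport.isCompact.finite_of_discrete.subset (subset_tsupport (f i))
    let T : Finset G := hfin.toFinset
    have hT : ∀ i s, s ∉ T → f i s = 0 := fun i s hs => by
      by_contra h
      exact hs (hfin.mem_toFinset.2 (Set.mem_iUnion.2 ⟨i, h⟩))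
    have h1 : ∀ i j, expectation ν A (star (κ ν A (f i)) * κ ν A (f j)) =
        ∑ s ∈ T, star ((√(ν.real {s}) : ℂ) • A.act s⁻¹ (f i s)) *
          ((√(ν.real {s}) : ℂ) • A.act s⁻¹ (f j s)) := fun i j => by
      rw [μ.expectation_star_κ_mul_κ, ← setIntegral_eq_integral_of_forall_compl_eq_zero
        (s := (T : Set G)) fun s hs => by rw [hT i s hs, map_zero, star_zero, zero_mul],
        setIntegral_finset _
          (continuous_of_discreteTopology.continuousOn.integrableOn_compact T.finite_toSet.isCompact)]
      refine Finset.sum_congr rfl fun s _ => ?_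
      rw [star_smul, smul_mul_smul_comm, Complex.star_def, Complex.conj_ofReal,
        ← Complex.ofReal_mul, Real.mul_self_sqrt measureReal_nonneg, Complex.coe_smul]
    have h2 := isPosMatrix_sum T (fun s i j => star ((√(ν.real {s}) : ℂ) • A.act s⁻¹ (f i s)) *
      ((√(ν.real {s}) : ℂ) • A.act s⁻¹ (f j s))) fun s _ => isPosMatrix_gram _
    simp only [← h1] at h2
    exact h2

end CrossedProductFunctor

end expectation

/-! ### The first diagonal corner of the linking algebra -/

section corner

variable {G : Type u} [Group G] [TopologicalSpace G] {A : GCStarAlg G} {B : Type u}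
  [NonUnitalCStarAlgebra B] (ρ : CovRep A B) (h : ∀ a, ∃ b, coeM B b = ρ.π a)

theorem LinkAlg.exists_mat_10 {ρ : CovRep A B} (x : LinkAlg ρ) : ∃ b, coeM B b = x.mat 1 0 := by
  obtain ⟨b, b₁, b₂, hx⟩ := x.exists_eq_mk
  exact ⟨b₂, by rw [hx, LinkAlg.mat_mk, mat2_10]⟩

theorem LinkAlg.exists_mat_00 (h : ∀ a, ∃ b, coeM B b = ρ.π a) (x : LinkAlg ρ) : ∃ b, coeM B b = x.mat 0 0 := by
  obtain ⟨b, b₁, b₂, hx⟩ := x.exists_eq_mk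
  obtain ⟨c, hc⟩ := h x.base
  exact ⟨c + b, by rw [hx, LinkAlg.mat_mk, mat2_00, map_add, hc]⟩

/-- The projection of the linking algebra to its first diagonal corner, if `π(A) ⊆ B`. -/
def corner : LinkAlg ρ →L[ℂ] B where
  toFun x := (LinkAlg.exists_mat_00 ρ h x).choose
  map_add' x y := coeM_injective (by
    refine (LinkAlg.exists_mat_00 ρ h (x + y)).choose_spec.trans
      (Eq.trans ?_ (map_add (coeM B) _ _).symm)
    rw [(LinkAlg.exists_mat_00 ρ h x).choose_spec, (LinkAlg.exists_mat_00 ρ h y).choose_spec,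
      map_add]
    rfl)
  map_smul' c x := coeM_injective (by
    refine (LinkAlg.exists_mat_00 ρ h (c • x)).choose_spec.trans
      (Eq.trans ?_ (map_smul (coeM B) _ _).symm)
    rw [(LinkAlg.exists_mat_00 ρ h x).choose_spec, map_smul]
    rfl)
  cont := by
    rw [(AddMonoidHomClass.isometry_of_norm (coeM B)
      norm_coeM).isUniformInducing.isInducing.continuous_iff]
    have : ∀ x, coeM B (LinkAlg.exists_mat_00 ρ h x).choose = x.mat 0 0 := fun x =>
      (LinkAlg.exists_mat_00 ρ h x).choose_spec
    refine Continuous.congr ?_ fun x => (this x).symm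
    exact (Mat2.continuous_apply 0 0).comp (continuous_hom LinkAlg.mat)

theorem coeM_corner (x : LinkAlg ρ) : coeM B (corner ρ h x) = x.mat 0 0 :=
  (LinkAlg.exists_mat_00 ρ h x).choose_spec

/-- On the first corner the action is conjugation by U_s; U_s b U_s* is written with left actions
only, as (U_s (U_s b)*)*. -/
theorem corner_linkAct (s : G) (x : LinkAlg ρ) :
    corner ρ h (linkAct ρ s x) = star (ρ.u s (star (ρ.u s (corner ρ h x)))) :=
  coeM_injective (by
    rw [coeM_corner, linkAct_mat, conjMat_00, ← coeM_corner ρ h, ρ.U_mul_coeM,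
      ρ.coeM_mul_star_U])

/-- (x* y)₁₁ = x₁₁* y₁₁ + x₂₁* y₂₁, and all four entries lie in B because π(A) does. So positivity
of E on Gram matrices over B is enough. -/
theorem isCompletelyPositive_comp_corner {C : Type u} [NonUnitalCStarAlgebra C] (E : B →L[ℂ] C)
    (hE : ∀ (k : ℕ) (x : Fin k → B), IsPosMatrix fun i j => E (star (x i) * x j)) :
    IsCompletelyPositive (E.comp (corner ρ h) : LinkAlg ρ →ₗ[ℂ] C) := by
  refine isCompletelyPositive_of_gram _ fun k x => ?_
  choose z hz using fun i => (x i).exists_mat_10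
  have key : ∀ i j, (E.comp (corner ρ h) : LinkAlg ρ →ₗ[ℂ] C) (star (x i) * x j) =
      ∑ c : Fin 2, E (star (if c = 0 then corner ρ h (x i) else z i) *
        (if c = 0 then corner ρ h (x j) else z j)) := fun i j => by
    change E (corner ρ h (star (x i) * x j)) = _
    rw [Fin.sum_univ_two, ← map_add]
    congr 1
    refine coeM_injective ?_
    rw [coeM_corner, map_mul, map_star, Mat2.mul_apply, Mat2.star_apply,
      Mat2.star_apply, map_add, map_mul, map_mul, map_star, map_star]
    simp [coeM_corner, hz]
  simp only [key]
  exact isPosMatrix_sum _ _ fun c _ => hE k fun i => if c = 0 then corner ρ h (x i) else z i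

theorem corner_mul_linkAHom (a b : A) (c d : B) (hc : coeM B c = ρ.π a) (hd : coeM B d = ρ.π b)
    (e : A) (he : B) (h_eq : coeM B he = ρ.π (a * star b * e)) :
    corner ρ h (linkOff ρ c * star (linkOff ρ d) * linkAHom ρ e) = he :=
  coeM_injective (by
    rw [coeM_corner, linkOff_mul_star_linkOff, linkAHom_apply, map_mul, Mat2.mul_apply]
    simp [h_eq, hc, hd, map_star ρ.π, map_star (coeM B)])

end corner

/-! ### Equivariance of the expectation. -/

section expectationEquivariant

variable {G : Type u} [Group G] [TopologicalSpace G] [IsTopologicalGroup G]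
  [LocallyCompactSpace G] [MeasurableSpace G] [BorelSpace G] {ν : Measure G} [ν.IsHaarMeasure]
  {A : GCStarAlg G} [DiscreteTopology G]

theorem CovRep.integrate_singleC {D : Type u} [NonUnitalCStarAlgebra D] (ρ : CovRep A D) (g : G)
    (a : A) : ρ.integrate ν (singleC g a) = (ν.real {g} : ℂ) • (ρ.π a * (ρ.U g : 𝓜(ℂ, D))) :=
  multiplier_ext fun d => by
    rw [integrate_singleC_fst, DoubleCentralizer.smul_fst, DoubleCentralizer.mul_fst,
      ← Complex.coe_smul]
    rfl

theorem conj_κ_singleC (s g : G) (a : A) :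
    star ((maxCanon ν A).u s (star ((maxCanon ν A).u s (κ ν A (singleC g a))))) =
      κ ν A (singleC (s * g * s⁻¹) (A.act s a)) :=
  coeM_injective (by
    rw [← CovRep.coeM_mul_star_U, ← CovRep.U_mul_coeM, ← maxCanon_integrate,
      ← maxCanon_integrate, CovRep.integrate_singleC, CovRep.integrate_singleC,
      (maxCanon ν A).covariant, map_mul, map_mul]
    -- On a discrete group left invariance gives all points the same mass, so no modular factor
    -- appears.
    have h1 : ν.real {s * g * s⁻¹} = ν.real {g} := by
      rw [measureReal_def, measureReal_def, Measure.haar_singleton, Measure.haar_singleton ν g]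
    have h2 : star ((maxCanon ν A).U s : 𝓜(ℂ, MaxCP ν A)) * ((maxCanon ν A).U s : 𝓜(ℂ, MaxCP ν A))
      = 1 := Unitary.coe_star_mul_self _
    have h3 : (((maxCanon ν A).U s * (maxCanon ν A).U g * (maxCanon ν A).U s⁻¹ :
        unitary 𝓜(ℂ, MaxCP ν A)) : 𝓜(ℂ, MaxCP ν A)) =
        ((maxCanon ν A).U s : 𝓜(ℂ, MaxCP ν A)) * ((maxCanon ν A).U g : 𝓜(ℂ, MaxCP ν A)) *
          star ((maxCanon ν A).U s : 𝓜(ℂ, MaxCP ν A)) := by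
      rw [(maxCanon ν A).star_U]
      rfl
    rw [h1, h3, mul_smul_comm, smul_mul_assoc]
    congr 1
    simp only [mul_assoc]
    rw [← mul_assoc (star _) (((maxCanon ν A).U s : 𝓜(ℂ, MaxCP ν A))) (_ * _), h2, one_mul])

/-- Conjugation by U_s sends a δ_g to α_s(a) δ_{sgs⁻¹}, and sgs⁻¹ = 1 only for g = 1. -/
theorem CrossedProductFunctor.expectation_conj (μ : CrossedProductFunctor ν) (s : G)
    (x : MaxCP ν A) :
    expectation ν A (star ((maxCanon ν A).u s (star ((maxCanon ν A).u s x)))) =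
      A.act s (expectation ν A x) := by
  refine (denseRange_κ ν A).induction_on (p := fun x =>
    expectation ν A (star ((maxCanon ν A).u s (star ((maxCanon ν A).u s x)))) =
      A.act s (expectation ν A x)) x (isClosed_eq (by fun_prop)
      ((continuous_hom _).comp (ContinuousLinearMap.continuous _))) fun f => ?_
  let S : Submodule ℂ C_c(G, A) :=
    { carrier := {f | expectation ν A
        (star ((maxCanon ν A).u s (star ((maxCanon ν A).u s (κL ν A f))))) =
          A.act s (expectation ν A (κL ν A f))}
      add_mem' := fun {f g} hf hg => by
        rw [Set.mem_ofPred_eq] at hf hg ⊢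
        simp only [map_add, star_add, hf, hg]
      zero_mem' := by
        rw [Set.mem_ofPred_eq]
        simp only [map_zero, star_zero]
      smul_mem' := fun c f hf => by
        rw [Set.mem_ofPred_eq] at hf ⊢
        simp only [map_smul, star_smul, star_star, hf] }
  refine mem_of_singleC_mem S (fun g a => ?_) f
  change expectation ν A (star ((maxCanon ν A).u s (star ((maxCanon ν A).u s
    (κ ν A (singleC g a)))))) = A.act s (expectation ν A (κ ν A (singleC g a)))
  rw [conj_κ_singleC, μ.expectation_κ, μ.expectation_κ]
  by_cases hg : g = 1
  · rw [hg, mul_one, mul_inv_cancel, singleC_self, singleC_self]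
  · rw [singleC_of_ne (Ne.symm hg), singleC_of_ne, map_zero]
    intro h1
    apply hg
    have := congrArg (fun t => s⁻¹ * t * s) h1
    simpa [mul_assoc] using this.symm

end expectationEquivariant

/-! ### Injectivity of Fell absorption for discrete groups -/

section absorptionInjective

variable {G : Type u} [Group G] [TopologicalSpace G] [IsTopologicalGroup G]
  [LocallyCompactSpace G] [MeasurableSpace G] [BorelSpace G] (ν : Measure G) [ν.IsHaarMeasure]
  (A : GCStarAlg G) [DiscreteTopology G]

/-- The element of the maximal crossed product that implements the coefficient `a`. -/
def ofCoeff (a : A) : MaxCP ν A := κ ν A (singleC 1 ((ν.real {1} : ℂ)⁻¹ • a))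

theorem coeM_ofCoeff (a : A) : coeM (MaxCP ν A) (ofCoeff ν A a) = (maxCanon ν A).π a := by
  have h : (ν.real {1} : ℂ) ≠ 0 := Complex.ofReal_ne_zero.2 (measureReal_singleton_ne_zero ν 1)
  rw [ofCoeff, ← maxCanon_integrate, CovRep.integrate_singleC, map_one, map_smul, smul_mul_assoc,
    smul_smul, mul_inv_cancel₀ h, one_smul]
  exact mul_one _

/-- The expectation of the first corner of the linking algebra of the universal representation. -/
def linkExpectation : link (maxCanon ν A) →L[ℂ] A :=
  (expectation ν A).comp (corner (maxCanon ν A) fun a => ⟨_, coeM_ofCoeff ν A a⟩)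

variable {ν}

namespace CrossedProductFunctor

theorem expectation_ofCoeff (μ : CrossedProductFunctor ν) (a : A) :
    expectation ν A (ofCoeff ν A a) = (ν.real {1} : ℂ)⁻¹ • a := by
  rw [ofCoeff, μ.expectation_κ, singleC_self]

theorem isCompletelyPositive_linkExpectation (μ : CrossedProductFunctor ν) :
    IsCompletelyPositive (linkExpectation ν A : link (maxCanon ν A) →ₗ[ℂ] A) :=
  isCompletelyPositive_comp_corner (maxCanon ν A) (fun a => ⟨_, coeM_ofCoeff ν A a⟩)
    (expectation ν A) fun _ x => μ.isPosMatrix_expectation x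

theorem linkExpectation_act (μ : CrossedProductFunctor ν) (s : G) (x : link (maxCanon ν A)) :
    linkExpectation ν A ((link (maxCanon ν A)).act s x) = A.act s (linkExpectation ν A x) :=
  (congrArg (expectation ν A) (corner_linkAct (maxCanon ν A) _ s x)).trans
    (μ.expectation_conj s _)

/-- The map that undoes absorption: E returns the coefficient a b* e from the first corner, up to
the factor ν{1}⁻¹ that normalizes `ofCoeff`. -/
theorem linkExpectation_mul (μ : CrossedProductFunctor ν) (a b e : A) :
    linkExpectation ν A (linkOffL (maxCanon ν A) (trivialOf G (ofCoeff ν A a)) *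
      star (linkOffL (maxCanon ν A) (trivialOf G (ofCoeff ν A b))) *
      (linkA (maxCanon ν A)).hom e) = (ν.real {1} : ℂ)⁻¹ • (a * star b * e) :=
  (congrArg (expectation ν A) (corner_mul_linkAHom (maxCanon ν A)
    (fun a => ⟨_, coeM_ofCoeff ν A a⟩) a b _ _ (coeM_ofCoeff ν A a)
    (coeM_ofCoeff ν A b) e _ (coeM_ofCoeff ν A _))).trans (μ.expectation_ofCoeff A _)

variable {A} {μ : CrossedProductFunctor ν} {B : Type u} [NonUnitalCStarAlgebra B]

/-- Ψ(y) = 0 means that y annihilates the range of R. Applied to the point mass of b at 1 and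
followed by the adjoint, this leaves the single term (b e₁₂)* y*. -/
theorem IsCorrespondence.canon_p_star_linkOff_eq_zero (hμ : μ.IsCorrespondence) (ρ : CovRep A B)
    {y : μ.obj A} (hy : hμ.absorbHom ρ y = 0) (b : GCStarAlg.trivial G B) :
    (μ.canon (link ρ)).p (star (linkOffL ρ b)) (μ.map (linkA ρ) (star y)) = 0 := by
  have h1 := hμ.tensorOff_absorbHom ρ y (μ.incl _ (singleC 1 b))
  rw [hy, DoubleCentralizer.zero_fst, _root_.zero_apply, map_zero, hμ.tensorOff_incl,
    offL_apply] at h1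
  have h2 : star (μ.incl (link ρ) (compC (linkOffL ρ) (singleC 1 b))) *
      μ.map (linkA ρ) (star y) = 0 := by
    have := congrArg star h1
    rw [star_zero, star_mul, ← map_star] at this
    exact this.symm
  rw [star_incl_mul, integral_eq_of_eq_zero ν 1] at h2
  · have h3 : compC (linkOffL ρ) (singleC 1 b) (1 : G) = linkOffL ρ b :=
      congrArg (linkOffL ρ) (singleC_self (1 : G) b)
    have h4 := (smul_eq_zero.1 h2).resolve_left (measureReal_singleton_ne_zero ν 1)
    rw [h3, inv_one, CovRep.u_one] at h4
    exact h4
  · intro s hs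
    have h3 : compC (linkOffL ρ) (singleC 1 b) s = 0 :=
      (congrArg (linkOffL ρ) (singleC_of_ne hs b)).trans (map_zero (linkOffL ρ))
    rw [h3, star_zero]
    simp [CovRep.p]

theorem IsCorrespondence.exists_map_linkExpectation (hμ : μ.IsCorrespondence) (a b : A) :
    ∃ Φ : μ.obj (link (maxCanon ν A)) →L[ℂ] μ.obj A, ∀ y : μ.obj A,
      Φ ((μ.canon (link (maxCanon ν A))).p (linkOffL (maxCanon ν A) (trivialOf G (ofCoeff ν A a)) *
        star (linkOffL (maxCanon ν A) (trivialOf G (ofCoeff ν A b))))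
        (μ.map (linkA (maxCanon ν A)) y)) =
      (ν.real {1} : ℂ)⁻¹ • (μ.canon A).p (a * star b) y := by
  obtain ⟨Φ, hΦ⟩ := hμ.exists_map (linkExpectation ν A)
    (μ.isCompletelyPositive_linkExpectation A) (μ.linkExpectation_act A)
  refine ⟨Φ, fun y => ?_⟩
  have hc := continuous_hom (μ.map (linkA (maxCanon ν A)))
  refine (μ.denseRange_incl A).induction_on (p := fun y => Φ ((μ.canon (link (maxCanon ν A))).p
      (linkOffL (maxCanon ν A) (trivialOf G (ofCoeff ν A a)) *
        star (linkOffL (maxCanon ν A) (trivialOf G (ofCoeff ν A b))))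
        (μ.map (linkA (maxCanon ν A)) y)) =
      (ν.real {1} : ℂ)⁻¹ • (μ.canon A).p (a * star b) y) y
    (isClosed_eq (by fun_prop) (by fun_prop)) fun f => ?_
  rw [map_incl, canon_p_incl, hΦ, canon_p_incl, ← inclL_apply, ← inclL_apply, ← map_smul]
  congr 1
  exact DFunLike.ext _ _ fun t => μ.linkExpectation_mul A a b (f t)

/-- If y is in the kernel, then a e₁₂ (b e₁₂)* y* = 0 in the crossed product by L, and the map
induced by the expectation turns this into a b* y* = 0. Nondegeneracy of A, used twice, removes a
and b. -/
theorem IsCorrespondence.absorbHom_maxCanon_injective (hμ : μ.IsCorrespondence)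
    (A : GCStarAlg G) : Function.Injective (hμ.absorbHom (maxCanon ν A)) := by
  refine (injective_iff_map_eq_zero _).2 fun y hy => star_eq_zero.1 ?_
  have h : ∀ a b : A, (μ.canon A).p a ((μ.canon A).p (star b) (star y)) = 0 := fun a b => by
    obtain ⟨Φ, hΦ⟩ := hμ.exists_map_linkExpectation a b
    have h1 := hΦ (star y)
    rw [CovRep.p_mul, hμ.canon_p_star_linkOff_eq_zero _ hy, map_zero, map_zero] at h1
    rw [← CovRep.p_mul]
    exact (smul_eq_zero.1 h1.symm).resolve_left
      (inv_ne_zero (Complex.ofReal_ne_zero.2 (measureReal_singleton_ne_zero ν 1)))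
  refine μ.eq_zero_of_canon_p_eq_zero fun b => ?_
  rw [← star_star b]
  exact μ.eq_zero_of_canon_p_eq_zero fun a => h a (star b)

end CrossedProductFunctor

end absorptionInjective

end

end ExoticCP

/-! ### Fell absorption and the coproduct for the universal representation. -/

theorem mainTheorem2 {G : Type u} [Group G] [TopologicalSpace G] [IsTopologicalGroup G]
    [LocallyCompactSpace G] [T2Space G] [MeasurableSpace G] [BorelSpace G]
    (ν : Measure G) [ν.IsHaarMeasure] [ν.Regular]
    (μ : CrossedProductFunctor ν) (hμ : μ.IsCorrespondence) :
    -- the canonical unitaries `u_{G,μ} = υ.U` in the multiplier algebra of `C*_μ G`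
    ∃ υ : CovRep (GCStarAlg.scalars G) μ.groupAlg,
      IsCanonical (μ.incl (GCStarAlg.scalars G)) υ ∧
      -- Fell absorption for every `G`-C*-algebra `A`
      (∀ A : GCStarAlg G,
        ∃ (ι : CovRep A (MaxCP ν A))
          (τ : MaxCP ν A →L[ℂ] μ.groupAlg →L[ℂ] μ.tensor (MaxCP ν A))
          (Θ : CovRep A (μ.tensor (MaxCP ν A))),
          IsCanonical (κ ν A) ι ∧ μ.IsTensorMap τ ∧
          (∀ a b c, (Θ.π a).fst (τ b c) = τ ((ι.π a).fst b) c) ∧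
          (∀ s b c, (Θ.U s : 𝓜(ℂ, μ.tensor (MaxCP ν A))).fst (τ b c) =
            τ ((ι.U s : 𝓜(ℂ, MaxCP ν A)).fst b) ((υ.U s : 𝓜(ℂ, μ.groupAlg)).fst c)) ∧
          Θ.Nondegenerate ∧
          ∃ Φ : MaxCP ν A →⋆ₙₐ[ℂ] 𝓜(ℂ, μ.tensor (MaxCP ν A)),
            (∀ f, Φ (κ ν A f) = Θ.integrate ν f) ∧
            ∃ Ψ : μ.obj A →⋆ₙₐ[ℂ] 𝓜(ℂ, μ.tensor (MaxCP ν A)),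
              (∀ x, Ψ (μ.q A x) = Φ x) ∧
              (∀ Ψ' : μ.obj A →⋆ₙₐ[ℂ] 𝓜(ℂ, μ.tensor (MaxCP ν A)),
                (∀ x, Ψ' (μ.q A x) = Φ x) → Ψ' = Ψ) ∧
              (DiscreteTopology G → Function.Injective Ψ)) ∧
      -- the coproduct
      ∃ (ω : CovRep (GCStarAlg.scalars G) (MaxGroupAlg ν))
        (τ : MaxGroupAlg ν →L[ℂ] μ.groupAlg →L[ℂ] μ.tensor (MaxGroupAlg ν)),
        IsCanonical (κ ν (GCStarAlg.scalars G)) ω ∧ μ.IsTensorMap τ ∧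
        (∃ (W : G →* unitary 𝓜(ℂ, μ.tensor (MaxGroupAlg ν)))
          (Δ : μ.groupAlg →⋆ₙₐ[ℂ] 𝓜(ℂ, μ.tensor (MaxGroupAlg ν))),
          (∀ g b c, (W g : 𝓜(ℂ, μ.tensor (MaxGroupAlg ν))).fst (τ b c) =
            τ ((ω.U g : 𝓜(ℂ, MaxGroupAlg ν)).fst b) ((υ.U g : 𝓜(ℂ, μ.groupAlg)).fst c)) ∧
          NondegenerateHom Δ ∧
          ∀ g x, Δ ((υ.U g : 𝓜(ℂ, μ.groupAlg)).fst x) =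
            (W g : 𝓜(ℂ, μ.tensor (MaxGroupAlg ν))) * Δ x) ∧
        (DiscreteTopology G →
          ∃ (w : G → MaxGroupAlg ν) (v : G → μ.groupAlg),
            (∀ g, DoubleCentralizer.coe ℂ (w g) = (ω.U g : 𝓜(ℂ, MaxGroupAlg ν))) ∧
            (∀ g, DoubleCentralizer.coe ℂ (v g) = (υ.U g : 𝓜(ℂ, μ.groupAlg))) ∧
            ∃ Δ : μ.groupAlg →⋆ₙₐ[ℂ] μ.tensor (MaxGroupAlg ν),
              ∀ g, Δ (v g) = τ (w g) (v g)) := by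
  have hmax := fun A : GCStarAlg G => hμ.absorb_nondegenerate (maxCanon ν A) (denseRange_κ ν A)
    (maxCanon_integrate ν)
  refine ⟨μ.canon _, μ.isCanonical_canon _, fun A => ?_, ?_⟩
  -- Φ is taken to be Ψ ∘ q, so the factorization holds by definition and the content is that Φ is
  -- the integrated form. Uniqueness of Ψ is surjectivity of q.
  · refine ⟨maxCanon ν A, hμ.tensorMap (maxCanon ν A), hμ.absorb (maxCanon ν A),
      isCanonical_maxCanon ν A, hμ.tensorMap_incl _, hμ.absorb_p_tensorMap _,
      hμ.absorb_u_tensorMap _, hmax A, (hμ.absorbHom (maxCanon ν A)).comp (μ.q A),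
      hμ.absorbHom_incl _, hμ.absorbHom (maxCanon ν A), fun x => rfl, fun Ψ' h => ?_,
      fun _ => hμ.absorbHom_maxCanon_injective A⟩
    refine DFunLike.ext _ _ fun y => ?_
    obtain ⟨x, rfl⟩ := μ.q_surjective A y
    exact h x
  -- The coproduct is absorption for A = ℂ, where W is the unitary part of the absorbed
  -- representation and Δ is Ψ.
  · let ρ := maxCanon ν (GCStarAlg.scalars G)
    refine ⟨ρ, hμ.tensorMap ρ, isCanonical_maxCanon ν _, hμ.tensorMap_incl ρ,
      ⟨(hμ.absorb ρ).U, hμ.absorbHom ρ, hμ.absorb_u_tensorMap ρ,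
        hμ.absorbHom_nondegenerate ρ (hmax _), hμ.absorbHom_canon_u ρ⟩, fun _ => ?_⟩
    have h1 := (isCanonical_maxCanon ν (GCStarAlg.scalars G)).p_one (denseRange_κ ν _)
    have hw : ∀ g, coeM _ (κ ν _ (deltaC ν g)) = (ρ.U g : 𝓜(ℂ, MaxGroupAlg ν)) := fun g => by
      rw [← maxCanon_integrate, CovRep.integrate_deltaC ν _ h1]
    obtain ⟨Δ, hΔ⟩ := hμ.exists_coproduct ρ h1 (fun g => κ ν _ (deltaC ν g)) hw
    refine ⟨fun g => κ ν _ (deltaC ν g), fun g => μ.incl _ (deltaC ν g), hw, fun g => ?_, Δ, hΔ⟩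
    refine (μ.canon_integrate (deltaC ν g)).symm.trans (CovRep.integrate_deltaC ν _ ?_ g)
    exact (μ.isCanonical_canon _).p_one (μ.denseRange_incl _)
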